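/- Let $\mathbb D=\{z\in\mathbb C:|z|<1\}$, let $\mathbb T$ be the unit circle with arc length $|d\xi|$, and let $m$ be the normalized area Lebesgue measure on $\mathbb D$. For $\beta\in(0,1)$ and $\xi\in\mathbb T$ put $$\Gamma_\beta(\xi)=\{z\in\mathbb D:|z|<\beta\}\cup\bigcup_{|z|<\beta}[z,\xi),$$ where $[z,\xi)=\{(1-t)z+t\xi:0\le t<1\}$. For $\alpha\in\mathbb D$ and $\eta\in(0,1)$ put $$\Delta(\alpha,\eta)=\Big\{z\in\mathbb D:\Big|\frac{\alpha-z}{1-\overline{\alpha}z}\Big|<\eta\Big\},\qquad \Delta_\eta(\alpha)=\{z\in\mathbb D:|z-\alpha|<\eta(1-|\alpha|)\}.$$ For $1\le p,q<\infty$, let $T^q_p$ be the space of measurable functions $f$ on $\mathbb D$ with $$\|f\|_{T^q_p}=\left(\int_{\mathbb T}\left(\int_{\Gamma_{1/2}(\xi)}|f(z)|^p\,\frac{dm(z)}{1-|z|}\right)^{q/p}|d\xi|\right)^{1/q}<\infty,$$ and let $AT^q_p$ be the set of those $f\in T^q_p$ that are analytic in $\mathbb D$. **Theorem.** Let $1\le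 p,q<\infty$ and let $G\subseteq\mathbb D$ be a measurable set. The following assertions are equivalent: (a) There are $\beta\in(0,1)$ and a constant $K>0$ such that $$\left(\int_{\mathbb T}\left(\int_{\Gamma_\beta(\xi)\cap G}|f(z)|^p\,\frac{dm(z)}{1-|z|}\right)^{q/p}|d\xi|\right)^{1/q}\ge K\,\|f\|_{T^q_p}\qquad\text{for every } f\in AT^q_p.$$ (b) There are $\eta\in(0,1)$ and $\delta>0$ such that $m(G\cap\Delta(\alpha,\eta))\ge\delta\,m(\Delta(\alpha,\eta))$ for every $\alpha\in\mathbb D$. (c) There are $\eta\in(0,1)$ and $\delta>0$ such that $m(G\cap\Delta_\eta(\alpha))\ge\delta\,m(\Delta_\eta(\alpha))$ for every $\alpha\in\mathbb D$. -/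

import Mathlib

open MeasureTheory Set
open scoped ENNReal ComplexConjugate

noncomputable section

namespace AnalyticTent

/-- The open unit disc `𝔻` of the complex plane. -/
def unitDisc : Set ℂ := Metric.ball (0 : ℂ) 1

/-- The normalized area Lebesgue measure `m` of the unit disc (so that `m(𝔻) = 1`),
as a measure on `ℂ` carried by the disc. -/
def area : Measure ℂ := (ENNReal.ofReal Real.pi)⁻¹ • volume.restrict unitDisc

/-- The pseudohyperbolic disc `Δ(α, η) = {z ∈ 𝔻 : |(α - z) / (1 - conj α * z)| < η}`. -/
def pseudoDisc (α : ℂ) (η : ℝ) : Set ℂ :=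
  {z | z ∈ unitDisc ∧ ‖(α - z) / (1 - conj α * z)‖ < η}

/-- The Euclidean disc `Δ_η(α) = {z ∈ 𝔻 : |z - α| < η (1 - |α|)}`. -/
def euclDisc (η : ℝ) (α : ℂ) : Set ℂ :=
  {z | z ∈ unitDisc ∧ ‖z - α‖ < η * (1 - ‖α‖)}

/-- The half-open segment `[z, ξ) = {(1 - t) z + t ξ : 0 ≤ t < 1}`. -/
def halfOpenSegment (z ξ : ℂ) : Set ℂ :=
  (fun t : ℝ => (1 - (t : ℂ)) * z + (t : ℂ) * ξ) '' Ico (0 : ℝ) 1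

/-- The cone-like region `Γ_β(ξ) = {z ∈ 𝔻 : |z| < β} ∪ ⋃_{|z| < β} [z, ξ)`. -/
def cone (β : ℝ) (ξ : ℂ) : Set ℂ :=
  {z | z ∈ unitDisc ∧ ‖z‖ < β} ∪ ⋃ z ∈ {z : ℂ | ‖z‖ < β}, halfOpenSegment z ξ

/-- `(∫_𝕋 (∫_{Γ_β(ξ) ∩ G} |f|^p dm / (1 - |z|))^{q/p} |dξ|)^{1/q}` in `[0, ∞]`, where the circle is
parametrized as `ξ = e^{iθ}`, `0 < θ ≤ 2π`, so that `|dξ| = dθ` is arc length. -/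
def tentFunctional (β p q : ℝ) (G : Set ℂ) (f : ℂ → ℂ) : ℝ≥0∞ :=
  (∫⁻ θ in Ioc (0 : ℝ) (2 * Real.pi),
    (∫⁻ z in cone β (Complex.exp (θ * Complex.I)) ∩ G,
      ‖f z‖ₑ ^ p / ENNReal.ofReal (1 - ‖z‖) ∂area) ^ (q / p)) ^ (1 / q)

/-- The tent space norm `‖f‖_{T^q_p}`, with values in `[0, ∞]`; its region is `Γ_{1/2}(ξ)`. -/
def tentNorm (p q : ℝ) (f : ℂ → ℂ) : ℝ≥0∞ := tentFunctional (1 / 2) p q unitDisc f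

/-- The tent space `T^q_p`: the (Lebesgue) measurable functions on the disc of finite norm.
Values off the disc play no role. -/
def tentSpace (p q : ℝ) : Set (ℂ → ℂ) :=
  {f | AEMeasurable f (volume.restrict unitDisc) ∧ tentNorm p q f < ∞}

/-- The analytic tent space `AT^q_p`: the members of `T^q_p` that are holomorphic in the disc. -/
def analyticTentSpace (p q : ℝ) : Set (ℂ → ℂ) :=
  {f | DifferentiableOn ℂ f unitDisc} ∩ tentSpace p q

end AnalyticTent

end

namespace AnalyticTent

/-! With `tentMeasure p G f`, the measure |f|^p dm/(1 - |z|) on G, the tent functional is the L^s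
norm (s = q/p), up to outer powers, of the function sending ξ to the mass of the cone at ξ.
Statements about apertures thus become statements about arbitrary s-finite measures.

Density implies domination. Since |f|^r is subharmonic for every r > 0, the sub-mean value property
may be used with r = p/(n+1). Hölder's inequality on the part of a disc outside G then gains a power
of its relative area 1 - δ, and for large n the value |f(c)|^p is at most a small multiple ε of its
mean over the disc plus a large multiple of its mean over G
(`exists_volume_ball_mul_enorm_rpow_le`). Integrating over a cone gives the same inequality for tent
measures, at the price of a wider cone (`tentMeasure_cone_half_le`). Change of aperture
(`lintegral_cone_rpow_le`) brings the ε-term back to aperture 1/2, where it is absorbed because the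
norm of f is finite. Change of aperture rests on Tonelli and the maximal theorem on the circle:
duality for s > 1, direct comparison of arcs for s = 1, and a weight (Mg)^(-a) with Hölder's
inequality for s < 1.

Domination implies density. Test on (1 - conj α z)⁻⁴. Off the pseudohyperbolic disc of radius η
about α, (1 - |z|)(1 - |α|) ≤ (1 - η²)|1 - conj α z|², so that part contributes at most a small
multiple of the q-th power of the norm when η is near 1 (`exists_lintegral_tentMeasure_testFun_le`).
The rest must come from G inside the disc, where the contribution is controlled by the area of that
piece (`exists_lintegral_tentMeasure_testFun_inter_le`).

The two density conditions are compared through the explicit Euclidean centre and radius of a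
pseudohyperbolic disc (`pseudoDisc_eq_ball`). -/

lemma mem_unitDisc {z : ℂ} : z ∈ unitDisc ↔ ‖z‖ < 1 := by simp [unitDisc]

/-! ### Geometry and measurability of the cones -/

/-- The cone with vertex `ξ` is the union of the discs `|z - t ξ| < β (1 - t)`. -/
lemma mem_cone_iff {β : ℝ} {ξ z : ℂ} :
    z ∈ cone β ξ ↔ ∃ t ∈ Ico (0 : ℝ) 1, ‖z - t * ξ‖ < β * (1 - t) := by
  constructor
  · rintro (⟨_, hz⟩ | hz)
    · exact ⟨0, by simp, by simpa using hz⟩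
    · simp only [mem_iUnion, halfOpenSegment, mem_image, mem_ofPred_eq] at hz
      obtain ⟨w, hw, t, ht, rfl⟩ := hz
      refine ⟨t, ht, ?_⟩
      have h1 : (0 : ℝ) < 1 - t := by linarith [ht.2]
      have : (1 - (t : ℂ)) * w + t * ξ - t * ξ = ((1 - t : ℝ) : ℂ) * w := by push_cast; ring
      rw [this, norm_mul, Complex.norm_real, Real.norm_of_nonneg h1.le, mul_comm]
      gcongr
  · rintro ⟨t, ht, h⟩
    right
    have h1 : (0 : ℝ) < 1 - t := by linarith [ht.2]
    have h1' : ((1 - t : ℝ) : ℂ) ≠ 0 := by exact_mod_cast h1.ne'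
    simp only [mem_iUnion, halfOpenSegment, mem_image, mem_ofPred_eq]
    refine ⟨(z - t * ξ) / ((1 - t : ℝ) : ℂ), ?_, t, ht, ?_⟩
    · rw [norm_div, Complex.norm_real, Real.norm_of_nonneg h1.le, div_lt_iff₀ h1]
      exact h
    · push_cast at h1' ⊢
      field_simp
      ring

lemma norm_lt_one_of_mem_cone {β : ℝ} (hβ : β < 1) {ξ z : ℂ} (hξ : ‖ξ‖ = 1)
    (hz : z ∈ cone β ξ) : ‖z‖ < 1 := by
  obtain ⟨t, ht, h⟩ := mem_cone_iff.1 hz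
  have h1 : ‖z‖ ≤ ‖z - t * ξ‖ + ‖(t : ℂ) * ξ‖ := by
    simpa using norm_add_le (z - t * ξ) (t * ξ)
  rw [norm_mul, hξ, Complex.norm_real, Real.norm_of_nonneg ht.1] at h1
  nlinarith [ht.2]

/-- For the disc about tξ that contains z, |z - ξ| ≤ (1 + β)(1 - t) while 1 - |z| ≥ (1 - β)(1 - t).
-/
lemma norm_sub_le_of_mem_cone {β : ℝ} (hβ : β < 1) {ξ z : ℂ} (hξ : ‖ξ‖ = 1)
    (hz : z ∈ cone β ξ) : ‖z - ξ‖ ≤ 2 / (1 - β) * (1 - ‖z‖) := by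
  obtain ⟨t, ht, h⟩ := mem_cone_iff.1 hz
  have h1 : ‖z‖ ≤ ‖z - t * ξ‖ + ‖(t : ℂ) * ξ‖ := by
    simpa using norm_add_le (z - t * ξ) (t * ξ)
  rw [norm_mul, hξ, Complex.norm_real, Real.norm_of_nonneg ht.1] at h1
  have ht1 : 0 < 1 - t := by linarith [ht.2]
  have h2 : ‖z - ξ‖ ≤ ‖z - t * ξ‖ + (1 - t) := by
    have e : z - ξ = (z - t * ξ) - ((1 - t : ℝ) : ℂ) * ξ := by push_cast; ring
    rw [e]
    refine (norm_sub_le _ _).trans ?_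
    rw [norm_mul, hξ, Complex.norm_real, Real.norm_of_nonneg ht1.le, mul_one]
  have hb : 0 < 1 - β := by linarith
  rw [div_mul_eq_mul_div, le_div_iff₀ hb]
  have h3 : (1 - β) * (1 - t) ≤ 1 - ‖z‖ := by linarith
  have h4 : ‖z - ξ‖ ≤ (1 + β) * (1 - t) := by linarith
  have h5 : 0 ≤ 1 + β := by
    by_contra! hh
    nlinarith [norm_nonneg (z - ξ)]
  calc ‖z - ξ‖ * (1 - β) ≤ (1 + β) * (1 - t) * (1 - β) := by gcongr
    _ = (1 + β) * ((1 - β) * (1 - t)) := by ring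
    _ ≤ (1 + β) * (1 - ‖z‖) := by gcongr
    _ ≤ 2 * (1 - ‖z‖) := by
      have : 0 ≤ 1 - ‖z‖ := le_trans (by positivity) h3
      gcongr; linarith

/-- Nontangential regions are contained in cones of large aperture. -/
lemma mem_cone_of_norm_sub_le {C : ℝ} (hC : 1 ≤ C) {ξ z : ℂ} (hξ : ‖ξ‖ = 1) (hz : ‖z‖ < 1)
    (h : ‖z - ξ‖ ≤ C * (1 - ‖z‖)) : z ∈ cone (1 - 1 / (4 * C ^ 2)) ξ := by
  have hC0 : 0 < C := by linarith
  set κ : ℝ := 1 / (4 * C ^ 2) with hκ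
  have hκ0 : 0 < κ := by positivity
  have hκC : 4 * (κ * C ^ 2) = 1 := by rw [hκ]; field_simp
  have hκ1 : κ ≤ 1 / 4 := by
    have : (1 : ℝ) ≤ C ^ 2 := one_le_pow₀ hC
    nlinarith
  rw [mem_cone_iff]
  have hpos : 0 < ‖z - ξ‖ := by
    rw [norm_pos_iff, sub_ne_zero]; rintro rfl; linarith
  by_cases hu : C * ‖z - ξ‖ ≤ 1
  -- Put d = |z - ξ|, so that 1 - t = Cd. The law of cosines and Cd + |z| ≥ 1 give |z - tξ|² ≤ (Cd)²
  -- - d², and the choice κC² = 1/4 makes ((1 - κ)Cd)² at least (Cd)² - d²/2.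
  · refine ⟨1 - C * ‖z - ξ‖, ⟨by linarith, by nlinarith⟩, ?_⟩
    have hsub : ‖z - ξ‖ ^ 2 = ‖z‖ ^ 2 + 1 - 2 * inner ℝ z ξ := by
      rw [norm_sub_sq_real, hξ]; ring
    have hsub2 : ‖z - ((1 - C * ‖z - ξ‖ : ℝ) : ℂ) * ξ‖ ^ 2 = ‖z‖ ^ 2 + (1 - C * ‖z - ξ‖) ^ 2
        - 2 * (1 - C * ‖z - ξ‖) * inner ℝ z ξ := by
      rw [← Complex.real_smul, norm_sub_sq_real, inner_smul_right, norm_smul, hξ,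
        Real.norm_eq_abs, mul_one, sq_abs]; ring
    set d := ‖z - ξ‖
    have hin : 2 * inner ℝ z ξ = ‖z‖ ^ 2 + 1 - d ^ 2 := by linarith
    have hz0 := norm_nonneg z
    refine lt_of_pow_lt_pow_left₀ 2 (by nlinarith [mul_pos hC0 hpos]) ?_
    have e1 : ‖z - ((1 - C * d : ℝ) : ℂ) * ξ‖ ^ 2
        = C * d * (‖z‖ ^ 2 - 1) + (C * d) ^ 2 + (1 - C * d) * d ^ 2 := by
      rw [hsub2]
      linear_combination (-(1 - C * d)) * hin
    rw [e1]
    have e2 : C * d * (1 - ‖z‖ ^ 2) ≥ d ^ 2 * (1 + ‖z‖) := by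
      have : (0:ℝ) ≤ (C * (1 - ‖z‖) - d) * (d * (1 + ‖z‖)) :=
        mul_nonneg (by linarith) (by positivity)
      nlinarith
    have e3 : ((1 - κ) * (1 - (1 - C * d))) ^ 2 = (C * d) ^ 2 - d ^ 2 / 2 + κ ^ 2 * (C * d) ^ 2 := by
      have : κ * C ^ 2 = 1 / 4 := by linarith
      linear_combination (-2 * d ^ 2) * this
    rw [e3]
    have e4 : 0 < d ^ 2 := by positivity
    have e5 : 0 ≤ κ ^ 2 * (C * d) ^ 2 := by positivity
    have e6 : 1 ≤ d + ‖z‖ := by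
      have := norm_sub_norm_le ξ z
      rw [hξ, norm_sub_rev] at this
      linarith
    have e7 : d ≤ C * d := le_mul_of_one_le_left hpos.le hC
    have e8 : 0 ≤ d ^ 2 * (C * d + ‖z‖ - 1) := mul_nonneg e4.le (by linarith)
    linarith
  -- Here z is far from ξ: 1 - |z| ≥ |z - ξ|/C > 1/C² > κ, so the central disc t = 0 suffices.
  · refine ⟨0, by simp, ?_⟩
    push Not at hu
    have : 1 < C ^ 2 * (1 - ‖z‖) := by nlinarith
    have : κ < 1 - ‖z‖ := by
      by_contra! hh
      nlinarith
    simp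
    linarith

/-- Take t = |α| and split w - |α|ξ = (w - α) - |α|(ξ - ζ). This is the lower bound for shadows: a
whole arc of length comparable to 1 - |α| sees the same disc about α. -/
lemma mem_cone_half {α ζ ξ w : ℂ} (hα : ‖α‖ < 1) (hζ : α = ‖α‖ * ζ)
    (hξ : ‖ξ - ζ‖ < (1 - ‖α‖) / 4) (hw : ‖w - α‖ ≤ (1 - ‖α‖) / 4) : w ∈ cone (1 / 2) ξ := by
  rw [mem_cone_iff]
  refine ⟨‖α‖, ⟨norm_nonneg _, hα⟩, ?_⟩
  have e : w - ‖α‖ * ξ = (w - α) - ‖α‖ * (ξ - ζ) := by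
    nth_rw 2 [hζ]; ring
  rw [e]
  refine (norm_sub_le _ _).trans_lt ?_
  rw [norm_mul, Complex.norm_real, norm_norm]
  nlinarith [norm_nonneg α, norm_nonneg (ξ - ζ)]

lemma exists_radial (α : ℂ) : ∃ ζ : ℂ, ‖ζ‖ = 1 ∧ α = ‖α‖ * ζ := by
  refine ⟨Complex.exp (α.arg * Complex.I), Complex.norm_exp_ofReal_mul_I _, ?_⟩
  exact (Complex.norm_mul_exp_arg_mul_I α).symm

/-- The graph of the cones, as a subset of the product. -/
def coneGraph (β : ℝ) : Set (ℂ × ℂ) :=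
  {x | ∃ t ∈ Ico (0 : ℝ) 1, ‖x.2 - t * x.1‖ < β * (1 - t)}

/-- Openness in both variables jointly supplies the measurability that Tonelli needs when vertex and
point are interchanged. -/
lemma isOpen_coneGraph (β : ℝ) : IsOpen (coneGraph β) := by
  have : coneGraph β = ⋃ t ∈ Ico (0 : ℝ) 1, {x : ℂ × ℂ | ‖x.2 - t * x.1‖ < β * (1 - t)} := by
    ext x; simp [coneGraph]
  rw [this]
  exact isOpen_biUnion fun t _ => isOpen_lt (by fun_prop) (by fun_prop)

lemma cone_eq_preimage (β : ℝ) (ξ : ℂ) :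
    cone β ξ = Prod.mk ξ ⁻¹' coneGraph β := by
  ext z; rw [mem_cone_iff]; rfl

lemma measurableSet_cone (β : ℝ) (ξ : ℂ) : MeasurableSet (cone β ξ) := by
  rw [cone_eq_preimage]
  exact measurable_prodMk_left (isOpen_coneGraph β).measurableSet

lemma measurable_measure_cone (β : ℝ) (μ : Measure ℂ) [SFinite μ] :
    Measurable fun ξ => μ (cone β ξ) := by
  simp_rw [cone_eq_preimage]
  exact measurable_measure_prodMk_left (isOpen_coneGraph β).measurableSet

/-! ### Arc length of balls -/

/-- Arc length on the unit circle, as a measure on the plane. -/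
noncomputable def arcLength : Measure ℂ :=
  (volume.restrict (Ioc (0 : ℝ) (2 * Real.pi))).map fun θ : ℝ => Complex.exp (θ * Complex.I)

lemma measurable_exp_ofReal_mul_I : Measurable fun θ : ℝ => Complex.exp (θ * Complex.I) := by
  fun_prop

instance : IsFiniteMeasure arcLength := by
  unfold arcLength; infer_instance

lemma ae_arcLength_norm : ∀ᵐ ξ ∂arcLength, ‖ξ‖ = 1 := by
  rw [arcLength, ae_map_iff measurable_exp_ofReal_mul_I.aemeasurable
    (measurableSet_eq_fun (by fun_prop) (by fun_prop))]
  exact Filter.Eventually.of_forall fun θ => Complex.norm_exp_ofReal_mul_I θ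

lemma norm_exp_sub_exp (θ φ : ℝ) :
    ‖Complex.exp (θ * Complex.I) - Complex.exp (φ * Complex.I)‖ = 2 * |Real.sin ((θ - φ) / 2)| := by
  have e : Complex.exp (θ * Complex.I) - Complex.exp (φ * Complex.I)
      = Complex.exp (φ * Complex.I) * (Complex.exp (Complex.I * ((θ - φ : ℝ) : ℂ)) - 1) := by
    rw [mul_sub, ← Complex.exp_add]; push_cast; ring_nf
  rw [e, norm_mul, Complex.norm_exp_ofReal_mul_I, one_mul, Complex.norm_exp_I_mul_ofReal_sub_one]
  simp

lemma abs_le_pi_mul_of_abs_sin_le {x r : ℝ} (hx : |x| ≤ Real.pi / 2) (h : |Real.sin x| ≤ r) :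
    |2 * x| ≤ Real.pi * r := by
  have := Real.mul_abs_le_abs_sin hx
  have hp := Real.pi_pos
  rw [abs_mul, abs_two]
  have h3 : 2 / Real.pi * |x| ≤ r := this.trans h
  rw [div_mul_eq_mul_div, div_le_iff₀ hp] at h3
  linarith

/-- Fix one angle φ in the ball. Any other angle θ there has chord at most 2r to it, and Jordan's
inequality bounds |θ - φ| by πr modulo 2π. Three intervals allow for the wrap-around, of total
length 6πr ≤ 20r. -/
lemma arcLength_closedBall_le (c : ℂ) {r : ℝ} (hr : 0 ≤ r) :
    arcLength (Metric.closedBall c r) ≤ ENNReal.ofReal (20 * r) := by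
  have hp := Real.pi_pos
  rw [arcLength, Measure.map_apply measurable_exp_ofReal_mul_I measurableSet_closedBall,
    Measure.restrict_apply (measurable_exp_ofReal_mul_I measurableSet_closedBall)]
  rcases eq_empty_or_nonempty
    ((fun θ : ℝ => Complex.exp (θ * Complex.I)) ⁻¹' Metric.closedBall c r ∩ Ioc 0 (2 * Real.pi))
    with h | ⟨φ, hφ, hφ'⟩
  · simp [h]
  have hsub : (fun θ : ℝ => Complex.exp (θ * Complex.I)) ⁻¹' Metric.closedBall c r
      ∩ Ioc 0 (2 * Real.pi) ⊆ Metric.closedBall φ (Real.pi * r) ∪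
        (Metric.closedBall (φ + 2 * Real.pi) (Real.pi * r) ∪
          Metric.closedBall (φ - 2 * Real.pi) (Real.pi * r)) := by
    rintro θ ⟨hθ, hθ'⟩
    simp only [mem_preimage, Metric.mem_closedBall] at hθ hφ
    have hd := dist_triangle_right (Complex.exp (θ * Complex.I)) (Complex.exp (φ * Complex.I)) c
    rw [dist_eq_norm, norm_exp_sub_exp] at hd
    have hs : |Real.sin ((θ - φ) / 2)| ≤ r := by linarith
    simp only [mem_union, Metric.mem_closedBall, Real.dist_eq]
    rcases le_or_gt |(θ - φ) / 2| (Real.pi / 2) with h1 | h1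
    · left
      convert abs_le_pi_mul_of_abs_sin_le h1 hs using 2; ring
    · right
      rcases lt_abs.1 h1 with h2 | h2
      · left
        have h3 : |Real.sin ((θ - φ) / 2 - Real.pi)| ≤ r := by
          rw [Real.sin_sub_pi, abs_neg]; exact hs
        convert abs_le_pi_mul_of_abs_sin_le (abs_le.2 ⟨?_, ?_⟩) h3 using 2
        · ring
        · linarith
        · linarith [hφ'.1, hθ'.2]
      · right
        have h3 : |Real.sin ((θ - φ) / 2 + Real.pi)| ≤ r := by
          rw [Real.sin_add_pi, abs_neg]; exact hs
        convert abs_le_pi_mul_of_abs_sin_le (abs_le.2 ⟨?_, ?_⟩) h3 using 2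
        · ring
        · linarith [hφ'.2, hθ'.1]
        · linarith
  refine (measure_mono hsub).trans ((measure_union_le _ _).trans
    ((add_le_add_right (measure_union_le _ _) _).trans ?_))
  simp only [Real.volume_closedBall]
  rw [← ENNReal.ofReal_add (by positivity) (by positivity),
    ← ENNReal.ofReal_add (by positivity) (by positivity)]
  apply ENNReal.ofReal_le_ofReal
  nlinarith [Real.pi_lt_d2]

lemma le_arcLength_ball {ζ : ℂ} (hζ : ‖ζ‖ = 1) {r : ℝ} (hr : r ≤ 1) :
    ENNReal.ofReal r ≤ arcLength (Metric.ball ζ r) := by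
  have hp := Real.pi_gt_three
  obtain ⟨φ, hφ, rfl⟩ : ∃ φ ∈ Ioc (0 : ℝ) (2 * Real.pi), Complex.exp (φ * Complex.I) = ζ := by
    have h := Complex.norm_mul_exp_arg_mul_I ζ
    rw [hζ, Complex.ofReal_one, one_mul] at h
    rcases lt_or_ge 0 ζ.arg with h0 | h0
    · exact ⟨ζ.arg, ⟨h0, by linarith [Complex.arg_le_pi ζ]⟩, h⟩
    · refine ⟨ζ.arg + 2 * Real.pi, ⟨by linarith [Complex.neg_pi_lt_arg ζ], by linarith⟩, ?_⟩
      nth_rw 2 [← h]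
      push_cast
      rw [add_mul, Complex.exp_add, Complex.exp_two_pi_mul_I, mul_one]
  rw [arcLength, Measure.map_apply measurable_exp_ofReal_mul_I Metric.isOpen_ball.measurableSet,
    Measure.restrict_apply (measurable_exp_ofReal_mul_I Metric.isOpen_ball.measurableSet)]
  have key : ∀ θ : ℝ, |θ - φ| < r →
      Complex.exp (θ * Complex.I) ∈ Metric.ball (Complex.exp (φ * Complex.I)) r := by
    intro θ h
    rw [Metric.mem_ball, dist_eq_norm, norm_exp_sub_exp]
    have := Real.abs_sin_le_abs (x := (θ - φ) / 2)
    rw [abs_div, abs_two] at this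
    linarith
  -- Only one side of φ is used, whichever stays inside (0, 2π]; hence the lower bound r rather than
  -- 2r.
  rcases le_or_gt r φ with h | h
  · have : Ioc (φ - r) φ ⊆ (fun θ : ℝ => Complex.exp (θ * Complex.I)) ⁻¹'
        Metric.ball (Complex.exp (φ * Complex.I)) r ∩ Ioc 0 (2 * Real.pi) := by
      intro θ hθ
      refine ⟨key θ (abs_lt.2 ⟨by linarith [hθ.1], by linarith [hθ.1, hθ.2]⟩), ?_, ?_⟩
      · linarith [hθ.1]
      · linarith [hθ.2, hφ.2]
    refine le_trans ?_ (measure_mono this)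
    simp
  · have : Ico φ (φ + r) ⊆ (fun θ : ℝ => Complex.exp (θ * Complex.I)) ⁻¹'
        Metric.ball (Complex.exp (φ * Complex.I)) r ∩ Ioc 0 (2 * Real.pi) := by
      intro θ hθ
      refine ⟨key θ (abs_lt.2 ⟨by linarith [hθ.1, hθ.2], by linarith [hθ.2]⟩), ?_, ?_⟩
      · linarith [hθ.1, hφ.1]
      · linarith [hθ.2]
    refine le_trans ?_ (measure_mono this)
    simp

/-! ### The tent functional as a norm of cone masses -/

/-- The measure `|f|^p dm / (1 - |z|)` restricted to `G`. -/
noncomputable def tentMeasure (p : ℝ) (G : Set ℂ) (f : ℂ → ℂ) : Measure ℂ :=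
  (area.restrict G).withDensity fun z => ‖f z‖ₑ ^ p / ENNReal.ofReal (1 - ‖z‖)

instance : IsFiniteMeasure area := by
  refine ⟨?_⟩
  rw [area, Measure.smul_apply, Measure.restrict_apply_univ, smul_eq_mul]
  refine ENNReal.mul_lt_top (ENNReal.inv_lt_top.2 ?_) ?_
  · simp [Real.pi_pos]
  · rw [unitDisc]; exact measure_ball_lt_top

instance (p : ℝ) (G : Set ℂ) (f : ℂ → ℂ) : SFinite (tentMeasure p G f) := by
  unfold tentMeasure; infer_instance

lemma tentMeasure_cone (β p : ℝ) (G : Set ℂ) (f : ℂ → ℂ) (ξ : ℂ) :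
    tentMeasure p G f (cone β ξ)
      = ∫⁻ z in cone β ξ ∩ G, ‖f z‖ₑ ^ p / ENNReal.ofReal (1 - ‖z‖) ∂area := by
  rw [tentMeasure, withDensity_apply _ (measurableSet_cone β ξ),
    Measure.restrict_restrict (measurableSet_cone β ξ)]

/-- From here on f enters the aperture estimates only through the measure it defines. -/
lemma tentFunctional_eq (β p q : ℝ) (G : Set ℂ) (f : ℂ → ℂ) :
    tentFunctional β p q G f
      = (∫⁻ ξ, tentMeasure p G f (cone β ξ) ^ (q / p) ∂arcLength) ^ (1 / q) := by
  rw [arcLength, lintegral_map ((measurable_measure_cone β _).pow_const _)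
    measurable_exp_ofReal_mul_I]
  simp_rw [tentMeasure_cone]
  rfl

/-! ### The maximal theorem -/

section Maximal

variable {α : Type*} [PseudoMetricSpace α] [MeasurableSpace α]

/-- The uncentred maximal function of `ψ` over balls of radius at most `R`, the integral over a ball
being divided by the radius. -/
noncomputable def maximal (σ : Measure α) (R : ℝ) (ψ : α → ℝ≥0∞) (x : α) : ℝ≥0∞ :=
  ⨆ (b : α × ℝ) (_ : 0 < b.2 ∧ b.2 ≤ R ∧ x ∈ Metric.ball b.1 b.2),
    (∫⁻ y in Metric.closedBall b.1 b.2, ψ y ∂σ) / ENNReal.ofReal b.2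

lemma le_maximal (σ : Measure α) {R : ℝ} (ψ : α → ℝ≥0∞) {x c : α} {r : ℝ} (hr : 0 < r) (hR : r ≤ R)
    (hx : x ∈ Metric.ball c r) :
    (∫⁻ y in Metric.closedBall c r, ψ y ∂σ) / ENNReal.ofReal r ≤ maximal σ R ψ x :=
  le_iSup₂_of_le (c, r) ⟨hr, hR, hx⟩ le_rfl

lemma lt_maximal_iff {σ : Measure α} {R : ℝ} {ψ : α → ℝ≥0∞} {x : α} {a : ℝ≥0∞} :
    a < maximal σ R ψ x ↔ ∃ b : α × ℝ, (0 < b.2 ∧ b.2 ≤ R ∧ x ∈ Metric.ball b.1 b.2) ∧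
      a < (∫⁻ y in Metric.closedBall b.1 b.2, ψ y ∂σ) / ENNReal.ofReal b.2 := by
  simp only [maximal, lt_iSup_iff, exists_prop]

/-- The maximal function being uncentred over open balls, each superlevel set is a union of open
balls. -/
lemma measurable_maximal [OpensMeasurableSpace α] (σ : Measure α) (R : ℝ) (ψ : α → ℝ≥0∞) :
    Measurable (maximal σ R ψ) := by
  refine measurable_of_Ioi fun a => IsOpen.measurableSet ?_
  have : maximal σ R ψ ⁻¹' Ioi a = ⋃ b ∈ {b : α × ℝ | 0 < b.2 ∧ b.2 ≤ R ∧
      a < (∫⁻ y in Metric.closedBall b.1 b.2, ψ y ∂σ) / ENNReal.ofReal b.2},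
      Metric.ball b.1 b.2 := by
    ext x
    simp only [mem_preimage, mem_Ioi, lt_maximal_iff, mem_iUnion, mem_ofPred_eq, exists_prop]
    exact exists_congr fun b => by tauto
  rw [this]
  exact isOpen_biUnion fun b _ => Metric.isOpen_ball

/-- The weak type inequality, from the Vitali covering lemma. -/
lemma mul_measure_lt_maximal_le [SecondCountableTopology α] [OpensMeasurableSpace α]
    {σ : Measure α} {K : ℝ} (hσ : ∀ c r, 0 ≤ r → σ (Metric.closedBall c r) ≤ ENNReal.ofReal (K * r))
    (R : ℝ) (ψ : α → ℝ≥0∞) (a : ℝ≥0∞) :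
    a * σ {x | a < maximal σ R ψ x} ≤ ENNReal.ofReal (5 * K) * ∫⁻ x, ψ x ∂σ := by
  set t : Set (α × ℝ) := {b | (0 < b.2 ∧ b.2 ≤ R) ∧
      a < (∫⁻ y in Metric.closedBall b.1 b.2, ψ y ∂σ) / ENNReal.ofReal b.2} with ht
  obtain ⟨u, hut, hd, hu⟩ := Vitali.exists_disjoint_subfamily_covering_enlargement_closedBall t
    Prod.fst Prod.snd R (fun b hb => hb.1.2) 5 (by norm_num)
  have hc : u.Countable := hd.countable_of_nonempty_interior fun b hb =>
    ⟨b.1, Metric.ball_subset_interior_closedBall (Metric.mem_ball_self (hut hb).1.1)⟩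
  have hsub : {x | a < maximal σ R ψ x} ⊆ ⋃ b ∈ u, Metric.closedBall b.1 (5 * b.2) := by
    intro x hx
    obtain ⟨b, hb, hb'⟩ := lt_maximal_iff.1 hx
    obtain ⟨b', hb'u, hbb'⟩ := hu b ⟨⟨hb.1, hb.2.1⟩, hb'⟩
    exact mem_biUnion hb'u (hbb' (Metric.ball_subset_closedBall hb.2.2))
  calc a * σ {x | a < maximal σ R ψ x}
      ≤ a * ∑' b : u, σ (Metric.closedBall b.1.1 (5 * b.1.2)) := by
        gcongr
        exact (measure_mono hsub).trans (measure_biUnion_le σ hc _)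
    _ ≤ ∑' b : u, ENNReal.ofReal (5 * K) * (a * ENNReal.ofReal b.1.2) := by
        rw [← ENNReal.tsum_mul_left]
        refine ENNReal.tsum_le_tsum fun b => ?_
        have hb := (hut b.2).1.1
        rw [mul_left_comm, ← ENNReal.ofReal_mul' hb.le]
        gcongr
        refine (hσ _ _ (by positivity)).trans_eq ?_
        ring_nf
    _ ≤ ∑' b : u, ENNReal.ofReal (5 * K) * ∫⁻ y in Metric.closedBall b.1.1 b.1.2, ψ y ∂σ := by
        refine ENNReal.tsum_le_tsum fun b => ?_
        gcongr
        have hb := (hut b.2).1.1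
        exact (ENNReal.mul_lt_of_lt_div (hut b.2).2).le
    _ = ENNReal.ofReal (5 * K) * ∫⁻ y in ⋃ b ∈ u, Metric.closedBall b.1 b.2, ψ y ∂σ := by
        rw [ENNReal.tsum_mul_left, lintegral_biUnion hc
          (fun _ _ => Metric.isClosed_closedBall.measurableSet) hd]
    _ ≤ _ := by
        gcongr
        exact Measure.restrict_le_self

/-- The part of ψ where ψ ≤ a contributes at most Ka to any quotient, so discarding it costs half of
the threshold 2Ka. The weak type inequality is then applied to the remaining part. -/
lemma mul_measure_lt_maximal_le_setLIntegral [SecondCountableTopology α] [OpensMeasurableSpace α]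
    {σ : Measure α} {K : ℝ} (hK : 0 < K)
    (hσ : ∀ c r, 0 ≤ r → σ (Metric.closedBall c r) ≤ ENNReal.ofReal (K * r))
    (R : ℝ) {ψ : α → ℝ≥0∞} (hψ : Measurable ψ) (a : ℝ≥0∞) :
    a * σ {x | ENNReal.ofReal (2 * K) * a < maximal σ R ψ x} ≤ 5 * ∫⁻ x in {x | a < ψ x}, ψ x ∂σ := by
  have hm : MeasurableSet {x | a < ψ x} := measurableSet_lt measurable_const hψ
  have hsub : {x | ENNReal.ofReal (2 * K) * a < maximal σ R ψ x} ⊆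
      {x | ENNReal.ofReal K * a < maximal σ R ({x | a < ψ x}.indicator ψ) x} := by
    intro x hx
    obtain ⟨b, hb, hb'⟩ := lt_maximal_iff.1 hx
    refine lt_of_lt_of_le ?_ (le_maximal σ _ hb.1 hb.2.1 hb.2.2)
    have h0 : ENNReal.ofReal b.2 ≠ 0 := by simpa using hb.1
    have h1 : (∫⁻ y in Metric.closedBall b.1 b.2, ψ y ∂σ) ≤
        (∫⁻ y in Metric.closedBall b.1 b.2, {x | a < ψ x}.indicator ψ y ∂σ)
          + a * ENNReal.ofReal (K * b.2) := by
      calc (∫⁻ y in Metric.closedBall b.1 b.2, ψ y ∂σ)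
          ≤ ∫⁻ y in Metric.closedBall b.1 b.2, ({x | a < ψ x}.indicator ψ y + a) ∂σ := by
            refine lintegral_mono fun y => ?_
            by_cases hy : a < ψ y
            · rw [indicator_of_mem (by exact hy)]; exact le_self_add
            · exact (not_lt.1 hy).trans le_add_self
        _ = (∫⁻ y in Metric.closedBall b.1 b.2, {x | a < ψ x}.indicator ψ y ∂σ)
              + a * σ (Metric.closedBall b.1 b.2) := by
            rw [lintegral_add_right _ measurable_const, setLIntegral_const]
        _ ≤ _ := by gcongr; exact hσ _ _ hb.1.le
    have h2 := lt_of_lt_of_le hb' (ENNReal.div_le_div_right h1 _)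
    rw [ENNReal.add_div, ENNReal.ofReal_mul hK.le, ← mul_assoc,
      ENNReal.mul_div_cancel_right h0 ENNReal.ofReal_ne_top,
      ENNReal.ofReal_mul (by norm_num), ENNReal.ofReal_ofNat, mul_assoc, two_mul,
      mul_comm a] at h2
    exact lt_of_add_lt_add_right h2
  have h3 := mul_measure_lt_maximal_le hσ R ({x | a < ψ x}.indicator ψ) (ENNReal.ofReal K * a)
  rw [lintegral_indicator hm, ENNReal.ofReal_mul (by norm_num), ENNReal.ofReal_ofNat,
    mul_comm 5, mul_assoc, mul_assoc] at h3
  have hK0 : ENNReal.ofReal K ≠ 0 := by simpa using hK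
  refine le_trans ?_ ((ENNReal.mul_le_mul_iff_right hK0 ENNReal.ofReal_ne_top).1 h3)
  gcongr

end Maximal

lemma setLIntegral_rpow_sub_one {t : ℝ} (ht : 0 < t) (y : ℝ≥0∞) :
    ∫⁻ τ in {τ : ℝ | 0 < τ ∧ ENNReal.ofReal τ < y}, ENNReal.ofReal (t * τ ^ (t - 1)) = y ^ t := by
  have key : ∀ b : ℝ, 0 ≤ b →
      ∫⁻ τ in Ioc (0 : ℝ) b, ENNReal.ofReal (t * τ ^ (t - 1)) = ENNReal.ofReal b ^ t := by
    intro b hb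
    have hi : IntervalIntegrable (fun τ : ℝ => t * τ ^ (t - 1)) volume 0 b :=
      (intervalIntegral.intervalIntegrable_rpow' (by linarith)).const_mul t
    rw [← ofReal_integral_eq_lintegral_ofReal ((intervalIntegrable_iff_integrableOn_Ioc_of_le hb).1 hi),
      ← intervalIntegral.integral_of_le hb, intervalIntegral.integral_const_mul,
      integral_rpow (Or.inl (by linarith)), ENNReal.ofReal_rpow_of_nonneg hb ht.le]
    · congr 1
      rw [sub_add_cancel, Real.zero_rpow ht.ne']
      field_simp
      simp
    · filter_upwards [ae_restrict_mem measurableSet_Ioc] with τ hτ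
      have := hτ.1
      positivity
  rcases eq_or_ne y ∞ with rfl | hy
  · rw [ENNReal.top_rpow_of_pos ht, eq_top_iff]
    refine ENNReal.le_of_forall_nnreal_lt fun r _ => ?_
    have h := key ((r : ℝ) ^ (t⁻¹)) (by positivity)
    rw [ENNReal.ofReal_rpow_of_nonneg (by positivity) ht.le, ← Real.rpow_mul (by positivity),
      inv_mul_cancel₀ ht.ne', Real.rpow_one, ENNReal.ofReal_coe_nnreal] at h
    rw [← h]
    exact lintegral_mono_set fun τ hτ => ⟨hτ.1, ENNReal.ofReal_lt_top⟩
  · have h := key y.toReal ENNReal.toReal_nonneg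
    rw [ENNReal.ofReal_toReal hy] at h
    rw [← h, ← setLIntegral_congr Ioo_ae_eq_Ioc]
    congr 2
    ext τ
    simp only [mem_ofPred_eq, mem_Ioo, and_congr_right_iff]
    intro h0
    rw [ENNReal.ofReal_lt_iff_lt_toReal h0.le hy]

/-- Layer-cake formula. The weight φ allows it to be run backwards, with φ = ψ and exponent t - 1,
in the maximal theorem. -/
lemma lintegral_rpow_eq_setLIntegral_measure_lt {α : Type*} [MeasurableSpace α] (σ : Measure α)
    [SFinite σ] {g φ : α → ℝ≥0∞} (hg : Measurable g) (hφ : Measurable φ) {t : ℝ} (ht : 0 < t) :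
    ∫⁻ x, φ x * g x ^ t ∂σ = ∫⁻ τ in Ioi (0 : ℝ), ENNReal.ofReal (t * τ ^ (t - 1)) *
      ∫⁻ x in {x | ENNReal.ofReal τ < g x}, φ x ∂σ := by
  have hm : MeasurableSet {x : α × ℝ | ENNReal.ofReal x.2 < g x.1} :=
    measurableSet_lt (by fun_prop) (by fun_prop)
  calc ∫⁻ x, φ x * g x ^ t ∂σ
      = ∫⁻ x, (∫⁻ τ in Ioi (0 : ℝ), {x : α × ℝ | ENNReal.ofReal x.2 < g x.1}.indicator
          (fun x => φ x.1 * ENNReal.ofReal (t * x.2 ^ (t - 1))) (x, τ)) ∂σ := by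
        refine lintegral_congr fun x => ?_
        rw [← setLIntegral_rpow_sub_one ht (g x), ← lintegral_const_mul _ (by fun_prop)]
        have hs : MeasurableSet {τ : ℝ | ENNReal.ofReal τ < g x} :=
          measurableSet_lt (by fun_prop) (by fun_prop)
        have e : {τ : ℝ | 0 < τ ∧ ENNReal.ofReal τ < g x} = {τ : ℝ | ENNReal.ofReal τ < g x} ∩ Ioi 0 := by
          ext τ; simp [and_comm]
        rw [e, ← Measure.restrict_restrict hs, ← lintegral_indicator hs]
        rfl
    _ = ∫⁻ τ in Ioi (0 : ℝ), ∫⁻ x, {x : α × ℝ | ENNReal.ofReal x.2 < g x.1}.indicator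
          (fun x => φ x.1 * ENNReal.ofReal (t * x.2 ^ (t - 1))) (x, τ) ∂σ := by
        refine lintegral_lintegral_swap (Measurable.aemeasurable ?_)
        exact Measurable.indicator (by fun_prop) hm
    _ = _ := by
        refine lintegral_congr fun τ => ?_
        rw [← lintegral_const_mul _ hφ, ← lintegral_indicator
          (measurableSet_lt (by fun_prop) (by fun_prop))]
        refine lintegral_congr fun x => ?_
        simp only [indicator, mem_ofPred_eq]
        split_ifs
        · exact mul_comm _ _
        · rfl

/-- The maximal function is bounded on `L^t`, `1 < t`. -/
lemma lintegral_maximal_rpow_le {α : Type*} [PseudoMetricSpace α] [MeasurableSpace α]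
    [SecondCountableTopology α] [OpensMeasurableSpace α] {σ : Measure α} [SFinite σ] {K : ℝ}
    (hK : 0 < K) (hσ : ∀ c r, 0 ≤ r → σ (Metric.closedBall c r) ≤ ENNReal.ofReal (K * r))
    (R : ℝ) {t : ℝ} (ht : 1 < t) {ψ : α → ℝ≥0∞} (hψ : Measurable ψ) :
    ∫⁻ x, maximal σ R ψ x ^ t ∂σ
      ≤ ENNReal.ofReal ((2 * K) ^ t * 5 * (t / (t - 1))) * ∫⁻ x, ψ x ^ t ∂σ := by
  have ht0 : 0 < t := by linarith
  have ht1 : 0 < t - 1 := by linarith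
  have hM := measurable_maximal σ R ψ
  have hk0 : ENNReal.ofReal (2 * K) ≠ 0 := by simpa using hK
  have h1 : ∀ x, maximal σ R ψ x ^ t
      = ENNReal.ofReal (2 * K) ^ t * (1 * (maximal σ R ψ x / ENNReal.ofReal (2 * K)) ^ t) := by
    intro x
    rw [one_mul, ← ENNReal.mul_rpow_of_nonneg _ _ ht0.le,
      ENNReal.mul_div_cancel hk0 ENNReal.ofReal_ne_top]
  simp_rw [h1]
  rw [lintegral_const_mul _ (by fun_prop), lintegral_rpow_eq_setLIntegral_measure_lt σ
    (by fun_prop) measurable_const ht0, mul_assoc ((2 * K) ^ t),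
    ENNReal.ofReal_mul (p := (2 * K) ^ t) (by positivity),
    ← ENNReal.ofReal_rpow_of_pos (by positivity), mul_assoc]
  gcongr
  -- The truncated weak type bound at height τ uses up one power of τ; what is left is the layer
  -- cake of ∫ ψ · ψ^(t-1).
  calc ∫⁻ τ in Ioi (0 : ℝ), ENNReal.ofReal (t * τ ^ (t - 1)) *
        ∫⁻ x in {x | ENNReal.ofReal τ < maximal σ R ψ x / ENNReal.ofReal (2 * K)}, 1 ∂σ
      ≤ ∫⁻ τ in Ioi (0 : ℝ), ENNReal.ofReal (5 * (t / (t - 1))) *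
          (ENNReal.ofReal ((t - 1) * τ ^ (t - 1 - 1)) *
            ∫⁻ x in {x | ENNReal.ofReal τ < ψ x}, ψ x ∂σ) := by
        refine setLIntegral_mono' measurableSet_Ioi fun τ (hτ : 0 < τ) => ?_
        have e : {x | ENNReal.ofReal τ < maximal σ R ψ x / ENNReal.ofReal (2 * K)}
            = {x | ENNReal.ofReal (2 * K) * ENNReal.ofReal τ < maximal σ R ψ x} := by
          ext x
          simp only [mem_ofPred_eq]
          rw [ENNReal.lt_div_iff_mul_lt (Or.inl hk0) (Or.inl ENNReal.ofReal_ne_top), mul_comm]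
        rw [e, setLIntegral_one]
        have e2 : ENNReal.ofReal (t * τ ^ (t - 1))
            = ENNReal.ofReal (t * τ ^ (t - 1 - 1)) * ENNReal.ofReal τ := by
          rw [← ENNReal.ofReal_mul (by positivity), mul_assoc, ← Real.rpow_add_one hτ.ne']
          ring_nf
        rw [e2, mul_assoc]
        refine (mul_le_mul_right (mul_measure_lt_maximal_le_setLIntegral hK hσ R hψ _) _).trans_eq ?_
        rw [← mul_assoc, ← mul_assoc, ← ENNReal.ofReal_ofNat 5, ← ENNReal.ofReal_mul (by positivity),
          ← ENNReal.ofReal_mul (by positivity)]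
        congr 2
        field_simp
    _ = ENNReal.ofReal (5 * (t / (t - 1))) * ∫⁻ x, ψ x * ψ x ^ (t - 1) ∂σ := by
        rw [lintegral_const_mul' _ _ ENNReal.ofReal_ne_top,
          lintegral_rpow_eq_setLIntegral_measure_lt σ hψ hψ ht1]
    _ = _ := by
        congr 2
        ext x
        nth_rw 1 [← ENNReal.rpow_one (ψ x)]
        rw [← ENNReal.rpow_add_of_nonneg _ _ zero_le_one ht1.le]
        ring_nf

/-! ### Change of aperture -/

lemma norm_sub_radial {z ζ : ℂ} (hz : ‖z‖ ≤ 1) (hζ : ‖ζ‖ = 1) (h : z = ‖z‖ * ζ) :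
    ‖z - ζ‖ = 1 - ‖z‖ := by
  have e : z - ζ = -(((1 - ‖z‖ : ℝ) : ℂ) * ζ) := by
    nth_rw 1 [h]; push_cast; ring
  rw [e, norm_neg, norm_mul, hζ, Complex.norm_real, Real.norm_of_nonneg (by linarith), mul_one]

/-- Tonelli: cones over a vertex are traded for shadows of a point. -/
lemma lintegral_measure_cone_mul (β : ℝ) (μ : Measure ℂ) [SFinite μ] {φ : ℂ → ℝ≥0∞}
    (hφ : Measurable φ) :
    ∫⁻ ξ, μ (cone β ξ) * φ ξ ∂arcLength
      = ∫⁻ z, (∫⁻ ξ in {ξ | z ∈ cone β ξ}, φ ξ ∂arcLength) ∂μ := by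
  have hm := (isOpen_coneGraph β).measurableSet
  calc ∫⁻ ξ, μ (cone β ξ) * φ ξ ∂arcLength
      = ∫⁻ ξ, (∫⁻ z, (coneGraph β).indicator (fun x => φ x.1) (ξ, z) ∂μ) ∂arcLength := by
        refine lintegral_congr fun ξ => ?_
        rw [mul_comm, ← setLIntegral_const, ← lintegral_indicator (measurableSet_cone β ξ)]
        refine lintegral_congr fun z => ?_
        rw [cone_eq_preimage]
        rfl
    _ = ∫⁻ z, (∫⁻ ξ, (coneGraph β).indicator (fun x => φ x.1) (ξ, z) ∂arcLength) ∂μ :=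
        lintegral_lintegral_swap (((hφ.comp measurable_fst).indicator hm).aemeasurable)
    _ = _ := by
        refine lintegral_congr fun z => ?_
        have hs : {ξ | z ∈ cone β ξ} = (fun ξ => (ξ, z)) ⁻¹' coneGraph β := by
          ext ξ; simp only [cone_eq_preimage]; rfl
        rw [hs, ← lintegral_indicator (measurable_prodMk_right hm)]
        rfl

/-- If `φ` has integral over large arcs bounded by that of `ψ` over smaller arcs, then `φ` tested
against wide cones is bounded by `ψ` tested against narrow ones. -/
lemma lintegral_measure_cone_mul_le {β : ℝ} (hβ : β < 1) {L : ℝ} (hL : 2 / (1 - β) + 2 ≤ L)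
    (μ : Measure ℂ) [SFinite μ] {φ ψ : ℂ → ℝ≥0∞} (hφ : Measurable φ) (hψ : Measurable ψ) {c : ℝ≥0∞}
    (hc : c ≠ ∞) (H : ∀ ζ : ℂ, ‖ζ‖ = 1 → ∀ h : ℝ, 0 < h → h ≤ 1 →
      ∫⁻ ξ in Metric.ball ζ (L * h), φ ξ ∂arcLength
        ≤ c * ∫⁻ ξ in Metric.ball ζ (h / 4), ψ ξ ∂arcLength) :
    ∫⁻ ξ, μ (cone β ξ) * φ ξ ∂arcLength ≤ c * ∫⁻ ξ, μ (cone (1 / 2) ξ) * ψ ξ ∂arcLength := by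
  rw [lintegral_measure_cone_mul β μ hφ, lintegral_measure_cone_mul (1 / 2) μ hψ,
    ← lintegral_const_mul' _ _ hc]
  refine lintegral_mono fun z => ?_
  rcases lt_or_ge ‖z‖ 1 with hz | hz
  · obtain ⟨ζ, hζ, hzζ⟩ := exists_radial z
    have hh : 0 < 1 - ‖z‖ := by linarith
    -- Almost all of the shadow of z for aperture β lies in the ball of radius L(1 - |z|) about ζ,
    -- and its shadow for aperture 1/2 contains the ball of radius (1 - |z|)/4.
    calc ∫⁻ ξ in {ξ | z ∈ cone β ξ}, φ ξ ∂arcLength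
        ≤ ∫⁻ ξ in Metric.ball ζ (L * (1 - ‖z‖)), φ ξ ∂arcLength := by
          refine lintegral_mono' (Measure.restrict_mono_ae ?_) le_rfl
          filter_upwards [ae_arcLength_norm] with ξ hξ (hξz : z ∈ cone β ξ)
          have h1 := norm_sub_le_of_mem_cone hβ hξ hξz
          have h2 := norm_sub_radial hz.le hζ hzζ
          change dist ξ ζ < _
          have h3 := dist_triangle_left ξ ζ z
          rw [dist_eq_norm z, dist_eq_norm z] at h3
          nlinarith
      _ ≤ c * ∫⁻ ξ in Metric.ball ζ ((1 - ‖z‖) / 4), ψ ξ ∂arcLength :=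
          H ζ hζ _ hh (by linarith [norm_nonneg z])
      _ ≤ _ := by
          gcongr
          intro ξ hξ
          refine mem_cone_half hz hzζ ?_ (by simp; linarith)
          rwa [← dist_eq_norm]
  · have : arcLength {ξ | z ∈ cone β ξ} = 0 := by
      refine measure_mono_null (fun ξ (hξ : z ∈ cone β ξ) => ?_) (ae_iff.1 ae_arcLength_norm)
      exact fun h1 => absurd (norm_lt_one_of_mem_cone hβ h1 hξ) (not_lt.2 hz)
    rw [setLIntegral_measure_zero _ _ this]
    exact zero_le

/-- On the small arc the maximal function dominates the quotient over the large ball, and that arc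
has length at least h/4. -/
lemma setLIntegral_ball_le_maximal {L : ℝ} (hL : 1 ≤ L) {φ : ℂ → ℝ≥0∞} {ζ : ℂ} (hζ : ‖ζ‖ = 1)
    {h : ℝ} (h0 : 0 < h) (h1 : h ≤ 1) :
    ∫⁻ ξ in Metric.ball ζ (L * h), φ ξ ∂arcLength
      ≤ ENNReal.ofReal (4 * L) * ∫⁻ ξ in Metric.ball ζ (h / 4), maximal arcLength L φ ξ ∂arcLength := by
  have hLh : 0 < L * h := by positivity
  set X := ∫⁻ ξ in Metric.closedBall ζ (L * h), φ ξ ∂arcLength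
  have h2 : X / ENNReal.ofReal (L * h) * ENNReal.ofReal (h / 4)
      ≤ ∫⁻ ξ in Metric.ball ζ (h / 4), maximal arcLength L φ ξ ∂arcLength := by
    calc _ ≤ X / ENNReal.ofReal (L * h) * arcLength (Metric.ball ζ (h / 4)) := by
          gcongr; exact le_arcLength_ball hζ (by linarith)
      _ = ∫⁻ ξ in Metric.ball ζ (h / 4), X / ENNReal.ofReal (L * h) ∂arcLength := by
          rw [setLIntegral_const]
      _ ≤ _ := by
          refine setLIntegral_mono' Metric.isOpen_ball.measurableSet fun ξ hξ => ?_
          refine le_maximal _ _ hLh (by nlinarith) (Metric.ball_subset_ball (by nlinarith) hξ)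
  calc _ ≤ X := lintegral_mono_set Metric.ball_subset_closedBall
    _ = ENNReal.ofReal (4 * L) * (X / ENNReal.ofReal (L * h) * ENNReal.ofReal (h / 4)) := by
        rw [mul_comm (X / _), ← mul_assoc, ← ENNReal.ofReal_mul (by positivity)]
        have : 4 * L * (h / 4) = L * h := by ring
        rw [this, ENNReal.mul_div_cancel (by simpa using hLh) ENNReal.ofReal_ne_top]
    _ ≤ _ := by gcongr

/-- Duality: pair the wide-cone mass with φ, its power s - 1, and pass to narrow cones with Mφ in
place of φ. Hölder and the maximal theorem for the conjugate exponent t, where (s - 1)t = s, give X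
≤ D I^(1/s) X^(1/t), to be divided by X^(1/t). -/
lemma lintegral_cone_rpow_le_of_one_lt {β : ℝ} (hβ : β < 1) {s : ℝ} (hs : 1 < s) :
    ∃ C : ℝ≥0∞, C ≠ ∞ ∧ ∀ μ : Measure ℂ, SFinite μ →
      ∫⁻ ξ, μ (cone β ξ) ^ s ∂arcLength ≤ C * ∫⁻ ξ, μ (cone (1 / 2) ξ) ^ s ∂arcLength := by
  set L := 2 / (1 - β) + 2 with hL
  have hb : 0 < 1 - β := by linarith
  have hL1 : 1 ≤ L := by have : 0 < 2 / (1 - β) := by positivity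
                         linarith
  have hs0 : 0 < s := by linarith
  have hst : s.HolderConjugate (s / (s - 1)) := Real.HolderConjugate.conjExponent hs
  set t := s / (s - 1) with htdef
  have ht : 1 < t := hst.symm.lt
  have ht0 : 0 < t := by linarith
  set K : ℝ≥0∞ := ENNReal.ofReal ((2 * 20) ^ t * 5 * (t / (t - 1))) with hK
  set D : ℝ≥0∞ := ENNReal.ofReal (4 * L) * K ^ (1 / t) with hD
  have hDtop : D ≠ ∞ := ENNReal.mul_ne_top ENNReal.ofReal_ne_top
    (ENNReal.rpow_ne_top_of_nonneg (by positivity) ENNReal.ofReal_ne_top)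
  refine ⟨D ^ s, ENNReal.rpow_ne_top_of_nonneg hs0.le hDtop, fun μ _ => ?_⟩
  have hA := measurable_measure_cone (1 / 2) μ
  have hB := measurable_measure_cone β μ
  set I := ∫⁻ ξ, μ (cone (1 / 2) ξ) ^ s ∂arcLength with hI
  -- Truncation at n makes X finite, so that the division is legitimate; monotone convergence
  -- removes it.
  have key : ∀ n : ℕ, ∫⁻ ξ, (μ (cone β ξ) ⊓ (n : ℝ≥0∞)) ^ s ∂arcLength ≤ D ^ s * I := by
    intro n
    set X := ∫⁻ ξ, (μ (cone β ξ) ⊓ (n : ℝ≥0∞)) ^ s ∂arcLength with hX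
    have hXtop : X ≠ ∞ := by
      refine ne_top_of_le_ne_top (b := ∫⁻ _ : ℂ, (n : ℝ≥0∞) ^ s ∂arcLength) ?_
        (lintegral_mono fun ξ => ENNReal.rpow_le_rpow inf_le_right hs0.le)
      rw [lintegral_const]
      exact ENNReal.mul_ne_top (ENNReal.rpow_ne_top_of_nonneg hs0.le (ENNReal.natCast_ne_top n))
        (measure_ne_top _ _)
    set φ : ℂ → ℝ≥0∞ := fun ξ => (μ (cone β ξ) ⊓ (n : ℝ≥0∞)) ^ (s - 1) with hφ
    have hφm : Measurable φ := (hB.inf measurable_const).pow_const _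
    have h1 : X ≤ D * I ^ (1 / s) * X ^ (1 / t) := by
      calc X ≤ ∫⁻ ξ, μ (cone β ξ) * φ ξ ∂arcLength := by
            refine lintegral_mono fun ξ => ?_
            have : (μ (cone β ξ) ⊓ (n : ℝ≥0∞)) ^ s = (μ (cone β ξ) ⊓ (n : ℝ≥0∞)) * φ ξ := by
              rw [hφ]
              nth_rw 2 [← ENNReal.rpow_one (μ (cone β ξ) ⊓ (n : ℝ≥0∞))]
              rw [← ENNReal.rpow_add_of_nonneg _ _ zero_le_one (by linarith)]
              ring_nf
            rw [this]
            gcongr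
            exact inf_le_left
        _ ≤ ENNReal.ofReal (4 * L) *
              ∫⁻ ξ, μ (cone (1 / 2) ξ) * maximal arcLength L φ ξ ∂arcLength :=
            lintegral_measure_cone_mul_le hβ le_rfl μ hφm (measurable_maximal _ _ _)
              ENNReal.ofReal_ne_top fun ζ hζ h h0 h1 => setLIntegral_ball_le_maximal hL1 hζ h0 h1
        _ ≤ ENNReal.ofReal (4 * L) *
              (I ^ (1 / s) * (∫⁻ ξ, maximal arcLength L φ ξ ^ t ∂arcLength) ^ (1 / t)) := by
            gcongr
            exact ENNReal.lintegral_mul_le_Lp_mul_Lq _ hst hA.aemeasurable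
              (measurable_maximal _ _ _).aemeasurable
        _ ≤ ENNReal.ofReal (4 * L) * (I ^ (1 / s) * (K * X) ^ (1 / t)) := by
            gcongr
            refine (lintegral_maximal_rpow_le (by norm_num)
              (fun c _ hr => arcLength_closedBall_le c hr) L ht hφm).trans_eq ?_
            congr 2
            ext ξ
            rw [hφ]
            simp only
            rw [← ENNReal.rpow_mul]
            congr 1
            rw [htdef]
            have : s - 1 ≠ 0 := by linarith
            field_simp
        _ = _ := by
            rw [ENNReal.mul_rpow_of_nonneg _ _ (by positivity), hD]
            ring
    rcases eq_or_ne X 0 with h0 | h0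
    · rw [h0]; exact zero_le
    have h2 : X ^ (1 / s) * X ^ (1 / t) = X := by
      rw [← ENNReal.rpow_add _ _ h0 hXtop]
      have := hst.inv_add_inv_eq_one
      rw [one_div, one_div, this, ENNReal.rpow_one]
    nth_rw 1 [← h2] at h1
    have h3 : X ^ (1 / s) ≤ D * I ^ (1 / s) := by
      refine (ENNReal.mul_le_mul_iff_left ?_ ?_).1 h1
      · simp [h0, hXtop]
      · exact ENNReal.rpow_ne_top_of_nonneg (by positivity) hXtop
    have h4 := ENNReal.rpow_le_rpow h3 hs0.le
    rw [ENNReal.mul_rpow_of_nonneg _ _ hs0.le, ← ENNReal.rpow_mul, ← ENNReal.rpow_mul,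
      one_div_mul_cancel hs0.ne', ENNReal.rpow_one, ENNReal.rpow_one] at h4
    exact h4
  have h5 : ∀ ξ, μ (cone β ξ) ^ s = ⨆ n : ℕ, (μ (cone β ξ) ⊓ (n : ℝ≥0∞)) ^ s := by
    intro ξ
    have : μ (cone β ξ) = ⨆ n : ℕ, μ (cone β ξ) ⊓ (n : ℝ≥0∞) := by
      rw [← inf_iSup_eq, ENNReal.iSup_natCast, inf_top_eq]
    nth_rw 1 [this]
    exact (ENNReal.orderIsoRpow s hs0).map_iSup _
  simp_rw [h5]
  rw [lintegral_iSup (f := fun n ξ => (μ (cone β ξ) ⊓ (n : ℝ≥0∞)) ^ s)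
    (fun n => (hB.inf measurable_const).pow_const _)]
  · exact iSup_le key
  · intro m n hmn ξ
    simp only
    gcongr

/-- For s = 1 both weights are 1 and only lengths of arcs are compared: 20Lh = 80L · (h/4). -/
lemma lintegral_cone_le {β : ℝ} (hβ : β < 1) :
    ∃ C : ℝ≥0∞, C ≠ ∞ ∧ ∀ μ : Measure ℂ, SFinite μ →
      ∫⁻ ξ, μ (cone β ξ) ∂arcLength ≤ C * ∫⁻ ξ, μ (cone (1 / 2) ξ) ∂arcLength := by
  have hb : 0 < 2 / (1 - β) := by have : 0 < 1 - β := by linarith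
                                  positivity
  refine ⟨ENNReal.ofReal (80 * (2 / (1 - β) + 2)), ENNReal.ofReal_ne_top, fun μ _ => ?_⟩
  have := lintegral_measure_cone_mul_le hβ le_rfl μ (φ := fun _ => 1) (ψ := fun _ => 1)
    measurable_const measurable_const
    (c := ENNReal.ofReal (80 * (2 / (1 - β) + 2))) ENNReal.ofReal_ne_top ?_
  · simpa using this
  · intro ζ hζ h h0 h1
    rw [setLIntegral_one, setLIntegral_one]
    calc _ ≤ ENNReal.ofReal (20 * ((2 / (1 - β) + 2) * h)) :=
          (measure_mono Metric.ball_subset_closedBall).trans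
            (arcLength_closedBall_le _ (by positivity))
      _ = ENNReal.ofReal (80 * (2 / (1 - β) + 2)) * ENNReal.ofReal (h / 4) := by
          rw [← ENNReal.ofReal_mul (by positivity)]; congr 1; ring
      _ ≤ _ := by gcongr; exact le_arcLength_ball hζ (by linarith)

/-- Jensen's inequality for the convex function `x ↦ x ^ (-a)`, in multiplicative form. -/
lemma measure_rpow_le_lintegral_rpow_mul {α : Type*} [MeasurableSpace α] (σ : Measure α) {a : ℝ}
    (ha : 0 < a) {g : α → ℝ≥0∞} (hg : Measurable g) (h0 : ∀ᵐ x ∂σ, g x ≠ 0)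
    (htop : ∀ᵐ x ∂σ, g x ≠ ∞) :
    σ univ ^ (1 + a) ≤ (∫⁻ x, g x ∂σ) ^ a * ∫⁻ x, g x ^ (-a) ∂σ := by
  have ha1 : 0 < 1 + a := by linarith
  have hpq : (a / (1 + a)) + 1 / (1 + a) = 1 := by field_simp; ring
  have h1 : σ univ ≤ (∫⁻ x, g x ∂σ) ^ (a / (1 + a)) * (∫⁻ x, g x ^ (-a) ∂σ) ^ (1 / (1 + a)) := by
    have h2 := ENNReal.lintegral_mul_norm_pow_le (μ := σ) hg.aemeasurable
      (hg.pow_const (-a)).aemeasurable (p := a / (1 + a)) (q := 1 / (1 + a)) (by positivity)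
      (by positivity) hpq
    refine le_trans (le_of_eq ?_) h2
    rw [← lintegral_one]
    refine lintegral_congr_ae ?_
    filter_upwards [h0, htop] with x hx hx'
    rw [← ENNReal.rpow_mul, ← ENNReal.rpow_add _ _ hx hx']
    have : a / (1 + a) + -a * (1 / (1 + a)) = 0 := by ring
    rw [this, ENNReal.rpow_zero]
  have h3 := ENNReal.rpow_le_rpow h1 ha1.le
  rw [ENNReal.mul_rpow_of_nonneg _ _ ha1.le, ← ENNReal.rpow_mul, ← ENNReal.rpow_mul,
    div_mul_cancel₀ _ ha1.ne', div_mul_cancel₀ _ ha1.ne', ENNReal.rpow_one] at h3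
  exact h3

/-- Throughout the large ball Mg is at least the integral of g over the small arc divided by Lh. A
negative power reverses this, and Jensen's inequality on the small arc brings in the integral of
g^(-a). -/
lemma setLIntegral_maximal_rpow_neg_le {L : ℝ} (hL : 1 ≤ L) {a : ℝ} (ha : 0 < a) {g : ℂ → ℝ≥0∞}
    (hg : Measurable g) (hg0 : ∀ ξ, g ξ ≠ 0) (hgtop : ∀ᵐ ξ ∂arcLength, g ξ ≠ ∞) {ζ : ℂ}
    (hζ : ‖ζ‖ = 1) {h : ℝ} (h0 : 0 < h) (h1 : h ≤ 1) :
    ∫⁻ ξ in Metric.ball ζ (L * h), maximal arcLength L g ξ ^ (-a) ∂arcLength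
      ≤ ENNReal.ofReal (20 * (4 * L) ^ (1 + a)) *
        ∫⁻ ξ in Metric.ball ζ (h / 4), g ξ ^ (-a) ∂arcLength := by
  have hLh : 0 < L * h := by positivity
  have ha1 : 0 < 1 + a := by linarith
  set X := ∫⁻ ξ in Metric.ball ζ (h / 4), g ξ ∂arcLength with hX
  set Y := ∫⁻ ξ in Metric.ball ζ (h / 4), g ξ ^ (-a) ∂arcLength with hY
  have hσ := le_arcLength_ball hζ (r := h / 4) (by linarith)
  have hJ : ENNReal.ofReal (h / 4) ^ (1 + a) ≤ X ^ a * Y := by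
    refine (ENNReal.rpow_le_rpow hσ ha1.le).trans ?_
    have := measure_rpow_le_lintegral_rpow_mul (arcLength.restrict (Metric.ball ζ (h / 4))) ha hg
      (Filter.Eventually.of_forall hg0) (ae_restrict_of_ae hgtop)
    rwa [Measure.restrict_apply_univ] at this
  have hX0 : X ≠ 0 := by
    intro hx
    rw [hx, ENNReal.zero_rpow_of_pos ha, zero_mul, nonpos_iff_eq_zero,
      ENNReal.rpow_eq_zero_iff_of_pos ha1] at hJ
    simp at hJ
    linarith
  have hw : ∫⁻ ξ in Metric.ball ζ (L * h), maximal arcLength L g ξ ^ (-a) ∂arcLength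
      ≤ (X / ENNReal.ofReal (L * h)) ^ (-a) * ENNReal.ofReal (20 * (L * h)) := by
    calc _ ≤ ∫⁻ ξ in Metric.ball ζ (L * h), (X / ENNReal.ofReal (L * h)) ^ (-a) ∂arcLength := by
          refine setLIntegral_mono' Metric.isOpen_ball.measurableSet fun ξ hξ => ?_
          rw [ENNReal.rpow_neg, ENNReal.rpow_neg, ENNReal.inv_le_inv]
          refine ENNReal.rpow_le_rpow ?_ ha.le
          refine le_trans ?_ (le_maximal _ _ hLh (by nlinarith) hξ)
          refine ENNReal.div_le_div_right (lintegral_mono_set ?_) _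
          exact (Metric.ball_subset_ball (by nlinarith)).trans Metric.ball_subset_closedBall
      _ ≤ _ := by
          rw [setLIntegral_const]
          gcongr
          exact (measure_mono Metric.ball_subset_closedBall).trans
            (arcLength_closedBall_le _ hLh.le)
  refine hw.trans ?_
  rcases eq_or_ne X ∞ with hx | hx
  · rw [hx, ENNReal.top_div_of_ne_top ENNReal.ofReal_ne_top, ENNReal.top_rpow_of_neg (by linarith),
      zero_mul]
    exact zero_le
  have hXa0 : X ^ a ≠ 0 := by simp [hX0, hx]
  have hXatop : X ^ a ≠ ∞ := ENNReal.rpow_ne_top_of_nonneg ha.le hx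
  have hY' : (X ^ a)⁻¹ * ENNReal.ofReal (h / 4) ^ (1 + a) ≤ Y := by
    rw [mul_comm, ← div_eq_mul_inv]
    exact ENNReal.div_le_of_le_mul' hJ
  calc (X / ENNReal.ofReal (L * h)) ^ (-a) * ENNReal.ofReal (20 * (L * h))
      = ENNReal.ofReal (20 * (4 * L) ^ (1 + a)) * ((X ^ a)⁻¹ * ENNReal.ofReal (h / 4) ^ (1 + a)) := by
        rw [ENNReal.rpow_neg, ENNReal.div_rpow_of_nonneg _ _ ha.le, ENNReal.inv_div
          (Or.inl (ENNReal.rpow_ne_top_of_nonneg ha.le ENNReal.ofReal_ne_top)) (Or.inr hXa0),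
          ENNReal.ofReal_rpow_of_pos hLh, ENNReal.ofReal_rpow_of_pos (by positivity),
          mul_left_comm (ENNReal.ofReal (20 * _)), ← ENNReal.ofReal_mul (by positivity),
          div_eq_mul_inv, mul_right_comm, ← ENNReal.ofReal_mul (by positivity), mul_comm]
        congr 2
        rw [mul_assoc, ← Real.mul_rpow (by positivity) (by positivity)]
        have : 4 * L * (h / 4) = L * h := by ring
        rw [this, Real.rpow_add hLh, Real.rpow_one]
        ring
    _ ≤ _ := by gcongr

/-- Let A be the narrow-cone mass and g = A^(s/2). The exponent a = 2(1 - s)/s is chosen so that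
g^(-a) = A^(s-1). Testing wide cones against (Mg)^(-a) then costs a multiple of ∫ A · A^(s-1) = ∫
A^s. Hölder with exponents s and 1 - s restores the s-th power, since -as + 2(1 - s) = 0, and ∫
(Mg)² is again bounded by a multiple of ∫ A^s. -/
lemma lintegral_cone_rpow_le_of_lt_one {β : ℝ} (hβ : β < 1) {s : ℝ} (hs0 : 0 < s) (hs : s < 1) :
    ∃ C : ℝ≥0∞, C ≠ ∞ ∧ ∀ μ : Measure ℂ, SFinite μ →
      ∫⁻ ξ, μ (cone β ξ) ^ s ∂arcLength ≤ C * ∫⁻ ξ, μ (cone (1 / 2) ξ) ^ s ∂arcLength := by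
  set L := 2 / (1 - β) + 2 with hL
  have hb : 0 < 1 - β := by linarith
  have hL1 : 1 ≤ L := by have : 0 < 2 / (1 - β) := by positivity
                         linarith
  set a : ℝ := 2 * (1 - s) / s with ha
  have ha0 : 0 < a := by have : 0 < 1 - s := by linarith
                         positivity
  set c : ℝ≥0∞ := ENNReal.ofReal (20 * (4 * L) ^ (1 + a)) with hc
  set K : ℝ≥0∞ := ENNReal.ofReal ((2 * 20) ^ (2 : ℝ) * 5 * (2 / (2 - 1))) with hK
  set C := c ^ s * K ^ (1 - s) with hC
  have hCtop : C ≠ ∞ := ENNReal.mul_ne_top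
    (ENNReal.rpow_ne_top_of_nonneg hs0.le ENNReal.ofReal_ne_top)
    (ENNReal.rpow_ne_top_of_nonneg (by linarith) ENNReal.ofReal_ne_top)
  refine ⟨C, hCtop, fun μ _ => ?_⟩
  have hA := measurable_measure_cone (1 / 2) μ
  have hB := measurable_measure_cone β μ
  rcases eq_or_ne (∫⁻ ξ, μ (cone (1 / 2) ξ) ^ s ∂arcLength) ∞ with hAtop | hAtop
  · rw [hAtop, ENNReal.mul_top]
    · exact le_top
    · have h1 : c ≠ 0 := by
        rw [hc, ne_eq, ENNReal.ofReal_eq_zero, not_le]; positivity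
      have h2 : K ≠ 0 := by
        rw [hK, ne_eq, ENNReal.ofReal_eq_zero, not_le]; norm_num
      exact mul_ne_zero (ENNReal.rpow_pos h1.bot_lt ENNReal.ofReal_ne_top).ne'
        (ENNReal.rpow_pos h2.bot_lt ENNReal.ofReal_ne_top).ne'
  -- Adding κ keeps A away from 0, so that negative powers are harmless. The error κ^s σ(𝕋) vanishes
  -- as κ → 0 because arc length is finite.
  have key : ∀ κ : ℝ≥0∞, κ ≠ 0 → κ ≠ ∞ → ∫⁻ ξ, μ (cone β ξ) ^ s ∂arcLength
      ≤ C * (∫⁻ ξ, μ (cone (1 / 2) ξ) ^ s ∂arcLength + κ ^ s * arcLength univ) := by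
    intro κ hκ0 hκtop
    set A' : ℂ → ℝ≥0∞ := fun ξ => μ (cone (1 / 2) ξ) + κ with hA'
    have hA'm : Measurable A' := hA.add_const κ
    have hA'0 : ∀ ξ, A' ξ ≠ 0 := fun ξ => by simp [hA', hκ0]
    set I := ∫⁻ ξ, A' ξ ^ s ∂arcLength with hI
    have hIle : I ≤ ∫⁻ ξ, μ (cone (1 / 2) ξ) ^ s ∂arcLength + κ ^ s * arcLength univ := by
      rw [← lintegral_const, ← lintegral_add_right _ measurable_const]
      exact lintegral_mono fun ξ => ENNReal.rpow_add_le_add_rpow _ _ hs0.le hs.le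
    have hItop : I ≠ ∞ := by
      refine ne_top_of_le_ne_top (ENNReal.add_ne_top.2 ⟨hAtop, ENNReal.mul_ne_top
        (ENNReal.rpow_ne_top_of_nonneg hs0.le hκtop) (measure_ne_top _ _)⟩) hIle
    have hA'top : ∀ᵐ ξ ∂arcLength, A' ξ ≠ ∞ := by
      filter_upwards [ae_lt_top (hA'm.pow_const s) hItop] with ξ hξ h
      rw [h, ENNReal.top_rpow_of_pos hs0] at hξ
      exact hξ.ne rfl
    set g : ℂ → ℝ≥0∞ := fun ξ => A' ξ ^ (s / 2) with hg
    have hgm : Measurable g := hA'm.pow_const _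
    have hs2 : 0 < s / 2 := by positivity
    have hg0 : ∀ ξ, g ξ ≠ 0 := fun ξ => by simp [hg, hA'0, hs2.not_gt]
    have hgtop : ∀ᵐ ξ ∂arcLength, g ξ ≠ ∞ := by
      filter_upwards [hA'top] with ξ hξ using ENNReal.rpow_ne_top_of_nonneg hs2.le hξ
    set M := maximal arcLength L g with hM
    have hMm : Measurable M := measurable_maximal _ _ _
    have hM2 : ∫⁻ ξ, M ξ ^ (2 : ℝ) ∂arcLength ≤ K * I := by
      refine (lintegral_maximal_rpow_le (by norm_num)
              (fun c _ hr => arcLength_closedBall_le c hr) L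
        one_lt_two hgm).trans_eq ?_
      congr 2
      ext ξ
      simp only [hg]
      rw [← ENNReal.rpow_mul]
      congr 1; ring
    have hMtop : ∀ᵐ ξ ∂arcLength, M ξ ≠ ∞ := by
      have : ∫⁻ ξ, M ξ ^ (2 : ℝ) ∂arcLength ≠ ∞ :=
        ne_top_of_le_ne_top (ENNReal.mul_ne_top ENNReal.ofReal_ne_top hItop) hM2
      filter_upwards [ae_lt_top (hMm.pow_const 2) this] with ξ hξ h
      rw [h, ENNReal.top_rpow_of_pos two_pos] at hξ
      exact hξ.ne rfl
    have hM0 : ∀ᵐ ξ ∂arcLength, M ξ ≠ 0 := by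
      filter_upwards [ae_arcLength_norm] with ξ hξ h
      have h1 := le_maximal arcLength g one_pos hL1 (Metric.mem_ball_self one_pos : ξ ∈ Metric.ball ξ 1)
      rw [← hM, h, ENNReal.ofReal_one, div_one, nonpos_iff_eq_zero, lintegral_eq_zero_iff hgm] at h1
      have h2 : arcLength (Metric.closedBall ξ 1) = 0 := by
        have h3 : ∀ᵐ x ∂arcLength.restrict (Metric.closedBall ξ 1), False := by
          filter_upwards [h1] with x hx using hg0 x hx
        simpa using h3
      have h4 := (le_arcLength_ball hξ le_rfl).trans (measure_mono Metric.ball_subset_closedBall)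
      rw [h2] at h4
      simp at h4
    have h1 : ∫⁻ ξ, μ (cone β ξ) * M ξ ^ (-a) ∂arcLength ≤ c * I := by
      refine (lintegral_measure_cone_mul_le hβ le_rfl μ (hMm.pow_const _) (hgm.pow_const (-a))
        (c := c) ENNReal.ofReal_ne_top fun ζ hζ h h0 h1 =>
        setLIntegral_maximal_rpow_neg_le hL1 ha0 hgm hg0 hgtop hζ h0 h1).trans ?_
      gcongr
      refine lintegral_mono_ae ?_
      filter_upwards [hA'top] with ξ hξ
      have e : g ξ ^ (-a) = A' ξ ^ (s - 1) := by
        simp only [hg]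
        rw [← ENNReal.rpow_mul]
        congr 1
        rw [ha]; field_simp; ring
      rw [e]
      calc μ (cone (1 / 2) ξ) * A' ξ ^ (s - 1) ≤ A' ξ * A' ξ ^ (s - 1) := by
            gcongr; exact le_self_add
        _ = A' ξ ^ s := by
            nth_rw 1 [← ENNReal.rpow_one (A' ξ)]
            rw [← ENNReal.rpow_add _ _ (hA'0 ξ) hξ]
            ring_nf
    calc ∫⁻ ξ, μ (cone β ξ) ^ s ∂arcLength
        = ∫⁻ ξ, (μ (cone β ξ) * M ξ ^ (-a)) ^ s * (M ξ ^ (2 : ℝ)) ^ (1 - s) ∂arcLength := by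
          refine lintegral_congr_ae ?_
          filter_upwards [hM0, hMtop] with ξ h0 htop
          rw [ENNReal.mul_rpow_of_nonneg _ _ hs0.le, mul_assoc, ← ENNReal.rpow_mul,
            ← ENNReal.rpow_mul, ← ENNReal.rpow_add _ _ h0 htop]
          have : -a * s + 2 * (1 - s) = 0 := by rw [ha]; field_simp; ring
          rw [this, ENNReal.rpow_zero, mul_one]
      _ ≤ (∫⁻ ξ, μ (cone β ξ) * M ξ ^ (-a) ∂arcLength) ^ s
            * (∫⁻ ξ, M ξ ^ (2 : ℝ) ∂arcLength) ^ (1 - s) :=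
          ENNReal.lintegral_mul_norm_pow_le (hB.mul (hMm.pow_const _)).aemeasurable
            (hMm.pow_const _).aemeasurable hs0.le (by linarith) (by ring)
      _ ≤ (c * I) ^ s * (K * I) ^ (1 - s) := by
          have : 0 ≤ 1 - s := by linarith
          gcongr
      _ = C * I := by
          have h2 : I ^ s * I ^ (1 - s) = I := by
            rw [← ENNReal.rpow_add_of_nonneg _ _ hs0.le (by linarith)]
            simp
          rw [ENNReal.mul_rpow_of_nonneg _ _ hs0.le, ENNReal.mul_rpow_of_nonneg _ _ (by linarith), hC]
          nth_rw 3 [← h2]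
          ring
      _ ≤ _ := by gcongr
  refine ENNReal.le_of_forall_pos_le_add fun ε hε _ => ?_
  have hD : C * arcLength univ + 1 ≠ ∞ :=
    ENNReal.add_ne_top.2 ⟨ENNReal.mul_ne_top hCtop (measure_ne_top _ _), ENNReal.one_ne_top⟩
  set τ : ℝ≥0∞ := ε / (C * arcLength univ + 1) with hτ
  have hτ0 : τ ≠ 0 := by simp [hτ, hD, hε.ne']
  have hτtop : τ ≠ ∞ := ENNReal.div_ne_top ENNReal.coe_ne_top (by simp)
  have := key (τ ^ (1 / s)) (by simp [hτ0, hs0.not_gt, hτtop])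
    (ENNReal.rpow_ne_top_of_nonneg (by positivity) hτtop)
  refine this.trans ?_
  rw [← ENNReal.rpow_mul, one_div_mul_cancel hs0.ne', ENNReal.rpow_one, mul_add]
  gcongr
  calc C * (τ * arcLength univ) = τ * (C * arcLength univ) := by ring
    _ ≤ τ * (C * arcLength univ + 1) := by gcongr; exact le_self_add
    _ = ε := ENNReal.div_mul_cancel (by simp) hD

/-- Change of aperture: wide cones are controlled by cones of aperture `1 / 2`. -/
theorem lintegral_cone_rpow_le {β : ℝ} (hβ : β < 1) {s : ℝ} (hs : 0 < s) :
    ∃ C : ℝ≥0∞, C ≠ ∞ ∧ ∀ μ : Measure ℂ, SFinite μ →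
      ∫⁻ ξ, μ (cone β ξ) ^ s ∂arcLength ≤ C * ∫⁻ ξ, μ (cone (1 / 2) ξ) ^ s ∂arcLength := by
  rcases lt_trichotomy s 1 with h | rfl | h
  · exact lintegral_cone_rpow_le_of_lt_one hβ hs h
  · simpa using lintegral_cone_le hβ
  · exact lintegral_cone_rpow_le_of_one_lt hβ h

/-! ### Sub-mean value properties of |f|^r -/

open Real in
/-- `|f| ^ r` has the sub-mean value property on circles. -/
lemma norm_rpow_le_circleAverage {f : ℂ → ℂ} {c : ℂ} {R : ℝ} (hR : 0 < R)
    (hf : AnalyticOnNhd ℂ f (Metric.closedBall c R)) {r : ℝ} (hr : 0 < r) :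
    ‖f c‖ ^ r ≤ circleAverage (fun z => ‖f z‖ ^ r) c R := by
  rcases eq_or_ne (f c) 0 with h0 | h0
  · rw [h0, norm_zero, zero_rpow hr.ne']
    exact circleAverage_nonneg_of_nonneg fun z _ => by positivity
  have habs : |R| = R := abs_of_pos hR
  have hf' : AnalyticOnNhd ℂ f (Metric.closedBall c |R|) := by rwa [habs]
  have hint : CircleIntegrable (fun z => log ‖f z‖) c R :=
    (hf'.mono Metric.sphere_subset_closedBall).meromorphicOn.circleIntegrable_log_norm
  set A := circleAverage (fun z => log ‖f z‖) c R with hA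
  -- Jensen's formula: a zero u in the disc contributes a nonnegative multiple of log(R/|c - u|) ≥
  -- 0, or 0 when u lies outside.
  have hjensen : log ‖f c‖ ≤ A := by
    rw [hA, hf'.circleAverage_log_norm hR.ne' h0]
    simp only [le_add_iff_nonneg_left]
    refine finsum_nonneg fun u => ?_
    by_cases hu : u ∈ Metric.closedBall c |R|
    · refine mul_nonneg (mod_cast MeromorphicOn.AnalyticOnNhd.divisor_nonneg hf' ..) ?_
      rcases eq_or_ne u c with rfl | huc
      · simp
      · have : 0 < ‖c - u‖ := by rw [norm_pos_iff, sub_ne_zero]; exact huc.symm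
        apply log_nonneg
        rw [← div_eq_mul_inv, one_le_div this, ← dist_eq_norm, dist_comm]
        rw [habs] at hu
        exact hu
    · simp [hu]
  -- At a zero of f the left side is exp 0 = 1, as `log 0 = 0`, and the right side is 0; the two
  -- agree off the zeros, which are isolated.
  have hcod : (fun z => exp (r * log ‖f z‖)) =ᶠ[Filter.codiscreteWithin (Metric.sphere c |R|)]
      fun z => ‖f z‖ ^ r := by
    have : f ⁻¹' {0}ᶜ ∈ Filter.codiscreteWithin (Metric.closedBall c |R|) :=
      hf'.preimage_zero_mem_codiscreteWithin h0 (by simp) 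
        ((convex_closedBall c |R|).isConnected ⟨c, by simp⟩)
    filter_upwards [Filter.codiscreteWithin_mono Metric.sphere_subset_closedBall this] with z hz
    rw [rpow_def_of_pos (norm_pos_iff.2 hz), mul_comm]
  have hcont : CircleIntegrable (fun z => ‖f z‖ ^ r) c R := by
    apply ContinuousOn.circleIntegrable hR.le
    exact ((hf.continuousOn.mono Metric.sphere_subset_closedBall).norm).rpow_const
      fun _ _ => Or.inr hr.le
  rw [← circleAverage_congr_codiscreteWithin hcod hR.ne']
  have hcont' : CircleIntegrable (fun z => exp (r * log ‖f z‖)) c R :=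
    (circleIntegrable_congr_codiscreteWithin hcod).2 hcont
  -- This is the tangent line of exp at rA, evaluated at r log|f|. It lies below exp and its circle
  -- average is exp(rA).
  have hlin : CircleIntegrable (fun z => exp (r * A) * (r * log ‖f z‖ + (1 - r * A))) c R :=
    ((hint.const_smul (a := r)).add (circleIntegrable_const _ _ _)).const_smul (a := exp (r * A))
  calc ‖f c‖ ^ r = exp (r * log ‖f c‖) := by
        rw [rpow_def_of_pos (norm_pos_iff.2 h0), mul_comm]
    _ ≤ exp (r * A) := by gcongr
    _ = circleAverage (fun z => exp (r * A) * (r * log ‖f z‖ + (1 - r * A))) c R := by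
        have h1 := circleAverage_fun_smul (a := exp (r * A)) (c := c) (R := R)
          (f := fun z => r * log ‖f z‖ + (1 - r * A))
        simp only [smul_eq_mul] at h1
        have h2 := circleAverage_fun_add (f₁ := fun z => r * log ‖f z‖) (hint.const_smul (a := r))
          (circleIntegrable_const (1 - r * A) c R)
        have h3 := circleAverage_fun_smul (a := r) (c := c) (R := R) (f := fun z => log ‖f z‖)
        simp only [smul_eq_mul] at h3
        rw [h1, h2, h3, circleAverage_const, ← hA]
        ring
    _ ≤ _ := by
        refine circleAverage_mono hlin hcont' fun z _ => ?_
        calc exp (r * A) * (r * log ‖f z‖ + (1 - r * A))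
            ≤ exp (r * A) * exp (r * log ‖f z‖ - r * A) := by
              gcongr
              linarith [add_one_le_exp (r * log ‖f z‖ - r * A)]
          _ = exp (r * log ‖f z‖) := by rw [← exp_add]; ring_nf

/-- The angle is shifted to (-π, π), the range of polar coordinates, so that the bound can be
integrated over radii. -/
lemma ofReal_two_pi_mul_enorm_rpow_le {f : ℂ → ℂ} {c : ℂ} {R : ℝ} (hR : 0 < R)
    (hf : AnalyticOnNhd ℂ f (Metric.closedBall c R)) {r : ℝ} (hr : 0 < r) :
    ENNReal.ofReal (2 * Real.pi) * ‖f c‖ₑ ^ r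
      ≤ ∫⁻ θ in Ioo (-Real.pi) Real.pi, ‖f (circleMap c R θ)‖ₑ ^ r := by
  have hp := Real.pi_pos
  have h := norm_rpow_le_circleAverage hR hf hr
  have hc : Continuous fun θ => ‖f (circleMap c R θ)‖ ^ r := by
    refine Continuous.rpow_const (Continuous.norm ?_) fun _ => Or.inr hr.le
    exact hf.continuousOn.comp_continuous (by fun_prop)
      fun θ => Metric.sphere_subset_closedBall (circleMap_mem_sphere c hR.le θ)
  have hper : Function.Periodic (fun θ => ‖f (circleMap c R θ)‖ ^ r) (2 * Real.pi) := by
    intro θ; simp only [periodic_circleMap c R θ]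
  have hshift := hper.intervalIntegral_add_eq 0 (-Real.pi)
  rw [Real.circleAverage, smul_eq_mul, ← zero_add (2 * Real.pi), hshift, zero_add] at h
  have e : -Real.pi + 2 * Real.pi = Real.pi := by ring
  rw [e, inv_mul_eq_div, le_div_iff₀ (by positivity),
    intervalIntegral.integral_of_le (by linarith), integral_Ioc_eq_integral_Ioo] at h
  have h2 := ENNReal.ofReal_le_ofReal h
  rw [ofReal_integral_eq_lintegral_ofReal
    ((hc.integrableOn_Icc (a := -Real.pi) (b := Real.pi)).mono_set Ioo_subset_Icc_self)
    (Filter.Eventually.of_forall fun _ => by positivity), mul_comm,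
    ENNReal.ofReal_mul (by positivity), ← ENNReal.ofReal_rpow_of_nonneg (norm_nonneg _) hr.le,
    ofReal_norm] at h2
  refine h2.trans_eq ?_
  refine lintegral_congr fun θ => ?_
  rw [← ENNReal.ofReal_rpow_of_nonneg (norm_nonneg _) hr.le, ofReal_norm]

/-- Integration in polar coordinates about the point `c`. -/
lemma lintegral_eq_lintegral_circleMap {g : ℂ → ℝ≥0∞} (hg : Measurable g) (c : ℂ) :
    ∫⁻ z, g z = ∫⁻ ρ in Ioi (0 : ℝ), ENNReal.ofReal ρ *
      ∫⁻ θ in Ioo (-Real.pi) Real.pi, g (circleMap c ρ θ) := by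
  rw [← lintegral_add_left_eq_self g c, ← Complex.lintegral_comp_polarCoord_symm]
  rw [polarCoord_target, Measure.volume_eq_prod, ← Measure.prod_restrict, lintegral_prod]
  · refine lintegral_congr fun ρ => ?_
    rw [← lintegral_const_mul' _ _ ENNReal.ofReal_ne_top]
    refine lintegral_congr fun θ => ?_
    rw [Complex.polarCoord_symm_apply, smul_eq_mul, circleMap, Complex.exp_mul_I]
    simp
  · apply Measurable.aemeasurable
    simp_rw [Complex.polarCoord_symm_apply]
    fun_prop

lemma lintegral_norm_sub {F : ℝ → ℝ≥0∞} (hF : Measurable F) (c : ℂ) :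
    ∫⁻ z, F ‖z - c‖ = ENNReal.ofReal (2 * Real.pi) *
      ∫⁻ ρ in Ioi (0 : ℝ), ENNReal.ofReal ρ * F ρ := by
  rw [lintegral_eq_lintegral_circleMap (by fun_prop) c, ← lintegral_const_mul' _ _ ENNReal.ofReal_ne_top]
  refine setLIntegral_congr_fun measurableSet_Ioi fun ρ (hρ : 0 < ρ) => ?_
  have : ∀ θ, ‖circleMap c ρ θ - c‖ = ρ := fun θ => by
    simp [circleMap, abs_of_pos hρ]
  simp only [this, lintegral_const, Measure.restrict_apply_univ, Real.volume_Ioo]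
  have e : Real.pi - -Real.pi = 2 * Real.pi := by ring
  rw [e]; ring

/-- `|f| ^ r` has the sub-mean value property on discs. -/
lemma volume_ball_mul_enorm_rpow_le {f : ℂ → ℂ} {c : ℂ} {R : ℝ}
    (hf : DifferentiableOn ℂ f (Metric.ball c R)) {r : ℝ} (hr : 0 < r) :
    volume (Metric.ball c R) * ‖f c‖ₑ ^ r ≤ ∫⁻ z in Metric.ball c R, ‖f z‖ₑ ^ r := by
  have hm : MeasurableSet (Metric.ball c R) := Metric.isOpen_ball.measurableSet
  have hfm : Measurable ((Metric.ball c R).indicator f) := by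
    classical
    rw [← piecewise_eq_indicator]
    exact hf.continuousOn.measurable_piecewise continuousOn_const hm
  have hgm : Measurable ((Metric.ball c R).indicator fun z => ‖f z‖ₑ ^ r) := by
    have : ((Metric.ball c R).indicator fun z => ‖f z‖ₑ ^ r)
        = fun z => ‖(Metric.ball c R).indicator f z‖ₑ ^ r := by
      ext z
      by_cases hz : z ∈ Metric.ball c R
      · simp [hz]
      · simp [hz, hr]
    rw [this]
    fun_prop
  rw [mul_comm, ← setLIntegral_const, ← lintegral_indicator hm, ← lintegral_indicator hm,
    lintegral_eq_lintegral_circleMap (measurable_const.indicator hm) c,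
    lintegral_eq_lintegral_circleMap hgm c]
  refine setLIntegral_mono' measurableSet_Ioi fun ρ (hρ : 0 < ρ) => ?_
  gcongr ENNReal.ofReal ρ * ?_
  have hd : ∀ θ, dist (circleMap c ρ θ) c = ρ := fun θ => by
    simp [circleMap, dist_eq_norm, abs_of_pos hρ]
  by_cases hρR : ρ < R
  · have hmem : ∀ θ, circleMap c ρ θ ∈ Metric.ball c R := fun θ => by
      rw [Metric.mem_ball, hd]; exact hρR
    simp only [indicator_of_mem (hmem _)]
    have han : AnalyticOnNhd ℂ f (Metric.closedBall c ρ) :=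
      (hf.analyticOnNhd Metric.isOpen_ball).mono (Metric.closedBall_subset_ball hρR)
    refine le_trans (le_of_eq ?_) (ofReal_two_pi_mul_enorm_rpow_le hρ han hr)
    rw [setLIntegral_const, Real.volume_Ioo, mul_comm]
    congr 2; ring
  · have hmem : ∀ θ, circleMap c ρ θ ∉ Metric.ball c R := fun θ => by
      rw [Metric.mem_ball, hd]; exact hρR
    simp [indicator_of_notMem (hmem _)]

/-- Either y ≤ tx or tx ≤ y, and the larger absorbs the smaller. The asymmetry keeps the factor on
the term that must remain small down to (1 + t)^N. -/
lemma add_pow_le_mul_add_mul {t : ℝ≥0∞} (ht0 : t ≠ 0) (httop : t ≠ ∞) (x y : ℝ≥0∞) (N : ℕ) :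
    (x + y) ^ N ≤ (1 + t) ^ N * x ^ N + (1 + t⁻¹) ^ N * y ^ N := by
  rw [← mul_pow, ← mul_pow]
  rcases le_total y (t * x) with h | h
  · refine le_trans ?_ le_self_add
    gcongr
    rw [add_mul, one_mul]
    gcongr
  · refine le_trans ?_ le_add_self
    gcongr
    rw [add_mul, one_mul, add_comm]
    gcongr
    rw [mul_comm, ← div_eq_mul_inv]
    exact (ENNReal.le_div_iff_mul_le (Or.inl ht0) (Or.inl httop)).2 (by rwa [mul_comm])

/-- If `G` has density at least `δ` in a disc, then the value of `|f| ^ p` at the centre is bounded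
by a small multiple of its mean over the disc and a large multiple of its mean over `G`. -/
lemma exists_volume_ball_mul_enorm_rpow_le {p : ℝ} (hp : 0 < p) {δ : ℝ} (hδ0 : 0 < δ) (hδ1 : δ ≤ 1)
    {ε : ℝ} (hε : 0 < ε) : ∃ C : ℝ≥0∞, C ≠ ∞ ∧ ∀ (f : ℂ → ℂ) (c : ℂ) (R : ℝ) (G : Set ℂ), 0 < R →
      DifferentiableOn ℂ f (Metric.ball c R) → NullMeasurableSet G volume →
      ENNReal.ofReal δ * volume (Metric.ball c R) ≤ volume (G ∩ Metric.ball c R) →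
      volume (Metric.ball c R) * ‖f c‖ₑ ^ p ≤
        ENNReal.ofReal ε * (∫⁻ z in Metric.ball c R, ‖f z‖ₑ ^ p)
          + C * ∫⁻ z in Metric.ball c R ∩ G, ‖f z‖ₑ ^ p := by
  -- The final coefficient is (1 + δ)^(n+1) (1 - δ)^n = (1 + δ)(1 - δ²)^n, and 1 + δ ≤ 2.
  obtain ⟨n, hn⟩ : ∃ n : ℕ, (1 - δ ^ 2) ^ n < ε / 2 :=
    exists_pow_lt_of_lt_one (by positivity) (by nlinarith)
  set t : ℝ≥0∞ := ENNReal.ofReal δ with ht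
  have ht0 : t ≠ 0 := by simpa [ht] using hδ0
  set C : ℝ≥0∞ := (1 + t⁻¹) ^ (n + 1) with hC
  refine ⟨C, ENNReal.pow_ne_top (ENNReal.add_ne_top.2 ⟨ENNReal.one_ne_top,
    ENNReal.inv_ne_top.2 ht0⟩), fun f c R G hR hf hG hd => ?_⟩
  set B := Metric.ball c R with hB
  set V := volume B with hV
  have hV0 : V ≠ 0 := (Metric.measure_ball_pos _ _ hR).ne'
  have hVtop : V ≠ ∞ := measure_ball_lt_top.ne
  -- The mean value inequality is applied to |f|^(pa). Hölder then yields the volume to the power 1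
  -- - a, which becomes (1 - δ)^n on the part outside G once everything is raised to the power n +
  -- 1.
  set a : ℝ := 1 / (n + 1 : ℝ) with ha
  have ha0 : 0 < a := by positivity
  have ha1 : 0 ≤ 1 - a := by
    rw [ha, sub_nonneg, div_le_one (by positivity)]
    have : (0 : ℝ) ≤ n := Nat.cast_nonneg n
    linarith
  have han : a * (n + 1 : ℝ) = 1 := by rw [ha]; field_simp
  have hdiff : volume (B \ G) ≤ ENNReal.ofReal (1 - δ) * V := by
    have h1 : volume (B ∩ G) + volume (B \ G) = V := measure_inter_add_sdiff₀ B hG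
    rw [inter_comm] at hd
    have h2 : t * V + volume (B \ G) ≤ t * V + ENNReal.ofReal (1 - δ) * V := by
      rw [← add_mul, ht, ← ENNReal.ofReal_add hδ0.le (by linarith)]
      calc _ ≤ volume (B ∩ G) + volume (B \ G) := by gcongr
        _ = _ := by rw [h1]; simp
    exact (ENNReal.add_le_add_iff_left (ENNReal.mul_ne_top ENNReal.ofReal_ne_top hVtop)).1 h2
  have hfm : AEMeasurable (fun z => ‖f z‖ₑ ^ p) (volume.restrict B) :=
    ((hf.continuousOn.aemeasurable Metric.isOpen_ball.measurableSet).enorm).pow_const p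
  set S := ∫⁻ z in B, ‖f z‖ₑ ^ p with hS
  set SG := ∫⁻ z in B ∩ G, ‖f z‖ₑ ^ p with hSG
  have holder : ∀ E : Set ℂ, E ⊆ B →
      ∫⁻ z in E, ‖f z‖ₑ ^ (p * a) ≤ (∫⁻ z in E, ‖f z‖ₑ ^ p) ^ a * volume E ^ (1 - a) := by
    intro E hE
    have := ENNReal.lintegral_mul_norm_pow_le (μ := volume.restrict E)
      (hfm.mono_measure (Measure.restrict_mono hE le_rfl)) (aemeasurable_const (b := (1 : ℝ≥0∞)))
      ha0.le ha1 (by ring)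
    simpa [ENNReal.rpow_mul] using this
  have h1 : V * ‖f c‖ₑ ^ (p * a) ≤ SG ^ a * V ^ (1 - a) +
      S ^ a * (ENNReal.ofReal (1 - δ) * V) ^ (1 - a) := by
    refine (volume_ball_mul_enorm_rpow_le hf (by positivity)).trans ?_
    have : ∫⁻ z in B, ‖f z‖ₑ ^ (p * a) ≤ (∫⁻ z in B ∩ G, ‖f z‖ₑ ^ (p * a))
        + ∫⁻ z in B \ G, ‖f z‖ₑ ^ (p * a) := by
      nth_rw 1 [← inter_union_sdiff B G]
      exact lintegral_union_le _ _ _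
    refine this.trans (add_le_add ((holder _ inter_subset_left).trans ?_)
      ((holder _ sdiff_subset).trans ?_))
    · gcongr
      exact measure_mono inter_subset_left
    · gcongr ?_ ^ a * ?_ ^ (1 - a)
      exact lintegral_mono_set sdiff_subset
  have h2 := pow_le_pow_left' h1 (n + 1)
  have hpow : ∀ x : ℝ≥0∞, (x ^ a) ^ (n + 1) = x := fun x => by
    rw [← ENNReal.rpow_natCast, ← ENNReal.rpow_mul]
    push_cast
    rw [han, ENNReal.rpow_one]
  have hpow' : ∀ x : ℝ≥0∞, (x ^ (1 - a)) ^ (n + 1) = x ^ n := fun x => by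
    rw [← ENNReal.rpow_natCast, ← ENNReal.rpow_mul]
    push_cast
    rw [sub_mul, han]
    simp
  rw [add_comm (SG ^ a * _)] at h2
  have h3 := h2.trans (add_pow_le_mul_add_mul ht0 ENNReal.ofReal_ne_top _ _ (n + 1))
  rw [mul_pow, mul_pow, mul_pow, hpow, hpow, hpow', hpow', ENNReal.rpow_mul, hpow, mul_pow] at h3
  have hVn0 : V ^ n ≠ 0 := pow_ne_zero _ hV0
  have hVntop : V ^ n ≠ ∞ := ENNReal.pow_ne_top hVtop
  refine (ENNReal.mul_le_mul_iff_right hVn0 hVntop).1 ?_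
  calc V ^ n * (V * ‖f c‖ₑ ^ p) = V ^ (n + 1) * ‖f c‖ₑ ^ p := by ring
    _ ≤ _ := h3
    _ = V ^ n * (((1 + t) ^ (n + 1) * ENNReal.ofReal (1 - δ) ^ n) * S + C * SG) := by
        rw [hC]; ring
    _ ≤ _ := by
        gcongr _ * (?_ * _ + _)
        rw [ht, ← ENNReal.ofReal_one, ← ENNReal.ofReal_add zero_le_one hδ0.le,
          ← ENNReal.ofReal_pow (by linarith), ← ENNReal.ofReal_pow (by linarith),
          ← ENNReal.ofReal_mul (by positivity)]
        apply ENNReal.ofReal_le_ofReal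
        have e : (1 + δ) ^ (n + 1) * (1 - δ) ^ n = (1 + δ) * (1 - δ ^ 2) ^ n := by
          have : 1 - δ ^ 2 = (1 + δ) * (1 - δ) := by ring
          rw [this, mul_pow]; ring
        rw [e]
        have : 0 ≤ (1 - δ ^ 2) ^ n := pow_nonneg (by nlinarith) n
        nlinarith

/-! ### Areas of discs and disc averages over cones -/

lemma area_apply_of_subset {E : Set ℂ} (hE : E ⊆ unitDisc) :
    area E = (ENNReal.ofReal Real.pi)⁻¹ * volume E := by
  rw [area, Measure.smul_apply, Measure.restrict_eq_self _ hE, smul_eq_mul]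

lemma setLIntegral_area_of_subset {E : Set ℂ} (hE : E ⊆ unitDisc) (g : ℂ → ℝ≥0∞) :
    ∫⁻ z in E, g z ∂area = (ENNReal.ofReal Real.pi)⁻¹ * ∫⁻ z in E, g z := by
  rw [area, Measure.restrict_smul, Measure.restrict_restrict_of_subset hE, lintegral_smul_measure,
    smul_eq_mul]

lemma volume_ball_eq (c : ℂ) {r : ℝ} (hr : 0 ≤ r) :
    volume (Metric.ball c r) = ENNReal.ofReal Real.pi * ENNReal.ofReal (r ^ 2) := by
  rw [Complex.volume_ball, ← ENNReal.ofReal_pow hr, mul_comm]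
  congr 1
  rw [ENNReal.ofReal, ENNReal.coe_inj]
  exact Subtype.ext (by simp [Real.pi_pos.le])

lemma ofReal_pi_inv_mul_cancel (x : ℝ≥0∞) :
    (ENNReal.ofReal Real.pi)⁻¹ * (ENNReal.ofReal Real.pi * x) = x :=
  ENNReal.inv_mul_cancel_left' (by simp [Real.pi_pos]) (by simp)

lemma area_ball_eq {c : ℂ} {r : ℝ} (hr : 0 ≤ r) (h : Metric.ball c r ⊆ unitDisc) :
    area (Metric.ball c r) = ENNReal.ofReal (r ^ 2) := by
  rw [area_apply_of_subset h, volume_ball_eq c hr, ofReal_pi_inv_mul_cancel]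

lemma area_ball_le (c : ℂ) {r : ℝ} (hr : 0 ≤ r) :
    area (Metric.ball c r) ≤ ENNReal.ofReal (r ^ 2) := by
  rw [← ofReal_pi_inv_mul_cancel (ENNReal.ofReal (r ^ 2)), ← volume_ball_eq c hr, area,
    Measure.smul_apply, smul_eq_mul]
  gcongr
  exact Measure.restrict_le_self

lemma ball_subset_unitDisc {η : ℝ} (hη : η < 1) {α : ℂ} (hα : ‖α‖ < 1) :
    Metric.ball α (η * (1 - ‖α‖)) ⊆ unitDisc := by
  intro z hz
  rw [mem_unitDisc]
  rw [Metric.mem_ball, dist_eq_norm] at hz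
  have : ‖z‖ ≤ ‖z - α‖ + ‖α‖ := by simpa using norm_add_le (z - α) α
  nlinarith

lemma euclDisc_eq_ball {η : ℝ} (hη : η < 1) {α : ℂ} (hα : ‖α‖ < 1) :
    euclDisc η α = Metric.ball α (η * (1 - ‖α‖)) := by
  ext z
  simp only [euclDisc, mem_ofPred_eq, Metric.mem_ball, dist_eq_norm, and_iff_right_iff_imp]
  intro h
  exact ball_subset_unitDisc hη hα (by rwa [Metric.mem_ball, dist_eq_norm])

/-- The averages of a measure over the discs `|w - z| < η (1 - |z|)`, integrated over a cone, are
controlled by the measure of a wider cone. -/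
lemma exists_setLIntegral_cone_le {η : ℝ} (hη0 : 0 < η) (hη : η < 1) :
    ∃ β : ℝ, 0 < β ∧ β < 1 ∧ ∀ μ : Measure ℂ, SFinite μ → ∀ ξ : ℂ, ‖ξ‖ = 1 →
      ∫⁻ z in cone (1 / 2) ξ, μ (Metric.ball z (η * (1 - ‖z‖))) / ENNReal.ofReal ((1 - ‖z‖) ^ 2)
        ∂area ≤ ENNReal.ofReal (4 * (η / (1 - η)) ^ 2) * μ (cone β ξ) := by
  have h1η : 0 < 1 - η := by linarith
  -- For w in the disc about z in the narrow cone, |w - ξ| ≤ (η + 4)(1 - |z|) ≤ 5(1 - |w|)/(1 - η).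
  set C : ℝ := 5 / (1 - η) with hC
  have hC1 : 1 ≤ C := by rw [hC, le_div_iff₀ h1η]; linarith
  have hC2 : 0 < 1 / (4 * C ^ 2) ∧ 1 / (4 * C ^ 2) < 1 := by
    refine ⟨by positivity, ?_⟩
    rw [div_lt_one (by positivity)]
    nlinarith
  refine ⟨1 - 1 / (4 * C ^ 2), by linarith [hC2.2], by linarith [hC2.1], fun μ _ ξ hξ => ?_⟩
  set β := 1 - 1 / (4 * C ^ 2) with hβ
  set E : Set (ℂ × ℂ) := {x | x.1 ∈ cone (1 / 2) ξ ∧ ‖x.2 - x.1‖ < η * (1 - ‖x.1‖)} with hE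
  have hEm : MeasurableSet E :=
    (measurable_fst (measurableSet_cone (1 / 2) ξ)).inter
      (measurableSet_lt (measurable_snd.sub measurable_fst).norm
        (measurable_const.mul (measurable_const.sub measurable_fst.norm)))
  set φ : ℂ × ℂ → ℝ≥0∞ := fun x => (ENNReal.ofReal ((1 - ‖x.1‖) ^ 2))⁻¹ with hφ
  calc ∫⁻ z in cone (1 / 2) ξ, μ (Metric.ball z (η * (1 - ‖z‖))) / ENNReal.ofReal ((1 - ‖z‖) ^ 2)
        ∂area
      = ∫⁻ z, (∫⁻ w, E.indicator φ (z, w) ∂μ) ∂area := by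
        rw [← lintegral_indicator (measurableSet_cone _ ξ)]
        refine lintegral_congr fun z => ?_
        by_cases hz : z ∈ cone (1 / 2) ξ
        · rw [indicator_of_mem hz, div_eq_mul_inv, mul_comm, ← setLIntegral_const,
            ← lintegral_indicator Metric.isOpen_ball.measurableSet]
          refine lintegral_congr fun w => ?_
          by_cases hw : w ∈ Metric.ball z (η * (1 - ‖z‖))
          · rw [indicator_of_mem hw, indicator_of_mem (show (z, w) ∈ E from ⟨hz, by rwa [← dist_eq_norm]⟩)]
          · rw [indicator_of_notMem hw, indicator_of_notMem]
            exact fun h => hw (by rw [Metric.mem_ball, dist_eq_norm]; exact h.2)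
        · rw [indicator_of_notMem hz]
          have : ∀ w, E.indicator φ (z, w) = 0 := fun w => indicator_of_notMem (fun h => hz h.1) _
          simp [this]
    _ = ∫⁻ w, (∫⁻ z, E.indicator φ (z, w) ∂area) ∂μ :=
        lintegral_lintegral_swap
          ((Measurable.indicator (by fun_prop) hEm).aemeasurable)
    _ ≤ ∫⁻ w, (cone β ξ).indicator (fun _ => ENNReal.ofReal (4 * (η / (1 - η)) ^ 2)) w ∂μ := by
        refine lintegral_mono fun w => ?_
        have key : ∀ z, (z, w) ∈ E → ‖z‖ < 1 ∧ (1 - η) * (1 - ‖z‖) ≤ 1 - ‖w‖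
            ∧ 1 - ‖w‖ ≤ 2 * (1 - ‖z‖) ∧ w ∈ cone β ξ := by
          rintro z ⟨hz, hw⟩
          simp only at hz hw
          have hz1 := norm_lt_one_of_mem_cone (by norm_num) hξ hz
          have hz2 := norm_sub_le_of_mem_cone (by norm_num) hξ hz
          have h1 : ‖w‖ ≤ ‖w - z‖ + ‖z‖ := by simpa using norm_add_le (w - z) z
          have h2 : ‖z‖ ≤ ‖w - z‖ + ‖w‖ := by
            rw [norm_sub_rev]; simpa using norm_add_le (z - w) w
          have h3 : ‖w - ξ‖ ≤ ‖w - z‖ + ‖z - ξ‖ := by simpa using norm_add_le (w - z) (z - ξ)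
          have h4 : (1 - η) * (1 - ‖z‖) ≤ 1 - ‖w‖ := by linarith
          have h5 : 0 < (1 - η) * (1 - ‖z‖) := mul_pos h1η (by linarith)
          refine ⟨hz1, h4, by nlinarith, mem_cone_of_norm_sub_le hC1 hξ (by linarith) ?_⟩
          rw [hC, div_mul_eq_mul_div, le_div_iff₀ h1η]
          norm_num at hz2
          nlinarith [norm_nonneg (w - ξ)]
        by_cases hw : w ∈ cone β ξ
        · rw [indicator_of_mem hw]
          have hw1 := norm_lt_one_of_mem_cone (by linarith [hC2.1]) hξ hw
          have hh : 0 < 1 - ‖w‖ := by linarith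
          -- Every z whose disc contains w is within η(1 - |w|)/(1 - η) of w and has 1 - |z| ≥ (1 -
          -- |w|)/2, so the powers of 1 - |w| cancel.
          calc ∫⁻ z, E.indicator φ (z, w) ∂area
              ≤ ∫⁻ z in Metric.ball w (η / (1 - η) * (1 - ‖w‖)),
                  ENNReal.ofReal (4 / (1 - ‖w‖) ^ 2) ∂area := by
                rw [← lintegral_indicator Metric.isOpen_ball.measurableSet]
                refine lintegral_mono fun z => ?_
                by_cases hz : (z, w) ∈ E
                · obtain ⟨h1, h2, h3, -⟩ := key z hz
                  have hzpos : 0 < 1 - ‖z‖ := by linarith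
                  rw [indicator_of_mem hz, indicator_of_mem, hφ]
                  · simp only
                    rw [← ENNReal.ofReal_inv_of_pos (by positivity)]
                    apply ENNReal.ofReal_le_ofReal
                    rw [inv_eq_one_div, div_le_div_iff₀ (by positivity) (by positivity)]
                    nlinarith
                  · rw [Metric.mem_ball, dist_eq_norm, norm_sub_rev]
                    refine lt_of_lt_of_le hz.2 ?_
                    simp only
                    rw [div_mul_eq_mul_div, le_div_iff₀ h1η]
                    nlinarith
                · rw [indicator_of_notMem hz]; exact zero_le
            _ ≤ ENNReal.ofReal (4 / (1 - ‖w‖) ^ 2)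
                  * ENNReal.ofReal ((η / (1 - η) * (1 - ‖w‖)) ^ 2) := by
                rw [setLIntegral_const]
                gcongr
                exact area_ball_le w (by positivity)
            _ = _ := by
                rw [← ENNReal.ofReal_mul (by positivity)]
                congr 1
                field_simp
        · rw [indicator_of_notMem hw]
          have : ∀ z, E.indicator φ (z, w) = 0 := fun z =>
            indicator_of_notMem (fun h => hw (key z h).2.2.2) _
          simp [this]
    _ = _ := by rw [lintegral_indicator (measurableSet_cone β ξ), setLIntegral_const]

lemma setLIntegral_ball_inter_le_tentMeasure {p : ℝ} (f : ℂ → ℂ) {E : Set ℂ} (hE : E ⊆ unitDisc)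
    {η : ℝ} (hη : η < 1) {z : ℂ} (hz : ‖z‖ < 1) :
    ∫⁻ w in Metric.ball z (η * (1 - ‖z‖)) ∩ E, ‖f w‖ₑ ^ p
      ≤ ENNReal.ofReal Real.pi * ENNReal.ofReal (2 * (1 - ‖z‖)) *
        tentMeasure p E f (Metric.ball z (η * (1 - ‖z‖))) := by
  have hm : MeasurableSet (Metric.ball z (η * (1 - ‖z‖))) := Metric.isOpen_ball.measurableSet
  rw [tentMeasure, withDensity_apply _ hm, Measure.restrict_restrict hm,
    setLIntegral_area_of_subset (inter_subset_right.trans hE), mul_right_comm,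
    ENNReal.mul_inv_cancel_left' (by simp [Real.pi_pos]) (by simp),
    mul_comm _ (ENNReal.ofReal (2 * (1 - ‖z‖))), ← lintegral_const_mul' _ _ ENNReal.ofReal_ne_top]
  refine lintegral_mono_ae ?_
  filter_upwards [ae_restrict_of_ae_restrict_of_subset inter_subset_left (ae_restrict_mem hm)]
    with w hw
  have hw1 := mem_unitDisc.1 (ball_subset_unitDisc hη hz hw)
  have hw2 : 1 - ‖w‖ ≤ 2 * (1 - ‖z‖) := by
    rw [Metric.mem_ball, dist_eq_norm, norm_sub_rev] at hw
    have h2 : ‖z‖ ≤ ‖z - w‖ + ‖w‖ := by simpa using norm_add_le (z - w) w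
    nlinarith
  have h0 : ENNReal.ofReal (1 - ‖w‖) ≠ 0 := by simpa using hw1
  calc ‖f w‖ₑ ^ p = ENNReal.ofReal (1 - ‖w‖) * (‖f w‖ₑ ^ p / ENNReal.ofReal (1 - ‖w‖)) :=
        (ENNReal.mul_div_cancel h0 ENNReal.ofReal_ne_top).symm
    _ ≤ _ := by gcongr

/-! ### Density implies domination -/

lemma add_rpow_le_two_rpow_mul {s : ℝ} (hs : 0 ≤ s) (x y : ℝ≥0∞) :
    (x + y) ^ s ≤ 2 ^ s * (x ^ s + y ^ s) := by
  rcases le_total x y with h | h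
  · calc (x + y) ^ s ≤ (2 * y) ^ s := by rw [two_mul]; gcongr
      _ = 2 ^ s * y ^ s := ENNReal.mul_rpow_of_nonneg _ _ hs
      _ ≤ _ := by gcongr; exact le_add_self
  · calc (x + y) ^ s ≤ (2 * x) ^ s := by rw [two_mul]; gcongr
      _ = 2 ^ s * x ^ s := ENNReal.mul_rpow_of_nonneg _ _ hs
      _ ≤ _ := by gcongr; exact le_self_add

lemma exists_mul_rpow_le {q : ℝ} (hq : 0 < q) {c : ℝ≥0∞} (hc : c ≠ ∞) :
    ∃ K : ℝ, 0 < K ∧ ∀ X Y : ℝ≥0∞, X ≤ c * Y → ENNReal.ofReal K * X ^ (1 / q) ≤ Y ^ (1 / q) := by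
  have hc1 : c + 1 ≠ ∞ := ENNReal.add_ne_top.2 ⟨hc, ENNReal.one_ne_top⟩
  set d := (c + 1) ^ (1 / q) with hd
  have hd0 : d ≠ 0 := (ENNReal.rpow_pos (by simp) hc1).ne'
  have hdtop : d ≠ ∞ := ENNReal.rpow_ne_top_of_nonneg (by positivity) hc1
  refine ⟨d⁻¹.toReal, ENNReal.toReal_pos (by simpa) (by simpa), fun X Y h => ?_⟩
  rw [ENNReal.ofReal_toReal (by simpa)]
  calc d⁻¹ * X ^ (1 / q) ≤ d⁻¹ * ((c + 1) * Y) ^ (1 / q) := by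
        gcongr
        exact h.trans (by gcongr; exact le_self_add)
    _ = Y ^ (1 / q) := by
        rw [ENNReal.mul_rpow_of_nonneg _ _ (by positivity), ← hd,
          ← mul_assoc, ENNReal.inv_mul_cancel hd0 hdtop, one_mul]

/-- The one-point bound is used at every z of the narrow cone and integrated. The order of
quantifiers matters: β comes before ε, because ε will be chosen against the aperture constant of β.
-/
lemma tentMeasure_cone_half_le {p : ℝ} (hp : 0 < p) {η δ : ℝ} (hη0 : 0 < η) (hη : η < 1)
    (hδ0 : 0 < δ) {G : Set ℂ} (hG : G ⊆ unitDisc) (hGm : NullMeasurableSet G volume)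
    (H : ∀ α ∈ unitDisc, ENNReal.ofReal δ * area (euclDisc η α) ≤ area (G ∩ euclDisc η α)) :
    ∃ β : ℝ, 0 < β ∧ β < 1 ∧ ∀ ε : ℝ, 0 < ε → ∃ C : ℝ≥0∞, C ≠ ∞ ∧ ∀ f : ℂ → ℂ,
      DifferentiableOn ℂ f unitDisc → ∀ ξ : ℂ, ‖ξ‖ = 1 →
        tentMeasure p unitDisc f (cone (1 / 2) ξ) ≤ ENNReal.ofReal ε * tentMeasure p unitDisc f (cone β ξ)
          + C * tentMeasure p G f (cone β ξ) := by
  obtain ⟨β, hβ0, hβ, hcone⟩ := exists_setLIntegral_cone_le hη0 hη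
  refine ⟨β, hβ0, hβ, fun ε hε => ?_⟩
  have h1η : 0 < 1 - η := by linarith
  -- Here a is the weight factor 2(1 - |z|) against the squared radius η²(1 - |z|)², and b is the
  -- overlap constant; together they multiply the ε of the one-point bound by ab.
  set a : ℝ := 2 / η ^ 2 with ha
  set b : ℝ := 4 * (η / (1 - η)) ^ 2 with hb
  have ha0 : 0 < a := by positivity
  have hb0 : 0 < b := by positivity
  obtain ⟨C, hC, hmean⟩ := exists_volume_ball_mul_enorm_rpow_le hp (lt_min hδ0 one_pos)
    (min_le_right δ 1) (ε := ε / (a * b)) (by positivity)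
  refine ⟨C * ENNReal.ofReal a * ENNReal.ofReal b, by finiteness, fun f hf ξ hξ => ?_⟩
  set ν := tentMeasure p unitDisc f with hν
  set γ := tentMeasure p G f with hγ
  set e := ENNReal.ofReal (ε / (a * b)) with he
  have hpt : ∀ z ∈ cone (1 / 2) ξ, ‖f z‖ₑ ^ p / ENNReal.ofReal (1 - ‖z‖) ≤
      ENNReal.ofReal a * (e * (ν (Metric.ball z (η * (1 - ‖z‖))) / ENNReal.ofReal ((1 - ‖z‖) ^ 2))
        + C * (γ (Metric.ball z (η * (1 - ‖z‖))) / ENNReal.ofReal ((1 - ‖z‖) ^ 2))) := by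
    intro z hz
    have hz1 := norm_lt_one_of_mem_cone (by norm_num) hξ hz
    have hh : 0 < 1 - ‖z‖ := by linarith
    have hsub := ball_subset_unitDisc hη hz1
    have hdens : ENNReal.ofReal (min δ 1) * volume (Metric.ball z (η * (1 - ‖z‖)))
        ≤ volume (G ∩ Metric.ball z (η * (1 - ‖z‖))) := by
      have h1 := H z (mem_unitDisc.2 hz1)
      rw [euclDisc_eq_ball hη hz1, area_apply_of_subset hsub,
        area_apply_of_subset (inter_subset_right.trans hsub), mul_left_comm] at h1
      refine le_trans (by gcongr; exact min_le_left _ _)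
        ((ENNReal.mul_le_mul_iff_right (ENNReal.inv_ne_zero.2 ENNReal.ofReal_ne_top)
          (ENNReal.inv_ne_top.2 (by simp [Real.pi_pos]))).1 h1)
    have h2 := hmean f z _ G (mul_pos hη0 hh) (hf.mono hsub) hGm hdens
    have h3 := setLIntegral_ball_inter_le_tentMeasure (p := p) f subset_rfl hη hz1
    rw [inter_eq_left.2 hsub] at h3
    have h4 := setLIntegral_ball_inter_le_tentMeasure (p := p) f hG hη hz1
    have h5 := h2.trans (add_le_add (mul_le_mul_right h3 _) (mul_le_mul_right h4 _))
    rw [volume_ball_eq _ (by positivity), mul_assoc] at h5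
    set N := ν (Metric.ball z (η * (1 - ‖z‖)))
    set N' := γ (Metric.ball z (η * (1 - ‖z‖)))
    have h6 : ENNReal.ofReal Real.pi * (ENNReal.ofReal ((η * (1 - ‖z‖)) ^ 2) * ‖f z‖ₑ ^ p)
        ≤ ENNReal.ofReal Real.pi * (ENNReal.ofReal (2 * (1 - ‖z‖)) * (e * N + C * N')) := by
      refine h5.trans_eq ?_
      ring
    have h7 := (ENNReal.mul_le_mul_iff_right (by simp [Real.pi_pos]) ENNReal.ofReal_ne_top).1 h6
    rw [ENNReal.div_le_iff (by simpa using hz1) ENNReal.ofReal_ne_top]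
    refine (ENNReal.mul_le_mul_iff_right (a := ENNReal.ofReal ((η * (1 - ‖z‖)) ^ 2))
      (by rw [ne_eq, ENNReal.ofReal_eq_zero, not_le]; positivity) ENNReal.ofReal_ne_top).1 ?_
    refine h7.trans_eq ?_
    have h8 : ENNReal.ofReal (2 * (1 - ‖z‖)) = ENNReal.ofReal ((η * (1 - ‖z‖)) ^ 2)
        * ENNReal.ofReal a * (ENNReal.ofReal ((1 - ‖z‖) ^ 2))⁻¹ * ENNReal.ofReal (1 - ‖z‖) := by
      rw [← ENNReal.ofReal_inv_of_pos (by positivity), ← ENNReal.ofReal_mul (by positivity),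
        ← ENNReal.ofReal_mul (by positivity), ← ENNReal.ofReal_mul (by positivity)]
      congr 1
      rw [ha]; field_simp
    rw [h8, div_eq_mul_inv, div_eq_mul_inv]
    ring
  have hfin : ∀ ρ : Measure ℂ, SFinite ρ →
      Measurable fun z => ρ (Metric.ball z (η * (1 - ‖z‖))) / ENNReal.ofReal ((1 - ‖z‖) ^ 2) := by
    intro ρ _
    refine Measurable.div ?_ (by fun_prop)
    have : MeasurableSet {x : ℂ × ℂ | ‖x.2 - x.1‖ < η * (1 - ‖x.1‖)} :=
      measurableSet_lt (by fun_prop) (by fun_prop)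
    convert measurable_measure_prodMk_left (ν := ρ) this using 1
    ext z
    congr 1
    ext w
    simp [dist_eq_norm]
  rw [hν, tentMeasure_cone]
  calc ∫⁻ z in cone (1 / 2) ξ ∩ unitDisc, ‖f z‖ₑ ^ p / ENNReal.ofReal (1 - ‖z‖) ∂area
      ≤ ∫⁻ z in cone (1 / 2) ξ, ‖f z‖ₑ ^ p / ENNReal.ofReal (1 - ‖z‖) ∂area :=
        lintegral_mono_set inter_subset_left
    _ ≤ _ := setLIntegral_mono' (measurableSet_cone _ ξ) hpt
    _ = ENNReal.ofReal a * (e * (∫⁻ z in cone (1 / 2) ξ,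
            ν (Metric.ball z (η * (1 - ‖z‖))) / ENNReal.ofReal ((1 - ‖z‖) ^ 2) ∂area)
          + C * ∫⁻ z in cone (1 / 2) ξ,
            γ (Metric.ball z (η * (1 - ‖z‖))) / ENNReal.ofReal ((1 - ‖z‖) ^ 2) ∂area) := by
        rw [lintegral_const_mul' _ _ ENNReal.ofReal_ne_top, lintegral_add_left
          ((hfin ν inferInstance).const_mul _), lintegral_const_mul' _ _ ENNReal.ofReal_ne_top,
          lintegral_const_mul' _ _ hC]
    _ ≤ ENNReal.ofReal a * (e * (ENNReal.ofReal b * ν (cone β ξ))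
          + C * (ENNReal.ofReal b * γ (cone β ξ))) := by
        gcongr
        · exact hcone ν inferInstance ξ hξ
        · exact hcone γ inferInstance ξ hξ
    _ = _ := by
        have : ENNReal.ofReal ε = ENNReal.ofReal a * e * ENNReal.ofReal b := by
          rw [he, ← ENNReal.ofReal_mul (by positivity), ← ENNReal.ofReal_mul (by positivity)]
          congr 1; field_simp
        rw [this]; ring

/-- Sets of positive density in the Euclidean discs are dominating for the analytic tent spaces. -/
theorem exists_le_tentFunctional_of_density {p q : ℝ} (hp : 0 < p) (hq : 0 < q) {η δ : ℝ}
    (hη0 : 0 < η) (hη : η < 1)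
    (hδ0 : 0 < δ) {G : Set ℂ} (hG : G ⊆ unitDisc) (hGm : NullMeasurableSet G volume)
    (H : ∀ α ∈ unitDisc, ENNReal.ofReal δ * area (euclDisc η α) ≤ area (G ∩ euclDisc η α)) :
    ∃ β : ℝ, 0 < β ∧ β < 1 ∧ ∃ K : ℝ, 0 < K ∧ ∀ f ∈ analyticTentSpace p q,
      ENNReal.ofReal K * tentNorm p q f ≤ tentFunctional β p q G f := by
  obtain ⟨β, hβ0, hβ, hpt⟩ := tentMeasure_cone_half_le hp hη0 hη hδ0 hG hGm H
  set s := q / p with hs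
  have hs0 : 0 < s := by positivity
  obtain ⟨A, hA, hap⟩ := lintegral_cone_rpow_le hβ hs0
  set a : ℝ := A.toReal + 1 with ha
  have ha0 : 0 < a := by positivity
  -- Solves 2^s ε^s a = 1/2, where a exceeds the aperture constant A.
  set ε : ℝ := (1 / (2 * 2 ^ s * a)) ^ (1 / s) with hε
  obtain ⟨C, hC, hf⟩ := hpt ε (by positivity)
  have hsmall : 2 ^ s * (ENNReal.ofReal ε ^ s * A) ≤ 2⁻¹ := by
    have hAa : A ≤ ENNReal.ofReal a := by
      rw [ha, ENNReal.ofReal_add (by positivity) zero_le_one, ENNReal.ofReal_toReal hA]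
      exact le_self_add
    have hεs : ε ^ s = 1 / (2 * 2 ^ s * a) := by
      rw [hε, ← Real.rpow_mul (by positivity), one_div_mul_cancel hs0.ne', Real.rpow_one]
    calc 2 ^ s * (ENNReal.ofReal ε ^ s * A) ≤ 2 ^ s * (ENNReal.ofReal ε ^ s * ENNReal.ofReal a) := by
          gcongr
      _ = ENNReal.ofReal (2 ^ s * (ε ^ s * a)) := by
          rw [ENNReal.ofReal_mul (by positivity), ENNReal.ofReal_mul (by positivity),
            ← ENNReal.ofReal_rpow_of_pos two_pos,
            ← ENNReal.ofReal_rpow_of_pos (x := ε) (by positivity),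
            ENNReal.ofReal_ofNat]
      _ = ENNReal.ofReal (2⁻¹) := by
          congr 1; rw [hεs]; field_simp
      _ = 2⁻¹ := by rw [ENNReal.ofReal_inv_of_pos two_pos, ENNReal.ofReal_ofNat]
      _ ≤ _ := le_rfl
  obtain ⟨K, hK0, hK⟩ := exists_mul_rpow_le hq (c := 2 * (2 ^ s * C ^ s))
    (ENNReal.mul_ne_top (by simp) (ENNReal.mul_ne_top
      (ENNReal.rpow_ne_top_of_nonneg hs0.le (by simp)) (ENNReal.rpow_ne_top_of_nonneg hs0.le hC)))
  refine ⟨β, hβ0, hβ, K, hK0, fun f ⟨hfd, _, hfin⟩ => ?_⟩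
  rw [tentNorm, tentFunctional_eq] at hfin ⊢
  rw [tentFunctional_eq]
  apply hK
  set X := ∫⁻ ξ, tentMeasure p unitDisc f (cone (1 / 2) ξ) ^ (q / p) ∂arcLength with hX
  set Y := ∫⁻ ξ, tentMeasure p G f (cone β ξ) ^ (q / p) ∂arcLength with hY
  have hXtop : X ≠ ∞ := by
    intro h
    rw [h, ENNReal.top_rpow_of_pos (by positivity)] at hfin
    exact hfin.ne rfl
  -- The term with ε lives on wide cones; change of aperture turns it into half of X, and finiteness
  -- of X allows it to be subtracted.
  have h1 : X ≤ 2⁻¹ * X + 2 ^ s * C ^ s * Y := by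
    calc X ≤ ∫⁻ ξ, 2 ^ s * (ENNReal.ofReal ε ^ s * tentMeasure p unitDisc f (cone β ξ) ^ s
            + C ^ s * tentMeasure p G f (cone β ξ) ^ s) ∂arcLength := by
          refine lintegral_mono_ae ?_
          filter_upwards [ae_arcLength_norm] with ξ hξ
          refine (ENNReal.rpow_le_rpow (hf f hfd ξ hξ) hs0.le).trans
            ((add_rpow_le_two_rpow_mul hs0.le _ _).trans_eq ?_)
          rw [ENNReal.mul_rpow_of_nonneg _ _ hs0.le, ENNReal.mul_rpow_of_nonneg _ _ hs0.le]
      _ = 2 ^ s * (ENNReal.ofReal ε ^ s * (∫⁻ ξ, tentMeasure p unitDisc f (cone β ξ) ^ s ∂arcLength)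
            + C ^ s * Y) := by
          rw [lintegral_const_mul' _ _ (ENNReal.rpow_ne_top_of_nonneg hs0.le (by simp)),
            lintegral_add_left (((measurable_measure_cone β _).pow_const _).const_mul _),
            lintegral_const_mul' _ _ (ENNReal.rpow_ne_top_of_nonneg hs0.le ENNReal.ofReal_ne_top),
            lintegral_const_mul' _ _ (ENNReal.rpow_ne_top_of_nonneg hs0.le hC)]
      _ ≤ 2 ^ s * (ENNReal.ofReal ε ^ s * (A * X) + C ^ s * Y) := by
          gcongr
          exact hap _ inferInstance
      _ = 2 ^ s * (ENNReal.ofReal ε ^ s * A) * X + 2 ^ s * C ^ s * Y := by ring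
      _ ≤ _ := by gcongr
  have h2 : 2⁻¹ * X + 2⁻¹ * X ≤ 2⁻¹ * X + 2 ^ s * C ^ s * Y := by
    rwa [← add_mul, ENNReal.inv_two_add_inv_two, one_mul]
  have h3 := (ENNReal.add_le_add_iff_left (ENNReal.mul_ne_top (by simp) hXtop)).1 h2
  calc X = 2 * (2⁻¹ * X) := by
        rw [← mul_assoc, ENNReal.mul_inv_cancel two_ne_zero ENNReal.ofNat_ne_top, one_mul]
    _ ≤ 2 * (2 ^ s * C ^ s * Y) := by gcongr
    _ = _ := by ring

/-! ### Pseudohyperbolic and Euclidean discs -/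

lemma one_sub_le_norm_one_sub_conj_mul (a : ℂ) {z : ℂ} (hz : ‖z‖ ≤ 1) :
    1 - ‖a‖ ≤ ‖1 - conj a * z‖ := by
  have := norm_sub_norm_le 1 (conj a * z)
  rw [norm_one, norm_mul, RCLike.norm_conj] at this
  nlinarith [norm_nonneg a]

lemma one_sub_le_norm_one_sub_conj_mul' {a : ℂ} (ha : ‖a‖ ≤ 1) (z : ℂ) :
    1 - ‖z‖ ≤ ‖1 - conj a * z‖ := by
  have := norm_sub_norm_le 1 (conj a * z)
  rw [norm_one, norm_mul, RCLike.norm_conj] at this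
  nlinarith [norm_nonneg z]

/-- Equivalent, for a and z in the disc, to 1 - ρ² = (1 - |a|²)(1 - |z|²)/|1 - conj a z|² for the
pseudohyperbolic distance ρ. -/
lemma norm_one_sub_conj_mul_sq (a z : ℂ) :
    ‖1 - conj a * z‖ ^ 2 = ‖a - z‖ ^ 2 + (1 - ‖a‖ ^ 2) * (1 - ‖z‖ ^ 2) := by
  simp only [Complex.sq_norm, Complex.normSq_apply, Complex.sub_re, Complex.sub_im, Complex.mul_re,
    Complex.mul_im, Complex.conj_re, Complex.conj_im, Complex.one_re, Complex.one_im]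
  ring

lemma mem_pseudoDisc_iff {a z : ℂ} {η : ℝ} (ha : ‖a‖ < 1) (hη0 : 0 < η) (hz : ‖z‖ < 1) :
    z ∈ pseudoDisc a η ↔ ‖a - z‖ ^ 2 < η ^ 2 * ‖1 - conj a * z‖ ^ 2 := by
  have h0 : 0 < ‖1 - conj a * z‖ :=
    lt_of_lt_of_le (by linarith) (one_sub_le_norm_one_sub_conj_mul a hz.le)
  simp only [pseudoDisc, mem_ofPred_eq, mem_unitDisc, hz, true_and]
  rw [norm_div, div_lt_iff₀ h0, ← mul_pow, pow_lt_pow_iff_left₀ (norm_nonneg _) (by positivity)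
    two_ne_zero]

/-- Completing the square: |a - z|² - η²|1 - conj a z|² equals D(|z - ka|² - R²). -/
lemma pseudoDisc_eq_ball {a : ℂ} {η : ℝ} (ha : ‖a‖ < 1) (hη0 : 0 < η) (hη : η < 1) :
    pseudoDisc a η = Metric.ball (((1 - η ^ 2) / (1 - η ^ 2 * ‖a‖ ^ 2) : ℝ) * a)
      (η * (1 - ‖a‖ ^ 2) / (1 - η ^ 2 * ‖a‖ ^ 2)) := by
  have hη2 : η ^ 2 < 1 := by nlinarith
  have hA : ‖a‖ ^ 2 < 1 := by nlinarith [norm_nonneg a]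
  have hA0 : 0 ≤ ‖a‖ ^ 2 := by positivity
  set D := 1 - η ^ 2 * ‖a‖ ^ 2 with hD
  have hD0 : 0 < D := by nlinarith
  set k : ℝ := (1 - η ^ 2) / D with hk
  have hk0 : 0 < k := div_pos (by linarith) hD0
  have hkD : k * D = 1 - η ^ 2 := by rw [hk]; field_simp
  set R := η * (1 - ‖a‖ ^ 2) / D with hR
  have hR0 : 0 < R := div_pos (mul_pos hη0 (by linarith)) hD0
  have hRD : R * D = η * (1 - ‖a‖ ^ 2) := by rw [hR]; field_simp
  have key : ∀ z : ℂ, D * (‖z - k * a‖ ^ 2 - R ^ 2) = ‖a - z‖ ^ 2 - η ^ 2 * ‖1 - conj a * z‖ ^ 2 := by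
    intro z
    have h1 : ‖z - k * a‖ ^ 2 = ‖z‖ ^ 2 - 2 * k * inner ℝ a z + k ^ 2 * ‖a‖ ^ 2 := by
      rw [← Complex.real_smul, norm_sub_sq_real, inner_smul_right, real_inner_comm, norm_smul,
        Real.norm_of_nonneg hk0.le]; ring
    have h2 : ‖a - z‖ ^ 2 = ‖a‖ ^ 2 - 2 * inner ℝ a z + ‖z‖ ^ 2 := norm_sub_sq_real a z
    rw [norm_one_sub_conj_mul_sq, h1, h2]
    refine mul_left_cancel₀ hD0.ne' ?_
    have e : D * (D * (‖z‖ ^ 2 - 2 * k * inner ℝ a z + k ^ 2 * ‖a‖ ^ 2 - R ^ 2))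
        = D ^ 2 * ‖z‖ ^ 2 - 2 * (k * D) * D * inner ℝ a z + (k * D) ^ 2 * ‖a‖ ^ 2 - (R * D) ^ 2 := by
      ring
    rw [e, hkD, hRD, hD]
    ring
  -- After multiplication by D the gap is (1 - |a|)(1 - η)(1 - η|a|).
  have hsub : ‖(k : ℂ) * a‖ + R < 1 := by
    rw [norm_mul, Complex.norm_real, Real.norm_of_nonneg hk0.le]
    refine lt_of_mul_lt_mul_right ?_ hD0.le
    have e : (k * ‖a‖ + R) * D = (k * D) * ‖a‖ + R * D := by ring
    rw [e, hkD, hRD, hD]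
    have h1 : 0 < 1 - η * ‖a‖ := by nlinarith
    have h2 := mul_pos (mul_pos (sub_pos.2 ha) (sub_pos.2 hη)) h1
    linarith
  ext z
  constructor
  · intro hz
    have h1 := (mem_pseudoDisc_iff ha hη0 (mem_unitDisc.1 hz.1)).1 hz
    rw [Metric.mem_ball, dist_eq_norm]
    refine lt_of_pow_lt_pow_left₀ 2 hR0.le ?_
    have := key z
    by_contra! hh
    nlinarith [mul_nonneg hD0.le (sub_nonneg.2 hh)]
  · intro hz
    rw [Metric.mem_ball, dist_eq_norm] at hz
    have hz1 : ‖z‖ < 1 := by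
      have : ‖z‖ ≤ ‖z - k * a‖ + ‖(k : ℂ) * a‖ := by simpa using norm_add_le (z - k * a) (k * a)
      linarith
    refine (mem_pseudoDisc_iff ha hη0 hz1).2 ?_
    have h2 : ‖z - k * a‖ ^ 2 < R ^ 2 := pow_lt_pow_left₀ hz (norm_nonneg _) two_ne_zero
    have := key z
    nlinarith [mul_pos hD0 (sub_pos.2 h2)]

lemma measurableSet_pseudoDisc {a : ℂ} {η : ℝ} (ha : ‖a‖ < 1) (hη0 : 0 < η) (hη : η < 1) :
    MeasurableSet (pseudoDisc a η) := by
  rw [pseudoDisc_eq_ball ha hη0 hη]; exact Metric.isOpen_ball.measurableSet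

lemma area_pseudoDisc_le {a : ℂ} {η : ℝ} (ha : ‖a‖ < 1) (hη0 : 0 < η) (hη : η < 1) :
    area (pseudoDisc a η) ≤ ENNReal.ofReal ((2 / (1 - η ^ 2)) ^ 2 * (1 - ‖a‖) ^ 2) := by
  have hη2 : η ^ 2 < 1 := by nlinarith
  have hA : ‖a‖ ^ 2 < 1 := by nlinarith [norm_nonneg a]
  have hD0 : 0 < 1 - η ^ 2 * ‖a‖ ^ 2 := by nlinarith [sq_nonneg ‖a‖]
  have hR0 : 0 < η * (1 - ‖a‖ ^ 2) / (1 - η ^ 2 * ‖a‖ ^ 2) :=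
    div_pos (mul_pos hη0 (by linarith)) hD0
  rw [pseudoDisc_eq_ball ha hη0 hη]
  refine (area_ball_le _ hR0.le).trans (ENNReal.ofReal_le_ofReal ?_)
  rw [← mul_pow (2 / (1 - η ^ 2))]
  refine pow_le_pow_left₀ hR0.le ?_ 2
  rw [div_mul_eq_mul_div]
  have h1 : 0 < 1 - η ^ 2 := by linarith
  have h2 : 0 < 1 - ‖a‖ := by linarith
  refine div_le_div₀ (by positivity) ?_ h1 ?_
  · calc η * (1 - ‖a‖ ^ 2) ≤ 1 * (1 - ‖a‖ ^ 2) := by gcongr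
      _ ≤ _ := by nlinarith [norm_nonneg a]
  · nlinarith [sq_nonneg η]

lemma euclDisc_subset_pseudoDisc {η : ℝ} {α : ℂ} (hα : ‖α‖ < 1) :
    euclDisc η α ⊆ pseudoDisc α η := by
  rintro z ⟨hz, h⟩
  refine ⟨hz, ?_⟩
  have h0 := one_sub_le_norm_one_sub_conj_mul α (mem_unitDisc.1 hz).le
  have h1 : 0 < 1 - ‖α‖ := by linarith
  rw [norm_div, div_lt_iff₀ (by linarith), norm_sub_rev]
  have hη : 0 < η := by
    by_contra! hh
    nlinarith [norm_nonneg (z - α)]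
  nlinarith

/-- Every Euclidean disc `Δ_{η'}(α)`, `η' = 2 η / (1 + η²)`, contains a pseudohyperbolic disc of
radius `η` whose Euclidean centre is `α`. -/
lemma exists_pseudoDisc_eq_ball {η : ℝ} (hη0 : 0 < η) (hη : η < 1) {α : ℂ} (hα : ‖α‖ < 1) :
    ∃ a : ℂ, ‖a‖ < 1 ∧ ∃ R : ℝ, η * (1 - ‖α‖) ≤ R ∧ R ≤ 2 * η / (1 + η ^ 2) * (1 - ‖α‖) ∧
      pseudoDisc a η = Metric.ball α R := by
  have hη2 : η ^ 2 < 1 := by nlinarith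
  have hpos : ∀ t ∈ Icc (0 : ℝ) 1, 0 < 1 - η ^ 2 * t ^ 2 := by
    intro t ht
    have : t ^ 2 ≤ 1 := by nlinarith [ht.1, ht.2]
    nlinarith [sq_nonneg t]
  -- The modulus of the Euclidean centre of the pseudohyperbolic disc about tζ goes continuously
  -- from 0 to 1, hence takes the value |α|.
  have hcont : ContinuousOn (fun t : ℝ => (1 - η ^ 2) * t / (1 - η ^ 2 * t ^ 2)) (Icc 0 1) :=
    ContinuousOn.div (by fun_prop) (by fun_prop) fun t ht => (hpos t ht).ne'
  have h1η : 1 - η ^ 2 ≠ 0 := by linarith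
  obtain ⟨t, ht, hte⟩ := intermediate_value_Icc zero_le_one hcont
    (show ‖α‖ ∈ Icc _ _ by simp [h1η, hα.le])
  simp only at hte
  have hD := hpos t ht
  have ht1 : t < 1 := by
    refine lt_of_le_of_ne ht.2 ?_
    rintro rfl
    simp [h1η] at hte
    linarith
  obtain ⟨ζ, hζ, hαζ⟩ := exists_radial α
  have hat : ‖(t : ℂ) * ζ‖ = t := by
    rw [norm_mul, hζ, Complex.norm_real, Real.norm_of_nonneg ht.1, mul_one]
  rw [div_eq_iff hD.ne'] at hte
  refine ⟨t * ζ, by rwa [hat], η * (1 - t ^ 2) / (1 - η ^ 2 * t ^ 2), ?_, ?_, ?_⟩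
  · rw [le_div_iff₀ hD, mul_assoc]
    gcongr
    nlinarith [mul_nonneg (mul_nonneg ht.1 (sub_nonneg.2 ht1.le)) (sub_nonneg.2 hη2.le)]
  -- With denominators cleared, the two sides differ by η(1 - t)²(1 - η²).
  · rw [div_le_iff₀ hD, div_mul_eq_mul_div, div_mul_eq_mul_div, le_div_iff₀ (by positivity)]
    have e : 2 * η * (1 - ‖α‖) * (1 - η ^ 2 * t ^ 2)
        = 2 * η * (1 - η ^ 2 * t ^ 2 - (1 - η ^ 2) * t) := by rw [hte]; ring
    rw [e]
    nlinarith [mul_nonneg hη0.le (mul_nonneg (mul_nonneg (sub_nonneg.2 ht1.le) (sub_nonneg.2 ht1.le))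
      (sub_nonneg.2 hη2.le))]
  · rw [pseudoDisc_eq_ball (by rwa [hat]) hη0 hη, hat]
    congr 1
    have e : (1 - η ^ 2) / (1 - η ^ 2 * t ^ 2) * t = ‖α‖ := by
      rw [div_mul_eq_mul_div, hte]; field_simp
    rw [← mul_assoc, ← Complex.ofReal_mul, e, ← hαζ]

/-- A pseudohyperbolic disc with Euclidean centre α fits into the disc of parameter η' = 2η/(1 + η²)
< 1 and fills at least the proportion (η/η')² of its area. -/
theorem euclDisc_density_of_pseudoDisc_density {G : Set ℂ} {η δ : ℝ} (hη0 : 0 < η) (hη : η < 1)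
    (hδ : 0 < δ) (H : ∀ α ∈ unitDisc,
      ENNReal.ofReal δ * area (pseudoDisc α η) ≤ area (G ∩ pseudoDisc α η)) :
    ∃ η : ℝ, 0 < η ∧ η < 1 ∧ ∃ δ : ℝ, 0 < δ ∧ ∀ α ∈ unitDisc,
      ENNReal.ofReal δ * area (euclDisc η α) ≤ area (G ∩ euclDisc η α) := by
  set η' := 2 * η / (1 + η ^ 2) with hη'
  have hη'0 : 0 < η' := by positivity
  have hη'1 : η' < 1 := by rw [hη', div_lt_one (by positivity)]; nlinarith [sq_pos_of_pos (sub_pos.2 hη)]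
  refine ⟨η', hη'0, hη'1, δ * (η / η') ^ 2, by positivity, fun α hα => ?_⟩
  rw [mem_unitDisc] at hα
  have hh : 0 < 1 - ‖α‖ := by linarith
  obtain ⟨a, ha, R, hR1, hR2, he⟩ := exists_pseudoDisc_eq_ball hη0 hη hα
  have hsub := ball_subset_unitDisc hη'1 hα
  have hbb : Metric.ball α R ⊆ Metric.ball α (η' * (1 - ‖α‖)) := Metric.ball_subset_ball hR2
  have h1 := H a (mem_unitDisc.2 ha)
  have hR0 : 0 ≤ R := le_trans (by positivity) hR1
  rw [he, area_ball_eq hR0 (hbb.trans hsub)] at h1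
  rw [euclDisc_eq_ball hη'1 hα, area_ball_eq (by positivity) hsub]
  calc ENNReal.ofReal (δ * (η / η') ^ 2) * ENNReal.ofReal ((η' * (1 - ‖α‖)) ^ 2)
      = ENNReal.ofReal δ * ENNReal.ofReal ((η * (1 - ‖α‖)) ^ 2) := by
        rw [← ENNReal.ofReal_mul (by positivity), ← ENNReal.ofReal_mul (by positivity)]
        congr 1
        field_simp
    _ ≤ ENNReal.ofReal δ * ENNReal.ofReal (R ^ 2) := by gcongr
    _ ≤ _ := h1.trans (measure_mono (inter_subset_inter_right _ hbb))

theorem pseudoDisc_density_of_euclDisc_density {G : Set ℂ} {η δ : ℝ} (hη0 : 0 < η) (hη : η < 1)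
    (hδ : 0 < δ) (H : ∀ α ∈ unitDisc,
      ENNReal.ofReal δ * area (euclDisc η α) ≤ area (G ∩ euclDisc η α)) :
    ∃ η : ℝ, 0 < η ∧ η < 1 ∧ ∃ δ : ℝ, 0 < δ ∧ ∀ α ∈ unitDisc,
      ENNReal.ofReal δ * area (pseudoDisc α η) ≤ area (G ∩ pseudoDisc α η) := by
  have h1η : 0 < 1 - η ^ 2 := by nlinarith
  refine ⟨η, hη0, hη, δ * (η * (1 - η ^ 2) / 2) ^ 2, by positivity, fun α hα => ?_⟩
  have hα' := mem_unitDisc.1 hα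
  have hh : 0 < 1 - ‖α‖ := by linarith
  calc ENNReal.ofReal (δ * (η * (1 - η ^ 2) / 2) ^ 2) * area (pseudoDisc α η)
      ≤ ENNReal.ofReal (δ * (η * (1 - η ^ 2) / 2) ^ 2) *
          ENNReal.ofReal ((2 / (1 - η ^ 2)) ^ 2 * (1 - ‖α‖) ^ 2) := by
        gcongr; exact area_pseudoDisc_le hα' hη0 hη
    _ = ENNReal.ofReal δ * area (euclDisc η α) := by
        rw [euclDisc_eq_ball hη hα', area_ball_eq (by positivity) (ball_subset_unitDisc hη hα'),
          ← ENNReal.ofReal_mul (by positivity), ← ENNReal.ofReal_mul (by positivity)]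
        congr 1
        field_simp
    _ ≤ area (G ∩ euclDisc η α) := H α hα
    _ ≤ _ := by gcongr; exact euclDisc_subset_pseudoDisc hα'

/-! ### Estimates for the test functions -/

lemma norm_sub_eq_norm_one_sub_conj_mul (α : ℂ) {ξ : ℂ} (hξ : ‖ξ‖ = 1) :
    ‖ξ - α‖ = ‖1 - conj α * ξ‖ := by
  have := norm_one_sub_conj_mul_sq α ξ
  rw [hξ] at this
  rw [← sq_eq_sq₀ (norm_nonneg _) (norm_nonneg _), this, norm_sub_rev]
  ring

lemma one_sub_norm_le_norm_sub {α ξ : ℂ} (hξ : ‖ξ‖ = 1) : 1 - ‖α‖ ≤ ‖ξ - α‖ := by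
  simpa [hξ] using norm_sub_norm_le ξ α

lemma integral_poisson {α : ℂ} (hα : ‖α‖ < 1) :
    ∫ θ in (0 : ℝ)..2 * Real.pi, (1 - ‖α‖ ^ 2) / ‖Complex.exp (θ * Complex.I) - α‖ ^ 2
      = 2 * Real.pi := by
  have h := DiffContOnCl.circleAverage_poissonKernel_smul' (f := fun _ => (1 : ℂ)) (c := 0) (R := 1)
    (w := α) diffContOnCl_const (by simpa using hα)
  rw [Real.circleAverage, intervalIntegral.integral_smul_const] at h
  simp only [circleMap, Complex.ofReal_one, one_mul, zero_add, sub_zero,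
    Complex.norm_exp_ofReal_mul_I, one_pow, Complex.real_smul, mul_one] at h
  have hp := Real.pi_pos
  norm_cast at h
  rwa [inv_mul_eq_one₀ (by positivity), eq_comm] at h

lemma lintegral_norm_sub_rpow_neg_two_le {α : ℂ} (hα : ‖α‖ < 1) :
    ∫⁻ ξ, ENNReal.ofReal (‖ξ - α‖ ^ (-2 : ℝ)) ∂arcLength
      ≤ ENNReal.ofReal (2 * Real.pi * (1 - ‖α‖)⁻¹) := by
  have hp := Real.pi_pos
  have hh : 0 < 1 - ‖α‖ := by linarith
  have hA : 0 < 1 - ‖α‖ ^ 2 := by nlinarith [norm_nonneg α]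
  have hpos : ∀ θ : ℝ, 0 < ‖Complex.exp (θ * Complex.I) - α‖ := fun θ =>
    lt_of_lt_of_le hh (one_sub_norm_le_norm_sub (Complex.norm_exp_ofReal_mul_I θ))
  have hcont : Continuous fun θ : ℝ => (1 - ‖α‖ ^ 2) / ‖Complex.exp (θ * Complex.I) - α‖ ^ 2 :=
    Continuous.div (by fun_prop) (by fun_prop) fun θ => (pow_pos (hpos θ) 2).ne'
  have hint := integral_poisson hα
  rw [intervalIntegral.integral_of_le (by positivity)] at hint
  rw [arcLength, lintegral_map (by fun_prop) measurable_exp_ofReal_mul_I]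
  calc ∫⁻ θ in Ioc (0 : ℝ) (2 * Real.pi),
        ENNReal.ofReal (‖Complex.exp (θ * Complex.I) - α‖ ^ (-2 : ℝ))
      = ∫⁻ θ in Ioc (0 : ℝ) (2 * Real.pi), ENNReal.ofReal (1 - ‖α‖ ^ 2)⁻¹ *
        ENNReal.ofReal ((1 - ‖α‖ ^ 2) / ‖Complex.exp (θ * Complex.I) - α‖ ^ 2) := by
        refine lintegral_congr fun θ => ?_
        rw [← ENNReal.ofReal_mul (by positivity), Real.rpow_neg (hpos θ).le, Real.rpow_two]
        congr 1
        have := (hpos θ).ne'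
        field_simp
    _ = ENNReal.ofReal ((1 - ‖α‖ ^ 2)⁻¹ * (2 * Real.pi)) := by
        rw [lintegral_const_mul' _ _ ENNReal.ofReal_ne_top, ← ofReal_integral_eq_lintegral_ofReal,
          hint, ← ENNReal.ofReal_mul (by positivity)]
        · exact (hcont.integrableOn_Icc (μ := volume)).mono_set Ioc_subset_Icc_self
        · exact Filter.Eventually.of_forall fun θ => div_nonneg hA.le (sq_nonneg _)
    _ ≤ _ := by
        rw [mul_comm]
        gcongr
        nlinarith [norm_nonneg α]

/-- The exponent beyond 2 is spent on |ξ - α| ≥ 1 - |α|; the remaining |ξ - α|⁻² is integrated with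
the Poisson kernel. -/
lemma lintegral_rpow_le_of_le_norm_sub_rpow {α : ℂ} (hα : ‖α‖ < 1) {A : ℂ → ℝ≥0∞} {c n s : ℝ}
    (hc : 0 ≤ c) (hs : 0 ≤ s) (hns : 2 ≤ n * s)
    (hA : ∀ ξ, ‖ξ‖ = 1 → A ξ ≤ ENNReal.ofReal (c * ‖ξ - α‖ ^ (-n))) :
    ∫⁻ ξ, A ξ ^ s ∂arcLength
      ≤ ENNReal.ofReal (c ^ s * (2 * Real.pi * (1 - ‖α‖) ^ (1 - n * s))) := by
  have hp := Real.pi_pos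
  have hh : 0 < 1 - ‖α‖ := by linarith
  calc ∫⁻ ξ, A ξ ^ s ∂arcLength
      ≤ ∫⁻ ξ, ENNReal.ofReal (c ^ s * (1 - ‖α‖) ^ (2 - n * s))
          * ENNReal.ofReal (‖ξ - α‖ ^ (-2 : ℝ)) ∂arcLength := by
        refine lintegral_mono_ae ?_
        filter_upwards [ae_arcLength_norm] with ξ hξ
        have hD := one_sub_norm_le_norm_sub (α := α) hξ
        have hD0 : 0 < ‖ξ - α‖ := hh.trans_le hD
        refine (ENNReal.rpow_le_rpow (hA ξ hξ) hs).trans ?_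
        rw [ENNReal.ofReal_rpow_of_nonneg (by positivity) hs, ← ENNReal.ofReal_mul (by positivity)]
        apply ENNReal.ofReal_le_ofReal
        rw [Real.mul_rpow hc (by positivity), mul_assoc]
        gcongr
        rw [← Real.rpow_mul hD0.le]
        have e : -n * s = (2 - n * s) + -2 := by ring
        rw [e, Real.rpow_add hD0]
        gcongr ?_ * _
        exact Real.rpow_le_rpow_of_nonpos hh hD (by linarith)
    _ ≤ ENNReal.ofReal (c ^ s * (1 - ‖α‖) ^ (2 - n * s))
          * ENNReal.ofReal (2 * Real.pi * (1 - ‖α‖)⁻¹) := by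
        rw [lintegral_const_mul' _ _ ENNReal.ofReal_ne_top]
        gcongr
        exact lintegral_norm_sub_rpow_neg_two_le hα
    _ = _ := by
        rw [← ENNReal.ofReal_mul (by positivity)]
        congr 1
        have e : 1 - n * s = (2 - n * s) - 1 := by ring
        rw [e, Real.rpow_sub_one hh.ne']
        ring

/-- An antiderivative is (2/D)(ρ/(D + ρ))^(1/2), vanishing at 0 and tending to 2/D. -/
lemma setLIntegral_radial_le {D : ℝ} (hD : 0 < D) :
    ∫⁻ ρ in Ioi (0 : ℝ), ENNReal.ofReal ρ *
      ENNReal.ofReal ((D + ρ) ^ (-(3 / 2) : ℝ) * ρ ^ (-(3 / 2) : ℝ)) ≤ ENNReal.ofReal (2 / D) := by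
  set g : ℝ → ℝ := fun ρ => 2 / D * (ρ / (D + ρ)) ^ (1 / 2 : ℝ) with hg
  set g' : ℝ → ℝ := fun ρ => ρ * ((D + ρ) ^ (-(3 / 2) : ℝ) * ρ ^ (-(3 / 2) : ℝ)) with hg'
  have hcont : ContinuousWithinAt g (Ici 0) 0 := by
    apply ContinuousAt.continuousWithinAt
    refine ContinuousAt.mul continuousAt_const (ContinuousAt.rpow_const ?_ (Or.inr (by norm_num)))
    exact ContinuousAt.div continuousAt_id (by fun_prop) (by simpa using hD.ne')
  have hderiv : ∀ x ∈ Ioi (0 : ℝ), HasDerivAt g (g' x) x := by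
    intro x (hx : 0 < x)
    have hDx : 0 < D + x := by linarith
    have h1 : HasDerivAt (fun ρ : ℝ => ρ / (D + ρ)) (D / (D + x) ^ 2) x := by
      have := (hasDerivAt_id x).div ((hasDerivAt_id x).const_add D) hDx.ne'
      exact this.congr_deriv (by simp)
    have h2 := (h1.rpow_const (p := 1 / 2) (Or.inl (by positivity))).const_mul (2 / D)
    refine h2.congr_deriv ?_
    rw [hg']
    simp only
    have e1 : (1 / 2 : ℝ) - 1 = -(1 / 2) := by norm_num
    have e2 : (D + x) ^ (-(3 / 2) : ℝ) = (D + x) ^ (1 / 2 : ℝ) / (D + x) ^ 2 := by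
      rw [← Real.rpow_two, ← Real.rpow_sub hDx]; norm_num
    have e3 : x ^ (-(3 / 2) : ℝ) = x ^ (-(1 / 2) : ℝ) / x := by
      rw [← Real.rpow_sub_one hx.ne']; norm_num
    rw [e1, Real.div_rpow hx.le hDx.le, e2, e3, Real.rpow_neg hDx.le]
    field_simp
  have hpos : ∀ x ∈ Ioi (0 : ℝ), 0 ≤ g' x := fun x (hx : 0 < x) => by positivity
  have hlim : Filter.Tendsto g Filter.atTop (nhds (2 / D)) := by
    have h1 : Filter.Tendsto (fun ρ : ℝ => ρ / (D + ρ)) Filter.atTop (nhds 1) := by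
      have h2 : Filter.Tendsto (fun ρ : ℝ => 1 - D / (D + ρ)) Filter.atTop (nhds (1 - 0)) :=
        (Filter.Tendsto.const_div_atTop (Filter.tendsto_atTop_add_const_left _ _ Filter.tendsto_id)
          D).const_sub 1
      rw [sub_zero] at h2
      refine h2.congr' ?_
      filter_upwards [Filter.eventually_gt_atTop 0] with x hx
      have : D + x ≠ 0 := by positivity
      field_simp
      ring
    have h3 := (h1.rpow_const (p := 1 / 2) (Or.inl one_ne_zero)).const_mul (2 / D)
    rw [Real.one_rpow, mul_one] at h3
    exact h3
  have hint := integrableOn_Ioi_deriv_of_nonneg hcont hderiv hpos hlim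
  have hval := integral_Ioi_of_hasDerivAt_of_nonneg hcont hderiv hpos hlim
  calc _ = ∫⁻ ρ in Ioi (0 : ℝ), ENNReal.ofReal (g' ρ) := by
        refine setLIntegral_congr_fun measurableSet_Ioi fun ρ (hρ : 0 < ρ) => ?_
        exact (ENNReal.ofReal_mul hρ.le).symm
    _ = ENNReal.ofReal (2 / D - g 0) := by
        rw [← hval, ofReal_integral_eq_lintegral_ofReal hint]
        filter_upwards [ae_restrict_mem measurableSet_Ioi] with x hx using hpos x hx
    _ ≤ _ := by
        apply ENNReal.ofReal_le_ofReal
        simp [hg]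

/-- To be read with t = 1 - |z|, u = |1 - conj α z|, r = |z - ξ|, h = 1 - |α|, D = |ξ - α|. Writing
1/t = t^(-3/2) t^(1/2) and using t^(1/2) ≤ (ε/h)^(1/2) u extracts the small factor ε^(1/2). The rest
is bounded by powers of r and D + r integrable over the plane. -/
lemma rpow_div_le_of_le {C D r t u h ε p : ℝ} (hC : 0 < C) (hD : 0 < D) (hr : 0 < r) (ht : 0 < t)
    (hu : 0 < u) (hh : 0 < h) (hε : 0 < ε) (hp : 1 ≤ p) (hrt : r ≤ C * t)
    (hDu : D + r ≤ (1 + 2 * C) * u) (hth : t * h ≤ ε * u ^ 2) :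
    u ^ (-(4 * p)) / t ≤ (1 + 2 * C) ^ (4 * p - 1) * C ^ (3 / 2 : ℝ) * ε ^ (1 / 2 : ℝ) *
      h ^ (-(1 / 2) : ℝ) * D ^ (-(4 * p - 5 / 2)) * ((D + r) ^ (-(3 / 2) : ℝ) * r ^ (-(3 / 2) : ℝ)) := by
  have hC2 : 0 < 1 + 2 * C := by positivity
  have hDr : 0 < D + r := by positivity
  have h1 : u ^ (-(4 * p)) / t ≤ ε ^ (1 / 2 : ℝ) * h ^ (-(1 / 2) : ℝ) *
      (u ^ (-(4 * p - 1)) * t ^ (-(3 / 2) : ℝ)) := by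
    have h2 : (t * h) ^ (1 / 2 : ℝ) ≤ (ε * u ^ 2) ^ (1 / 2 : ℝ) :=
      Real.rpow_le_rpow (by positivity) hth (by norm_num)
    rw [Real.mul_rpow ht.le hh.le, Real.mul_rpow hε.le (by positivity), ← Real.rpow_natCast,
      ← Real.rpow_mul hu.le] at h2
    norm_num at h2
    have e1 : u ^ (-(4 * p - 1)) = u ^ (-(4 * p)) * u := by
      rw [← Real.rpow_add_one hu.ne']; congr 1; ring
    have e2 : t ^ (-(3 / 2) : ℝ) * t ^ (1 / 2 : ℝ) = 1 / t := by
      have e : (-(3 / 2) + 1 / 2 : ℝ) = -1 := by norm_num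
      rw [← Real.rpow_add ht, e, Real.rpow_neg_one, one_div]
    have e3 : h ^ (-(1 / 2) : ℝ) * h ^ (1 / 2 : ℝ) = 1 := by
      rw [← Real.rpow_add hh]; norm_num
    calc u ^ (-(4 * p)) / t
        = h ^ (-(1 / 2) : ℝ) * u ^ (-(4 * p)) * t ^ (-(3 / 2) : ℝ) *
            (t ^ (1 / 2 : ℝ) * h ^ (1 / 2 : ℝ)) := by
          linear_combination (-u ^ (-(4 * p))) * e2
            - u ^ (-(4 * p)) * (t ^ (-(3 / 2) : ℝ) * t ^ (1 / 2 : ℝ)) * e3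
      _ ≤ h ^ (-(1 / 2) : ℝ) * u ^ (-(4 * p)) * t ^ (-(3 / 2) : ℝ) * (ε ^ (1 / 2 : ℝ) * u) := by
          gcongr
      _ = _ := by rw [e1]; ring
  have h2 : t ^ (-(3 / 2) : ℝ) ≤ C ^ (3 / 2 : ℝ) * r ^ (-(3 / 2) : ℝ) := by
    have h3 : r / C ≤ t := by rw [div_le_iff₀ hC]; linarith
    refine (Real.rpow_le_rpow_of_nonpos (by positivity) h3 (by norm_num)).trans_eq ?_
    rw [Real.div_rpow hr.le hC.le, Real.rpow_neg hC.le]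
    field_simp
  have h3 : u ^ (-(4 * p - 1)) ≤ (1 + 2 * C) ^ (4 * p - 1) *
      (D ^ (-(4 * p - 5 / 2)) * (D + r) ^ (-(3 / 2) : ℝ)) := by
    have h4 : (D + r) / (1 + 2 * C) ≤ u := by rw [div_le_iff₀ hC2]; linarith
    calc u ^ (-(4 * p - 1)) ≤ ((D + r) / (1 + 2 * C)) ^ (-(4 * p - 1)) :=
          Real.rpow_le_rpow_of_nonpos (by positivity) h4 (by linarith)
      _ = (1 + 2 * C) ^ (4 * p - 1) * ((D + r) ^ (-(4 * p - 5 / 2)) * (D + r) ^ (-(3 / 2) : ℝ)) := by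
          rw [Real.div_rpow hDr.le hC2.le, Real.rpow_neg hC2.le, ← Real.rpow_add hDr]
          have : -(4 * p - 5 / 2) + -(3 / 2) = -(4 * p - 1) := by ring
          rw [this]
          field_simp
      _ ≤ _ := by
          gcongr ?_ * (?_ * ?_)
          exact Real.rpow_le_rpow_of_nonpos hD (by linarith) (by linarith)
  calc u ^ (-(4 * p)) / t ≤ ε ^ (1 / 2 : ℝ) * h ^ (-(1 / 2) : ℝ) *
      (((1 + 2 * C) ^ (4 * p - 1) * (D ^ (-(4 * p - 5 / 2)) * (D + r) ^ (-(3 / 2) : ℝ)))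
        * (C ^ (3 / 2 : ℝ) * r ^ (-(3 / 2) : ℝ))) := h1.trans (by gcongr)
    _ = _ := by ring

/-- The test function `(1 - conj α * z)⁻⁴`. -/
noncomputable def testFun (α z : ℂ) : ℂ := ((1 - conj α * z) ^ 4)⁻¹

lemma norm_one_sub_conj_mul_pos {α z : ℂ} (hα : ‖α‖ < 1) (hz : ‖z‖ ≤ 1) :
    0 < ‖1 - conj α * z‖ :=
  lt_of_lt_of_le (by linarith) (one_sub_le_norm_one_sub_conj_mul α hz)

lemma enorm_testFun_rpow {α z : ℂ} (hα : ‖α‖ < 1) (hz : ‖z‖ < 1) (p : ℝ) :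
    ‖testFun α z‖ₑ ^ p = ENNReal.ofReal (‖1 - conj α * z‖ ^ (-(4 * p))) := by
  have hu := norm_one_sub_conj_mul_pos hα hz.le
  have h1 : ‖testFun α z‖ = ‖1 - conj α * z‖ ^ (-4 : ℝ) := by
    rw [testFun, norm_inv, norm_pow, Real.rpow_neg hu.le]
    norm_cast
  rw [← ofReal_norm, h1, ENNReal.ofReal_rpow_of_pos (by positivity), ← Real.rpow_mul hu.le]
  congr 2
  ring

lemma differentiableOn_testFun {α : ℂ} (hα : ‖α‖ < 1) :
    DifferentiableOn ℂ (testFun α) unitDisc := by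
  intro z hz
  have h0 : 1 - conj α * z ≠ 0 :=
    norm_pos_iff.1 (norm_one_sub_conj_mul_pos hα (mem_unitDisc.1 hz).le)
  exact DifferentiableWithinAt.inv (by fun_prop) (pow_ne_zero _ h0)

/-- In the cone |z - ξ| is at most a multiple of 1 - |z| ≤ |1 - conj α z|, so z may be replaced by
the vertex in 1 - conj α z. -/
lemma cone_estimates {β : ℝ} (hβ : β < 1) {α ξ z : ℂ} (hα : ‖α‖ < 1) (hξ : ‖ξ‖ = 1)
    (hz : z ∈ cone β ξ) : ‖z - ξ‖ ≤ 2 / (1 - β) * (1 - ‖z‖) ∧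
      ‖ξ - α‖ + ‖z - ξ‖ ≤ (1 + 2 * (2 / (1 - β))) * ‖1 - conj α * z‖ := by
  have h1 := norm_sub_le_of_mem_cone hβ hξ hz
  have h2 := one_sub_le_norm_one_sub_conj_mul' hα.le z
  have hb : 0 < 1 - β := by linarith
  have hC : 0 < 2 / (1 - β) := by positivity
  refine ⟨h1, ?_⟩
  rw [norm_sub_eq_norm_one_sub_conj_mul α hξ]
  have h3 : ‖1 - conj α * ξ‖ ≤ ‖1 - conj α * z‖ + ‖z - ξ‖ := by
    have e : 1 - conj α * ξ = (1 - conj α * z) + conj α * (z - ξ) := by ring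
    rw [e]
    refine (norm_add_le _ _).trans ?_
    rw [norm_mul, RCLike.norm_conj]
    nlinarith [norm_nonneg (z - ξ)]
  nlinarith

lemma tentMeasure_testFun_cone_le {β : ℝ} (hβ : β < 1) {p : ℝ} (hp : 1 ≤ p) {α : ℂ} (hα : ‖α‖ < 1)
    {E : Set ℂ} (hE : E ⊆ unitDisc) (hEm : MeasurableSet E) {ε : ℝ} (hε : 0 < ε)
    (H : ∀ z ∈ E, (1 - ‖z‖) * (1 - ‖α‖) ≤ ε * ‖1 - conj α * z‖ ^ 2) {ξ : ℂ} (hξ : ‖ξ‖ = 1) :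
    tentMeasure p E (testFun α) (cone β ξ) ≤ ENNReal.ofReal
      (4 * (1 + 2 * (2 / (1 - β))) ^ (4 * p - 1) * (2 / (1 - β)) ^ (3 / 2 : ℝ) * ε ^ (1 / 2 : ℝ) *
        (1 - ‖α‖) ^ (-(1 / 2) : ℝ) * ‖ξ - α‖ ^ (-(4 * p - 3 / 2))) := by
  have hb : 0 < 1 - β := by linarith
  have hC : 0 < 2 / (1 - β) := by positivity
  set C := 2 / (1 - β)
  have hh : 0 < 1 - ‖α‖ := by linarith
  have hD : 0 < ‖ξ - α‖ := hh.trans_le (one_sub_norm_le_norm_sub hξ)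
  set D := ‖ξ - α‖ with hDdef
  set c : ℝ := (1 + 2 * C) ^ (4 * p - 1) * C ^ (3 / 2 : ℝ) * ε ^ (1 / 2 : ℝ) *
      (1 - ‖α‖) ^ (-(1 / 2) : ℝ) * D ^ (-(4 * p - 5 / 2)) with hc
  have hc0 : 0 < c := by positivity
  have hmeas : MeasurableSet (cone β ξ ∩ E) := (measurableSet_cone β ξ).inter hEm
  rw [tentMeasure_cone, setLIntegral_area_of_subset (inter_subset_right.trans hE)]
  calc (ENNReal.ofReal Real.pi)⁻¹ * ∫⁻ z in cone β ξ ∩ E,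
        ‖testFun α z‖ₑ ^ p / ENNReal.ofReal (1 - ‖z‖)
      ≤ (ENNReal.ofReal Real.pi)⁻¹ * ∫⁻ z, ENNReal.ofReal c *
        ENNReal.ofReal ((D + ‖z - ξ‖) ^ (-(3 / 2) : ℝ) * ‖z - ξ‖ ^ (-(3 / 2) : ℝ)) := by
        refine mul_le_mul_right
          (le_trans (setLIntegral_mono' hmeas fun z hz => ?_) (setLIntegral_le_lintegral _ _)) _
        have hz1 := mem_unitDisc.1 (hE hz.2)
        have ht : 0 < 1 - ‖z‖ := by linarith
        have hr : 0 < ‖z - ξ‖ := by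
          rw [norm_pos_iff, sub_ne_zero]; rintro rfl; linarith
        obtain ⟨h1, h2⟩ := cone_estimates hβ hα hξ hz.1
        rw [enorm_testFun_rpow hα hz1, ← ENNReal.ofReal_div_of_pos ht,
          ← ENNReal.ofReal_mul hc0.le]
        apply ENNReal.ofReal_le_ofReal
        exact rpow_div_le_of_le hC hD hr ht (norm_one_sub_conj_mul_pos hα hz1.le) hh hε hp h1 h2
          (H z hz.2)
    _ ≤ (ENNReal.ofReal Real.pi)⁻¹ * (ENNReal.ofReal c * (ENNReal.ofReal (2 * Real.pi) *
          ENNReal.ofReal (2 / D))) := by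
        rw [lintegral_const_mul' _ _ ENNReal.ofReal_ne_top, lintegral_norm_sub (F := fun r =>
          ENNReal.ofReal ((D + r) ^ (-(3 / 2) : ℝ) * r ^ (-(3 / 2) : ℝ))) (by fun_prop) ξ]
        gcongr
        exact setLIntegral_radial_le hD
    _ = _ := by
        have hp := Real.pi_pos
        rw [← ENNReal.ofReal_inv_of_pos hp, ← ENNReal.ofReal_mul (by positivity),
          ← ENNReal.ofReal_mul hc0.le, ← ENNReal.ofReal_mul (by positivity)]
        congr 1
        have e : D ^ (-(4 * p - 3 / 2)) = D ^ (-(4 * p - 5 / 2)) / D := by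
          rw [← Real.rpow_sub_one hD.ne']; congr 1; ring
        rw [e, hc]
        field_simp
        ring

/-- Serves twice: ε = 1 on the whole disc gives finiteness of the norm, small ε off a
pseudohyperbolic disc gives a small contribution. The power of 1 - |α| is that of the lower bound
`exists_le_lintegral_tentMeasure_testFun`. -/
lemma exists_lintegral_tentMeasure_testFun_le {β p s : ℝ} (hβ : β < 1) (hp : 1 ≤ p) (hs : 0 < s)
    (hps : 1 ≤ p * s) : ∃ c : ℝ, 0 < c ∧ ∀ α : ℂ, ‖α‖ < 1 → ∀ E ⊆ unitDisc, MeasurableSet E →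
      ∀ ε : ℝ, 0 < ε → (∀ z ∈ E, (1 - ‖z‖) * (1 - ‖α‖) ≤ ε * ‖1 - conj α * z‖ ^ 2) →
      ∫⁻ ξ, tentMeasure p E (testFun α) (cone β ξ) ^ s ∂arcLength
        ≤ ENNReal.ofReal (c * ε ^ (s / 2) * (1 - ‖α‖) ^ (1 + s - 4 * (p * s))) := by
  have hb : 0 < 1 - β := by linarith
  have hpi := Real.pi_pos
  set c : ℝ := 4 * (1 + 2 * (2 / (1 - β))) ^ (4 * p - 1) * (2 / (1 - β)) ^ (3 / 2 : ℝ) with hc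
  have hc0 : 0 < c := by positivity
  refine ⟨2 * Real.pi * c ^ s, by positivity, fun α hα E hE hEm ε hε H => ?_⟩
  have hh : 0 < 1 - ‖α‖ := by linarith
  -- The fourth power in the test function is enough here: (4p - 3/2)s ≥ (5/2)ps ≥ 2.
  refine (lintegral_rpow_le_of_le_norm_sub_rpow hα (n := 4 * p - 3 / 2)
    (c := c * ε ^ (1 / 2 : ℝ) * (1 - ‖α‖) ^ (-(1 / 2) : ℝ)) (by positivity) hs.le
    (by nlinarith) fun ξ hξ => tentMeasure_testFun_cone_le hβ hp hα hE hEm hε H hξ).trans_eq ?_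
  congr 1
  rw [Real.mul_rpow (by positivity) (by positivity), Real.mul_rpow (by positivity) (by positivity),
    ← Real.rpow_mul hε.le, ← Real.rpow_mul hh.le]
  have e1 : 1 + s - 4 * (p * s) = -(1 / 2) * s + (1 - (4 * p - 3 / 2) * s) := by ring
  have e2 : (1 / 2 : ℝ) * s = s / 2 := by ring
  rw [e1, e2, Real.rpow_add hh]
  ring

lemma exists_lintegral_tentMeasure_testFun_inter_le {β p s : ℝ} (hβ : β < 1) (hp : 1 ≤ p)
    (hs : 0 < s) (hps : 1 ≤ p * s) : ∃ c : ℝ, 0 < c ∧ ∀ α : ℂ, ‖α‖ < 1 → ∀ η : ℝ, 0 < η → η < 1 →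
      ∀ G : Set ℂ, ∫⁻ ξ, tentMeasure p (G ∩ pseudoDisc α η) (testFun α) (cone β ξ) ^ s ∂arcLength
        ≤ ENNReal.ofReal (c * ((area (G ∩ pseudoDisc α η)).toReal / ((1 - η ^ 2) * (1 - ‖α‖) ^ 2)) ^ s
          * (1 - ‖α‖) ^ (1 + s - 4 * (p * s))) := by
  have hb : 0 < 1 - β := by linarith
  have hpi := Real.pi_pos
  set L : ℝ := 1 + 2 * (2 / (1 - β)) with hL
  have hL0 : 0 < L := by positivity
  refine ⟨2 * Real.pi * (4 * L ^ (4 * p)) ^ s, by positivity, fun α hα η hη0 hη G => ?_⟩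
  have hh : 0 < 1 - ‖α‖ := by linarith
  have hη2 : 0 < 1 - η ^ 2 := by nlinarith
  have hfin : area (G ∩ pseudoDisc α η) ≠ ∞ :=
    ((measure_mono inter_subset_right).trans_lt
      ((area_pseudoDisc_le hα hη0 hη).trans_lt ENNReal.ofReal_lt_top)).ne
  set M := (area (G ∩ pseudoDisc α η)).toReal with hM
  have hM0 : 0 ≤ M := ENNReal.toReal_nonneg
  refine (lintegral_rpow_le_of_le_norm_sub_rpow hα (n := 4 * p)
    (c := 4 * L ^ (4 * p) * (M / ((1 - η ^ 2) * (1 - ‖α‖)))) (by positivity) hs.le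
    (by nlinarith) fun ξ hξ => ?_).trans_eq ?_
  · have hD : 0 < ‖ξ - α‖ := hh.trans_le (one_sub_norm_le_norm_sub hξ)
    have hmeas : MeasurableSet (cone β ξ ∩ pseudoDisc α η) :=
      (measurableSet_cone β ξ).inter (measurableSet_pseudoDisc hα hη0 hη)
    rw [tentMeasure_cone]
    calc _ ≤ ∫⁻ _ in cone β ξ ∩ (G ∩ pseudoDisc α η), ENNReal.ofReal
          (4 * L ^ (4 * p) / ((1 - η ^ 2) * (1 - ‖α‖)) * ‖ξ - α‖ ^ (-(4 * p))) ∂area := by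
          refine lintegral_mono_ae (ae_restrict_of_ae_restrict_of_subset
            (inter_subset_inter_right _ inter_subset_right)
            (ae_restrict_of_forall_mem hmeas fun z hz => ?_))
          have hz1 := mem_unitDisc.1 hz.2.1
          have ht : 0 < 1 - ‖z‖ := by linarith
          have hu := norm_one_sub_conj_mul_pos hα hz1.le
          obtain ⟨-, h2⟩ := cone_estimates hβ hα hξ hz.1
          have h3 := (mem_pseudoDisc_iff hα hη0 hz1).1 hz.2
          have h4 := norm_one_sub_conj_mul_sq α z
          have h5 := one_sub_le_norm_one_sub_conj_mul α hz1.le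
          -- Inside the pseudohyperbolic disc (1 - η²)|1 - conj α z|² ≤ (1 - |α|²)(1 - |z|²), so the
          -- weight 1/(1 - |z|) is bounded there.
          have h6 : (1 - η ^ 2) * (1 - ‖α‖) ≤ 4 * (1 - ‖z‖) := by
            have h7 : (1 - η ^ 2) * ‖1 - conj α * z‖ ^ 2 ≤ 4 * (1 - ‖α‖) * (1 - ‖z‖) := by
              have : (1 - ‖α‖ ^ 2) * (1 - ‖z‖ ^ 2) ≤ 4 * (1 - ‖α‖) * (1 - ‖z‖) := by
                have := mul_le_mul (show 1 - ‖α‖ ^ 2 ≤ 2 * (1 - ‖α‖) by nlinarith [norm_nonneg α])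
                  (show 1 - ‖z‖ ^ 2 ≤ 2 * (1 - ‖z‖) by nlinarith [norm_nonneg z])
                  (by nlinarith [norm_nonneg z]) (by positivity)
                linarith
              linarith
            have h8 : (1 - ‖α‖) ^ 2 ≤ ‖1 - conj α * z‖ ^ 2 := by gcongr
            have h9 := mul_le_mul_of_nonneg_left h8 hη2.le
            refine le_of_mul_le_mul_right ?_ hh
            linarith
          have h10 : ‖1 - conj α * z‖ ^ (-(4 * p)) ≤ L ^ (4 * p) * ‖ξ - α‖ ^ (-(4 * p)) := by
            have h11 : ‖ξ - α‖ / L ≤ ‖1 - conj α * z‖ := by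
              rw [div_le_iff₀ hL0]; linarith [norm_nonneg (z - ξ)]
            refine (Real.rpow_le_rpow_of_nonpos (by positivity) h11 (by linarith)).trans_eq ?_
            rw [Real.div_rpow hD.le hL0.le, Real.rpow_neg hL0.le]
            field_simp
          rw [enorm_testFun_rpow hα hz1, ← ENNReal.ofReal_div_of_pos ht]
          apply ENNReal.ofReal_le_ofReal
          rw [div_le_iff₀ ht]
          calc _ ≤ L ^ (4 * p) * ‖ξ - α‖ ^ (-(4 * p)) := h10
            _ = L ^ (4 * p) / ((1 - η ^ 2) * (1 - ‖α‖)) * ‖ξ - α‖ ^ (-(4 * p)) *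
                ((1 - η ^ 2) * (1 - ‖α‖)) := by field_simp
            _ ≤ L ^ (4 * p) / ((1 - η ^ 2) * (1 - ‖α‖)) * ‖ξ - α‖ ^ (-(4 * p)) *
                (4 * (1 - ‖z‖)) := by gcongr
            _ = _ := by ring
      _ ≤ ENNReal.ofReal (4 * L ^ (4 * p) / ((1 - η ^ 2) * (1 - ‖α‖)) * ‖ξ - α‖ ^ (-(4 * p))) *
          ENNReal.ofReal M := by
          rw [setLIntegral_const, hM, ENNReal.ofReal_toReal hfin]
          exact mul_le_mul_right (measure_mono inter_subset_right) _
      _ = _ := by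
          rw [← ENNReal.ofReal_mul (by positivity)]
          congr 1
          ring
  · congr 1
    have e1 : M / ((1 - η ^ 2) * (1 - ‖α‖)) = M / ((1 - η ^ 2) * (1 - ‖α‖) ^ 2) * (1 - ‖α‖) := by
      field_simp
    have e2 : 1 + s - 4 * (p * s) = s + (1 - 4 * p * s) := by ring
    rw [e1, Real.mul_rpow (by positivity) (by positivity), Real.mul_rpow (by positivity) hh.le,
      e2, Real.rpow_add hh]
    ring

/-- With h = 1 - |α|, each ξ within h/4 of α/|α| has the ball of radius h/4 about α in its cone.
There |1 - conj α z| ≤ 3h and 1 - |z| ≤ 2h, and such ξ fill an arc of length at least h/4. -/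
lemma exists_le_lintegral_tentMeasure_testFun {p s : ℝ} (hp : 1 ≤ p) (hs : 0 < s) :
    ∃ c : ℝ, 0 < c ∧ ∀ α : ℂ, ‖α‖ < 1 →
      ENNReal.ofReal (c * (1 - ‖α‖) ^ (1 + s - 4 * (p * s))) ≤
        ∫⁻ ξ, tentMeasure p unitDisc (testFun α) (cone (1 / 2) ξ) ^ s ∂arcLength := by
  refine ⟨((3 : ℝ) ^ (-(4 * p)) / 32) ^ s / 4, by positivity, fun α hα => ?_⟩
  set h := 1 - ‖α‖ with hh'
  have hh : 0 < h := by linarith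
  have hh1 : h ≤ 1 := by linarith [norm_nonneg α]
  obtain ⟨ζ, hζ, hαζ⟩ := exists_radial α
  have hball : Metric.ball α (h / 4) ⊆ unitDisc := by
    intro z hz
    rw [mem_unitDisc]
    rw [mem_ball_iff_norm] at hz
    linarith [norm_le_norm_add_norm_sub' z α]
  have key : ∀ ξ ∈ Metric.sphere (0 : ℂ) 1 ∩ Metric.ball ζ (h / 4),
      ENNReal.ofReal ((3 * h) ^ (-(4 * p)) / (2 * h) * (h / 4) ^ 2)
        ≤ tentMeasure p unitDisc (testFun α) (cone (1 / 2) ξ) := by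
    intro ξ hξ
    have hξ2 : ‖ξ - ζ‖ < (1 - ‖α‖) / 4 := mem_ball_iff_norm.1 hξ.2
    rw [tentMeasure_cone, ENNReal.ofReal_mul (by positivity),
      ← area_ball_eq (by positivity) hball, ← setLIntegral_const]
    refine (setLIntegral_mono' measurableSet_ball fun z hz => ?_).trans
      (lintegral_mono_set fun z hz => ⟨mem_cone_half hα hαζ hξ2 (mem_ball_iff_norm.1 hz).le,
        hball hz⟩)
    have hz1 := mem_unitDisc.1 (hball hz)
    have ht : 0 < 1 - ‖z‖ := by linarith
    have hza := mem_ball_iff_norm.1 hz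
    have hu := norm_one_sub_conj_mul_pos hα hz1.le
    have hu3 : ‖1 - conj α * z‖ ≤ 3 * h := by
      have e : 1 - conj α * z = (1 - conj α * α) + conj α * (α - z) := by ring
      have e2 : ‖1 - conj α * α‖ = 1 - ‖α‖ ^ 2 := by
        rw [Complex.conj_mul', ← Complex.ofReal_pow, ← Complex.ofReal_one, ← Complex.ofReal_sub,
          Complex.norm_real, Real.norm_of_nonneg (by nlinarith [norm_nonneg α])]
      rw [e]
      refine (norm_add_le _ _).trans ?_
      rw [e2, norm_mul, RCLike.norm_conj, norm_sub_rev]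
      nlinarith [norm_nonneg α, norm_nonneg (z - α)]
    have ht2 : 1 - ‖z‖ ≤ 2 * h := by linarith [norm_le_norm_add_norm_sub z α]
    rw [enorm_testFun_rpow hα hz1, ← ENNReal.ofReal_div_of_pos ht]
    apply ENNReal.ofReal_le_ofReal
    gcongr ?_ / ?_
    exact Real.rpow_le_rpow_of_nonpos hu hu3 (by linarith)
  calc ENNReal.ofReal (((3 : ℝ) ^ (-(4 * p)) / 32) ^ s / 4 * h ^ (1 + s - 4 * (p * s)))
      = ENNReal.ofReal ((3 * h) ^ (-(4 * p)) / (2 * h) * (h / 4) ^ 2) ^ s *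
          ENNReal.ofReal (h / 4) := by
        rw [ENNReal.ofReal_rpow_of_nonneg (by positivity) hs.le, ← ENNReal.ofReal_mul (by positivity)]
        congr 1
        have e1 : (3 * h) ^ (-(4 * p)) / (2 * h) * (h / 4) ^ 2
            = (3 : ℝ) ^ (-(4 * p)) / 32 * (h ^ (-(4 * p)) * h) := by
          rw [Real.mul_rpow (by norm_num) hh.le]
          field_simp
          ring
        have e2 : 1 + s - 4 * (p * s) = (-(4 * p)) * s + s + 1 := by ring
        rw [e1, Real.mul_rpow (by positivity) (by positivity),
          Real.mul_rpow (by positivity) (by positivity), e2, Real.rpow_add_one hh.ne',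
          Real.rpow_add hh, Real.rpow_mul hh.le]
        ring
    _ ≤ ENNReal.ofReal ((3 * h) ^ (-(4 * p)) / (2 * h) * (h / 4) ^ 2) ^ s *
          arcLength (Metric.ball ζ (h / 4)) := by
        gcongr
        exact le_arcLength_ball hζ (by linarith)
    _ = ∫⁻ _ in Metric.ball ζ (h / 4),
          ENNReal.ofReal ((3 * h) ^ (-(4 * p)) / (2 * h) * (h / 4) ^ 2) ^ s ∂arcLength := by
        rw [setLIntegral_const]
    _ ≤ ∫⁻ ξ in Metric.ball ζ (h / 4),
          tentMeasure p unitDisc (testFun α) (cone (1 / 2) ξ) ^ s ∂arcLength := by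
        refine lintegral_mono_ae ?_
        filter_upwards [ae_restrict_of_ae ae_arcLength_norm,
          ae_restrict_mem measurableSet_ball] with ξ h1 h2
        exact ENNReal.rpow_le_rpow (key ξ ⟨by simpa using h1, h2⟩) hs.le
    _ ≤ _ := setLIntegral_le_lintegral _ _

/-! ### Domination implies density -/

lemma testFun_mem_analyticTentSpace {p q : ℝ} (hp : 1 ≤ p) (hq : 1 ≤ q) {α : ℂ} (hα : ‖α‖ < 1) :
    testFun α ∈ analyticTentSpace p q := by
  have hd := differentiableOn_testFun hα
  refine ⟨hd, hd.continuousOn.aemeasurable Metric.isOpen_ball.measurableSet, ?_⟩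
  have hp0 : 0 < p := by linarith
  obtain ⟨c, -, hc⟩ := exists_lintegral_tentMeasure_testFun_le (β := 1 / 2) (s := q / p)
    (by norm_num) hp (by positivity) (by rwa [mul_div_cancel₀ _ hp0.ne'])
  rw [tentNorm, tentFunctional_eq]
  refine ENNReal.rpow_lt_top_of_nonneg (by positivity) ((hc α hα unitDisc subset_rfl
    Metric.isOpen_ball.measurableSet 1 one_pos fun z hz => ?_).trans_lt ENNReal.ofReal_lt_top).ne
  have hz1 := mem_unitDisc.1 hz
  have h1 := one_sub_le_norm_one_sub_conj_mul α hz1.le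
  have h2 := one_sub_le_norm_one_sub_conj_mul' hα.le z
  rw [one_mul, sq]
  exact mul_le_mul h2 h1 (by linarith) (norm_nonneg _)

lemma tentMeasure_cone_le_add {β p : ℝ} {G : Set ℂ} (hG : G ⊆ unitDisc) (D : Set ℂ) (f : ℂ → ℂ)
    (ξ : ℂ) : tentMeasure p G f (cone β ξ) ≤
      tentMeasure p (unitDisc \ D) f (cone β ξ) + tentMeasure p (G ∩ D) f (cone β ξ) := by
  simp only [tentMeasure_cone]
  refine (lintegral_mono_set fun z hz => ?_).trans (lintegral_union_le _ _ _)
  by_cases h : z ∈ D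
  · exact Or.inr ⟨hz.1, hz.2, h⟩
  · exact Or.inl ⟨hz.1, hG hz.2, h⟩

lemma exists_rpow_mul_le {a b s : ℝ} (ha : 0 < a) (hb : 0 < b) (hs : 0 < s) :
    ∃ ε : ℝ, 0 < ε ∧ ε < 1 ∧ a * ε ^ s ≤ b := by
  refine ⟨min (1 / 2) ((b / a) ^ s⁻¹), lt_min (by norm_num) (by positivity),
    (min_le_left _ _).trans_lt (by norm_num), ?_⟩
  calc a * (min (1 / 2) ((b / a) ^ s⁻¹)) ^ s ≤ a * ((b / a) ^ s⁻¹) ^ s := by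
        gcongr
        exact min_le_right _ _
    _ = b := by
        rw [← Real.rpow_mul (by positivity), inv_mul_cancel₀ hs.ne', Real.rpow_one]
        field_simp

theorem pseudoDisc_density_of_le_tentFunctional {p q β K : ℝ} (hp : 1 ≤ p) (hq : 1 ≤ q)
    (hβ : β < 1) (hK : 0 < K) {G : Set ℂ} (hG : G ⊆ unitDisc)
    (H : ∀ f ∈ analyticTentSpace p q,
      ENNReal.ofReal K * tentNorm p q f ≤ tentFunctional β p q G f) :
    ∃ η : ℝ, 0 < η ∧ η < 1 ∧ ∃ δ : ℝ, 0 < δ ∧ ∀ α ∈ unitDisc,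
      ENNReal.ofReal δ * area (pseudoDisc α η) ≤ area (G ∩ pseudoDisc α η) := by
  have hp0 : 0 < p := by linarith
  have hq0 : 0 < q := by linarith
  set s := q / p with hs'
  have hs : 0 < s := by positivity
  have hps : 1 ≤ p * s := by rwa [hs', mul_div_cancel₀ _ hp0.ne']
  obtain ⟨a, ha, hfar⟩ := exists_lintegral_tentMeasure_testFun_le hβ hp hs hps
  obtain ⟨b, hb, hnear⟩ := exists_lintegral_tentMeasure_testFun_inter_le hβ hp hs hps
  obtain ⟨c, hc, hlow⟩ := exists_le_lintegral_tentMeasure_testFun hp hs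
  -- The far part may use up at most half of the lower bound K^q c; the radius η is then fixed by 1
  -- - η² = ε.
  obtain ⟨ε, hε, hε1, hεs⟩ := exists_rpow_mul_le (a := 2 ^ s * a) (b := K ^ q * c / 2)
    (s := s / 2) (by positivity) (by positivity) (by positivity)
  have hη2 : 1 - √(1 - ε) ^ 2 = ε := by rw [Real.sq_sqrt (by linarith)]; ring
  have hη0 : 0 < √(1 - ε) := Real.sqrt_pos.2 (by linarith)
  have hη : √(1 - ε) < 1 := by rw [Real.sqrt_lt' one_pos]; linarith
  set η := √(1 - ε)
  set d := (K ^ q * c / 2 / (2 ^ s * b)) ^ s⁻¹ with hd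
  have hd0 : 0 < d := by positivity
  refine ⟨η, hη0, hη, d * ε / (2 / ε) ^ 2, by positivity, fun α hα => ?_⟩
  rw [mem_unitDisc] at hα
  have hh : 0 < 1 - ‖α‖ := by linarith
  have hfin : area (G ∩ pseudoDisc α η) ≠ ∞ :=
    ((measure_mono inter_subset_right).trans_lt
      ((area_pseudoDisc_le hα hη0 hη).trans_lt ENNReal.ofReal_lt_top)).ne
  set M := (area (G ∩ pseudoDisc α η)).toReal with hM
  have hM0 : 0 ≤ M := ENNReal.toReal_nonneg
  have hmeas := measurableSet_pseudoDisc hα hη0 hη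
  have hfar' := hfar α hα (unitDisc \ pseudoDisc α η) sdiff_subset
    (Metric.isOpen_ball.measurableSet.diff hmeas) ε hε fun z hz => by
      have hz1 := mem_unitDisc.1 hz.1
      -- Off the disc, (1 - |α|²)(1 - |z|²) = |1 - conj α z|² - |α - z|² ≤ ε|1 - conj α z|².
      have h1 : ¬ _ := fun h => hz.2 ((mem_pseudoDisc_iff hα hη0 hz1).2 h)
      have h2 := norm_one_sub_conj_mul_sq α z
      have h3 : (1 - ‖z‖) * (1 - ‖α‖) ≤ (1 - ‖α‖ ^ 2) * (1 - ‖z‖ ^ 2) := by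
        rw [mul_comm]
        exact mul_le_mul (by nlinarith [norm_nonneg α]) (by nlinarith [norm_nonneg z])
          (by linarith) (by nlinarith [norm_nonneg α])
      have h4 : η ^ 2 = 1 - ε := by linarith
      rw [h4] at h1
      linarith
  have hnear' := hnear α hα η hη0 hη G
  rw [hη2] at hnear'
  set P := (1 - ‖α‖) ^ (1 + s - 4 * (p * s)) with hP
  have hP0 : 0 < P := by positivity
  have hmain : ENNReal.ofReal (K ^ q) *
      ∫⁻ ξ, tentMeasure p unitDisc (testFun α) (cone (1 / 2) ξ) ^ s ∂arcLength
      ≤ ∫⁻ ξ, tentMeasure p G (testFun α) (cone β ξ) ^ s ∂arcLength := by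
    have h1 := ENNReal.rpow_le_rpow (H _ (testFun_mem_analyticTentSpace hp hq hα)) hq0.le
    rw [tentNorm, tentFunctional_eq, tentFunctional_eq, ENNReal.mul_rpow_of_nonneg _ _ hq0.le,
      ← ENNReal.rpow_mul, ← ENNReal.rpow_mul, one_div_mul_cancel hq0.ne', ENNReal.rpow_one,
      ENNReal.rpow_one, ENNReal.ofReal_rpow_of_pos hK] at h1
    exact h1
  have hup : ∫⁻ ξ, tentMeasure p G (testFun α) (cone β ξ) ^ s ∂arcLength ≤
      ENNReal.ofReal (2 ^ s * (a * ε ^ (s / 2) * P + b * (M / (ε * (1 - ‖α‖) ^ 2)) ^ s * P)) := by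
    calc _ ≤ ∫⁻ ξ, 2 ^ s * (tentMeasure p (unitDisc \ pseudoDisc α η) (testFun α) (cone β ξ) ^ s +
          tentMeasure p (G ∩ pseudoDisc α η) (testFun α) (cone β ξ) ^ s) ∂arcLength :=
          lintegral_mono fun ξ => (ENNReal.rpow_le_rpow (tentMeasure_cone_le_add hG _ _ ξ)
            hs.le).trans (add_rpow_le_two_rpow_mul hs.le _ _)
      _ = 2 ^ s * (∫⁻ ξ, tentMeasure p (unitDisc \ pseudoDisc α η) (testFun α) (cone β ξ) ^ s
            ∂arcLength + ∫⁻ ξ, tentMeasure p (G ∩ pseudoDisc α η) (testFun α) (cone β ξ) ^ s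
            ∂arcLength) := by
          rw [lintegral_const_mul' _ _ (by simp),
            lintegral_add_left ((measurable_measure_cone β _).pow_const s)]
      _ ≤ _ := by
          rw [ENNReal.ofReal_mul (by positivity), ENNReal.ofReal_add (by positivity)
            (by positivity), ← ENNReal.ofReal_rpow_of_pos two_pos, ENNReal.ofReal_ofNat]
          gcongr
  have hreal : K ^ q * (c * P) ≤
      2 ^ s * (a * ε ^ (s / 2) * P + b * (M / (ε * (1 - ‖α‖) ^ 2)) ^ s * P) := by
    rw [← ENNReal.ofReal_le_ofReal_iff (by positivity), ENNReal.ofReal_mul (by positivity)]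
    exact (mul_le_mul_right (hlow α hα) _).trans (hmain.trans hup)
  -- The common factor P cancels, so the lower bound for the normalised area of G in the disc does
  -- not depend on α.
  have hreal2 : K ^ q * c / 2 / (2 ^ s * b) ≤ (M / (ε * (1 - ‖α‖) ^ 2)) ^ s := by
    rw [div_le_iff₀ (by positivity)]
    have : K ^ q * c ≤ 2 ^ s * a * ε ^ (s / 2) + (M / (ε * (1 - ‖α‖) ^ 2)) ^ s * (2 ^ s * b) :=
      le_of_mul_le_mul_right (by linarith) hP0
    linarith
  have hdM : d * ε * (1 - ‖α‖) ^ 2 ≤ M := by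
    have h1 := Real.rpow_le_rpow (by positivity) hreal2 (inv_pos.2 hs).le
    rw [← Real.rpow_mul (by positivity), mul_inv_cancel₀ hs.ne', Real.rpow_one,
      le_div_iff₀ (by positivity)] at h1
    linarith
  calc ENNReal.ofReal (d * ε / (2 / ε) ^ 2) * area (pseudoDisc α η)
      ≤ ENNReal.ofReal (d * ε / (2 / ε) ^ 2) * ENNReal.ofReal ((2 / ε) ^ 2 * (1 - ‖α‖) ^ 2) := by
        gcongr
        simpa only [hη2] using area_pseudoDisc_le hα hη0 hη
    _ = ENNReal.ofReal (d * ε * (1 - ‖α‖) ^ 2) := by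
        rw [← ENNReal.ofReal_mul (by positivity)]
        congr 1
        field_simp
    _ ≤ ENNReal.ofReal M := ENNReal.ofReal_le_ofReal hdM
    _ = _ := by rw [hM, ENNReal.ofReal_toReal hfin]

end AnalyticTent

theorem mainTheorem1 (p q : ℝ) (hp : 1 ≤ p) (hq : 1 ≤ q) (G : Set ℂ)
    (hG : G ⊆ AnalyticTent.unitDisc) (hGm : NullMeasurableSet G (volume : Measure ℂ)) :
    List.TFAE [
      ∃ β : ℝ, 0 < β ∧ β < 1 ∧ ∃ K : ℝ, 0 < K ∧
        ∀ f ∈ AnalyticTent.analyticTentSpace p q,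
          ENNReal.ofReal K * AnalyticTent.tentNorm p q f
            ≤ AnalyticTent.tentFunctional β p q G f,
      ∃ η : ℝ, 0 < η ∧ η < 1 ∧ ∃ δ : ℝ, 0 < δ ∧
        ∀ α ∈ AnalyticTent.unitDisc,
          ENNReal.ofReal δ * AnalyticTent.area (AnalyticTent.pseudoDisc α η)
            ≤ AnalyticTent.area (G ∩ AnalyticTent.pseudoDisc α η),
      ∃ η : ℝ, 0 < η ∧ η < 1 ∧ ∃ δ : ℝ, 0 < δ ∧
        ∀ α ∈ AnalyticTent.unitDisc,
          ENNReal.ofReal δ * AnalyticTent.area (AnalyticTent.euclDisc η α)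
            ≤ AnalyticTent.area (G ∩ AnalyticTent.euclDisc η α)] := by
  tfae_have 1 → 2 := fun ⟨_, _, hβ, _, hK, H⟩ =>
    AnalyticTent.pseudoDisc_density_of_le_tentFunctional hp hq hβ hK hG H
  tfae_have 2 → 3 := fun ⟨_, hη0, hη, _, hδ, H⟩ =>
    AnalyticTent.euclDisc_density_of_pseudoDisc_density hη0 hη hδ H
  tfae_have 3 → 2 := fun ⟨_, hη0, hη, _, hδ, H⟩ =>
    AnalyticTent.pseudoDisc_density_of_euclDisc_density hη0 hη hδ H
  tfae_have 3 → 1 := fun ⟨_, hη0, hη, _, hδ, H⟩ =>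
    AnalyticTent.exists_le_tentFunctional_of_density (by linarith) (by linarith) hη0 hη hδ hG hGm H
  tfae_finish
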